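/- Let $0\le\alpha<1$, $\beta\ge 0$, $0<\alpha+\beta\le 1$. For $n\ge1$ let $X=(X_1,\dots,X_n)$ follow the multiple blocks model $$X_i=\mu\,\mathbf 1\Big(i\in\bigcup_{g=1}^m I_g\Big)+Z_i,\qquad i=1,\dots,n,$$ where $Z_1,\dots,Z_n$ are i.i.d. standard normal and, independently of the $Z_i$, $\{I_1,\dots,I_m\}$ is uniformly distributed over all collections of $m=\lfloor n^{1-\alpha-\beta}\rfloor$ mutually disjoint intervals $I_g=(j_g,j_g+b]\subset(0,n]$, $j_g\in\mathbb Z$, of length $b=\lfloor n^\alpha\rfloor$. We test $H_0:\mu=0$ against $H_1:\mu=\mu(n)$ with one of the statistics $$P_n=\max_{0\le j<k\le n}\Big(\frac{\sum_{i=j+1}^kX_i}{\sqrt{k-j}}-\sqrt{2\log\tfrac{en}{k-j}}\Big),\qquad P_n^{app}=\max_{I\in\bigcup_{\ell=0}^{\ell_{max}}\mathcal I_{app}(\ell)}\Big(\frac{\sum_{i\in I}X_i}{\sqrt{|I|}}-\sqrt{2\log\tfrac{en}{|I|}}\Big),$$ rejecting $H_0$ for large values. Here $\ell_{max}=\lceil\log_2\frac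 n8\rceil$ (read as $0$ if negative) and $\mathcal I_{app}(\ell)$ is the set of all $(j,k]\subset(0,n]$ such that $j,k$ are integer multiples of $d_\ell=\lceil\epsilon_\ell2^{\ell-1}\rceil$ and $2^{\ell-1}<k-j\le2^\ell$, where $\epsilon_\ell=\big(6\sqrt{\log_2(n/2^{\ell-1})}\big)^{-1}$. Put $$\rho^*_{pen}(\alpha,\beta)=\begin{cases}\beta-\frac{1-\alpha}2&\text{if }\frac{\beta}{1-\alpha}<\frac12,\\ \big(\sqrt{1-\alpha}-\sqrt{1-\alpha-\beta}\big)^2&\text{if }\frac{\beta}{1-\alpha}>\frac12,\end{cases}$$ and calibrate the mean as $\mu(n)=n^r/\sqrt{n^\alpha}$ with $r\in\mathbb R$ in the first (dense) case and as $\mu(n)=\sqrt{2r\log n}/\sqrt{n^\alpha}$ with $r>0$ in the second (sparse) case. Then $\rho^*_{pen}$ is the detection boundary of $P_n$ and of $P_n^{app}$; that is, in each case, for $T_n=P_n$ and for $T_n=P_n^{app}$: 1. If $r>\rho^*_{pen}(\alpha,\beta)$, then $T_n$ has asymptotic power one: there are critical values $t_n$ for which the sum of the type I and type II errors of the test rejecting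 when $T_n>t_n$ tends to $0$, and for every choice of critical values whose type I error is eventually bounded below by a positive constant the power tends to $1$. 2. If $r<\rho^*_{pen}(\alpha,\beta)$, then $T_n$ is powerless: for every sequence of critical values $t_n\in\mathbb R$ the sum of the type I and type II errors of the test rejecting when $T_n>t_n$ tends to $1$. Moreover, let $\rho^*(\alpha,\beta)$ be the optimal detection boundary of the model, i.e. $\rho^*(\alpha,\beta)=\beta-\frac{1-\alpha}2$ if $\frac\beta{1-\alpha}<\frac34$ and $\rho^*(\alpha,\beta)=\big(\sqrt{1-\alpha}-\sqrt{1-\alpha-\beta}\big)^2$ if $\frac\beta{1-\alpha}\ge\frac34$. Then $\rho^*_{pen}(\alpha,\beta)>\rho^*(\alpha,\beta)$ if $\frac{1-\alpha}2<\beta<\frac{3(1-\alpha)}4$, and $\rho^*_{pen}(\alpha,\beta)=\rho^*(\alpha,\beta)$ if $\beta<\frac{1-\alpha}2$ or $\beta\ge\frac{3(1-\alpha)}4$. -/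

import Mathlib

open Filter Topology MeasureTheory ProbabilityTheory
open scoped ENNReal NNReal

noncomputable section

namespace BlockScan

/-! ### The multiple blocks model

The design points are `1, …, n`; the coordinate `i : Fin n` of the data vector is the observation at
the design point `i + 1`.  An interval `(j, k]` is stored as the pair `(j, k)`. -/

/-- Block length `n ^ α`, rounded down to an integer. -/
def blockLength (α : ℝ) (n : ℕ) : ℕ := ⌊(n : ℝ) ^ α⌋₊

/-- Number of blocks `n ^ (1 - α - β)`, rounded down to an integer. -/
def numBlocks (α β : ℝ) (n : ℕ) : ℕ := ⌊(n : ℝ) ^ (1 - α - β)⌋₊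

/-- All ways of placing `m` mutually disjoint blocks `(j, j + b] ⊆ (0, n]`; a placement is recorded
by the set of left endpoints of its blocks. -/
def placements (n b m : ℕ) : Finset (Finset ℕ) :=
  ((Finset.range (n + 1)).powersetCard m).filter fun S =>
    (∀ j ∈ S, j + b ≤ n) ∧
      ∀ j ∈ S, ∀ k ∈ S, j ≠ k → Disjoint (Finset.Ioc j (j + b)) (Finset.Ioc k (k + b))

/-- The union of the blocks of a placement. -/
def support (b : ℕ) (S : Finset ℕ) : Finset ℕ := S.biUnion fun j => Finset.Ioc j (j + b)

/-- Law of the data under `H₀`: i.i.d. standard normal observations. -/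
def nullLaw (n : ℕ) : Measure (Fin n → ℝ) := Measure.pi fun _ => gaussianReal 0 1

/-- The data vector `Xᵢ = μ 1(i ∈ ⋃ I_g) + Zᵢ` for a given placement and a given noise vector. -/
def observe (n b : ℕ) (μ : ℝ) (S : Finset ℕ) (z : Fin n → ℝ) : Fin n → ℝ :=
  fun i => (if (i : ℕ) + 1 ∈ support b S then μ else 0) + z i

/-- Law of the data in the model with `m` blocks of length `b` and elevated mean `μ`: the placement
of the blocks is uniformly distributed and independent of the standard normal noise. -/
def blocksLaw (n b m : ℕ) (μ : ℝ) : Measure (Fin n → ℝ) :=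
  ∑ S ∈ placements n b m,
    ((placements n b m).card : ℝ≥0∞)⁻¹ • (nullLaw n).map (observe n b μ S)

/-- Elevated mean in the dense calibration. -/
def denseMean (α r : ℝ) (n : ℕ) : ℝ := (n : ℝ) ^ r / √((n : ℝ) ^ α)

/-- Elevated mean in the sparse calibration. -/
def sparseMean (α r : ℝ) (n : ℕ) : ℝ := √(2 * r * Real.log n) / √((n : ℝ) ^ α)

/-- Law of the data under `H₁`, for a given calibration `μ = μ(n)` of the elevated mean. -/
def altLaw (α β : ℝ) (μ : ℕ → ℝ) (n : ℕ) : Measure (Fin n → ℝ) :=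
  blocksLaw n (blockLength α n) (numBlocks α β n) (μ n)

/-! ### The penalized scans -/

/-- All intervals `(j, k]` with `0 ≤ j < k ≤ n`. -/
def allIntervals (n : ℕ) : Finset (ℕ × ℕ) :=
  (Finset.range (n + 1) ×ˢ Finset.range (n + 1)).filter fun I => I.1 < I.2

/-- The largest level `⌈log₂ (n / 8)⌉`. -/
def maxLevel (n : ℕ) : ℕ := ⌈Real.logb 2 ((n : ℝ) / 8)⌉₊

/-- The relative precision at level `l`. -/
def precision (n l : ℕ) : ℝ := 1 / (6 * √(Real.logb 2 ((n : ℝ) / (2 : ℝ) ^ ((l : ℤ) - 1))))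

/-- The grid spacing at level `l`. -/
def spacing (n l : ℕ) : ℕ := ⌈precision n l * (2 : ℝ) ^ ((l : ℤ) - 1)⌉₊

/-- The approximating intervals at level `l`: both endpoints are multiples of the grid spacing, and
the length lies in `(2 ^ (l - 1), 2 ^ l]`. -/
def appIntervalsAt (n l : ℕ) : Finset (ℕ × ℕ) :=
  (allIntervals n).filter fun I =>
    spacing n l ∣ I.1 ∧ spacing n l ∣ I.2 ∧ 2 ^ l < 2 * (I.2 - I.1) ∧ I.2 - I.1 ≤ 2 ^ l

/-- The approximating set of intervals. -/
def appIntervals (n : ℕ) : Finset (ℕ × ℕ) :=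
  (Finset.range (maxLevel n + 1)).biUnion (appIntervalsAt n)

/-- The penalized standardized sum of the data over the interval `I = (j, k]`. -/
def penalizedSum (n : ℕ) (x : Fin n → ℝ) (I : ℕ × ℕ) : ℝ :=
  (∑ i ∈ Finset.univ.filter (fun i : Fin n => (i : ℕ) + 1 ∈ Finset.Ioc I.1 I.2), x i)
      / √((I.2 : ℝ) - I.1)
    - √(2 * Real.log (Real.exp 1 * n / ((I.2 : ℝ) - I.1)))

/-- The penalized scan: a maximum over a finite set that is nonempty for `n ≥ 1`. -/
def scan (n : ℕ) (x : Fin n → ℝ) : ℝ :=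
  sSup (penalizedSum n x '' (allIntervals n : Set (ℕ × ℕ)))

/-- The penalized scan evaluated on the approximating set only. -/
def scanApp (n : ℕ) (x : Fin n → ℝ) : ℝ :=
  sSup (penalizedSum n x '' (appIntervals n : Set (ℕ × ℕ)))

/-! ### Asymptotic performance of tests that reject for large values of a statistic -/

/-- Type I error of the test that rejects `H₀` when `T > t`. -/
def typeI (T : (n : ℕ) → (Fin n → ℝ) → ℝ) (n : ℕ) (t : ℝ) : ℝ :=
  (nullLaw n).real {x | t < T n x}

/-- Type II error, under the alternative `Q`, of the test that rejects `H₀` when `T > t`. -/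
def typeII (T : (n : ℕ) → (Fin n → ℝ) → ℝ) (Q : (n : ℕ) → Measure (Fin n → ℝ)) (n : ℕ) (t : ℝ) :
    ℝ :=
  (Q n).real {x | T n x ≤ t}

/-- `T` has asymptotic power one: suitable critical values make both errors vanish, and with every
choice of critical values whose significance level stays away from `0` the power tends to one. -/
def HasAsymptoticPowerOne (T : (n : ℕ) → (Fin n → ℝ) → ℝ) (Q : (n : ℕ) → Measure (Fin n → ℝ)) :
    Prop :=
  (∃ t : ℕ → ℝ, Tendsto (fun n => typeI T n (t n) + typeII T Q n (t n)) atTop (𝓝 0)) ∧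
    ∀ a : ℝ, 0 < a → ∀ t : ℕ → ℝ, (∀ᶠ n in atTop, a ≤ typeI T n (t n)) →
      Tendsto (fun n => typeII T Q n (t n)) atTop (𝓝 0)

/-- `T` is asymptotically powerless: whatever the critical values, the sum of the two errors tends
to one. -/
def IsPowerless (T : (n : ℕ) → (Fin n → ℝ) → ℝ) (Q : (n : ℕ) → Measure (Fin n → ℝ)) : Prop :=
  ∀ t : ℕ → ℝ, Tendsto (fun n => typeI T n (t n) + typeII T Q n (t n)) atTop (𝓝 1)

/-- `ρ` is the detection boundary of `T` for a family `Q r` of alternatives indexed by a signal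
strength `r` that ranges over `R`. -/
def IsDetectionBoundary (T : (n : ℕ) → (Fin n → ℝ) → ℝ)
    (Q : ℝ → (n : ℕ) → Measure (Fin n → ℝ)) (R : Set ℝ) (ρ : ℝ) : Prop :=
  ∀ r ∈ R, (ρ < r → HasAsymptoticPowerOne T (Q r)) ∧ (r < ρ → IsPowerless T (Q r))

/-- The detection boundary of the penalized scans (used for `β / (1 - α) ≠ 1 / 2`). -/
def rhoPen (α β : ℝ) : ℝ :=
  if β / (1 - α) < 1 / 2 then β - (1 - α) / 2 else (√(1 - α) - √(1 - α - β)) ^ 2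

/-- The optimal detection boundary of the multiple blocks model. -/
def rhoStar (α β : ℝ) : ℝ :=
  if β / (1 - α) < 3 / 4 then β - (1 - α) / 2 else (√(1 - α) - √(1 - α - β)) ^ 2

end BlockScan

end

/-!
Both scans are maxima of penalized standardized sums over a family `F` of intervals that lies between
the approximating set and the set of all intervals.  Everything is proved for such a family at once:
bounds for the noise are taken over all intervals, and the intervals that detect the blocks are taken
from the approximating set.

*Null hypothesis.*  The penalty cancels the noise at every scale: intervals of length about `ℓ` are
approximated, with relative precision `n ^ (-η)`, by about `n ^ (1 + O(η)) / ℓ` intervals of a net,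
so that their standardized sums stay below `√(2 log (n / ℓ)) + o(√(log n))`
(`eventually_nullLaw_net_le`, `tendsto_nullLaw_penalized_gt`).  Moreover the maximum has no atoms, not
even approximate ones: it falls into a window of length `o(1 / log n)` with vanishing probability,
uniformly in the position of the window (`eventually_nullLaw_window_le`).  Indeed a shift of the
data in the direction of the maximizing interval moves the maximum without changing the maximizer,
and by the Cameron–Martin formula such a shift costs only a constant factor in probability.

*Below the boundary.*  By anti-concentration a test is powerless as soon as, for most placements, the
blocks raise the maximum by at most a negative power of `n` (`isPowerless_of_increment`).  A moment
count of the placements (`card_placements_many_mul_le`) shows that for most of them short windows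
contain boundedly many blocks (`eventually_spread`), which makes the increments of long intervals
small.  This is all that is needed in the dense case.  In the sparse case intervals of length below
`n ^ (α + 2 τ)` may gain more, but each of them meets at most one block; the net bound, applied to
the few intervals near the blocks, shows that their penalized sums remain below `-c √(log n)` when
`√r < √(1 - α) - √(1 - α - β)`, whereas the maximum is larger already because of an interval
`(0, D]` of length comparable to `n`.

*Above the boundary.*  In the dense case the interval `(0, D]` detects the blocks, since most placements
put a fixed proportion of the blocks into it (`eventually_le_overlap_of_sparse`).  In the sparse case
every block contains an interval of the approximating set that fills almost all of it
(`eventually_exists_inner_mem_appIntervals`).  These about `n ^ (1 - α - β)` intervals are disjoint,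
so the largest of their noises is about `√(2 (1 - α - β) log n)`; together with the signal
`√(2 r log n)` it exceeds the penalty `√(2 (1 - α) log n)`
(`eventually_nullLaw_forall_stdSum_le`, `signal_sub_penalty_ge`).
-/

namespace BlockScan

/-! ### Linear functionals of Gaussian noise -/

instance isProbabilityMeasure_nullLaw (n : ℕ) : IsProbabilityMeasure (nullLaw n) := by
  unfold nullLaw; infer_instance

lemma iIndepFun_coord (n : ℕ) : iIndepFun (fun (i : Fin n) (z : Fin n → ℝ) => z i) (nullLaw n) :=
  iIndepFun_pi (X := fun _ => id) fun _ => aemeasurable_id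

lemma map_coord_nullLaw (n : ℕ) (i : Fin n) :
    (nullLaw n).map (fun z => z i) = gaussianReal 0 1 :=
  (measurePreserving_eval (fun _ : Fin n => gaussianReal 0 1) i).map_eq

lemma hasGaussianLaw_dot (n : ℕ) (v : Fin n → ℝ) :
    HasGaussianLaw (fun z : Fin n → ℝ => ∑ i, v i * z i) (nullLaw n) := by
  refine iIndepFun.hasGaussianLaw_fun_sum (X := fun i (z : Fin n → ℝ) => v i * z i) (fun i => ?_) ?_
  · have h : HasGaussianLaw (fun z : Fin n → ℝ => z i) (nullLaw n) :=
      ⟨by rw [map_coord_nullLaw]; infer_instance⟩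
    exact h.fun_smul (v i)
  · exact (iIndepFun_coord n).comp (fun i x => v i * x) (fun i => by fun_prop)

lemma map_dot_nullLaw (n : ℕ) (v : Fin n → ℝ) (hv : ∑ i, v i ^ 2 = 1) :
    (nullLaw n).map (fun z : Fin n → ℝ => ∑ i, v i * z i) = gaussianReal 0 1 := by
  have hmem : ∀ i, MemLp (fun x : ℝ => v i * x) 2 (gaussianReal 0 1) := fun i =>
    (memLp_id_gaussianReal' 2 (by simp)).const_mul (v i)
  have hint : ∀ i : Fin n, Integrable (fun z : Fin n → ℝ => v i * z i) (nullLaw n) := fun i =>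
    (((hmem i).comp_measurePreserving
      (measurePreserving_eval (fun _ : Fin n => gaussianReal 0 1) i)).integrable (by norm_num))
  rw [(hasGaussianLaw_dot n v).map_eq_gaussianReal]
  congr 1
  · rw [integral_finsetSum _ fun i _ => hint i]
    refine Finset.sum_eq_zero fun i _ => ?_
    rw [integral_const_mul]
    have : ∫ z : Fin n → ℝ, z i ∂(nullLaw n) = ∫ x, x ∂(gaussianReal 0 1) := by
      rw [← map_coord_nullLaw n i, integral_map (measurable_pi_apply i).aemeasurable (by fun_prop)]
    rw [this, integral_id_gaussianReal, mul_zero]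
  · have h := variance_sum_pi (μ := fun _ : Fin n => gaussianReal 0 1)
      (X := fun i (x : ℝ) => v i * x) hmem
    have e : (fun z : Fin n → ℝ => ∑ i, v i * z i) = ∑ i, fun ω : Fin n → ℝ => v i * ω i := by
      ext z; simp
    rw [e, nullLaw, h]
    have : ∀ i, Var[fun x : ℝ => v i * x; gaussianReal 0 1] = v i ^ 2 := fun i => by
      rw [variance_const_mul, variance_fun_id_gaussianReal]; simp
    simp_rw [this, hv]; simp

lemma measurable_dot {n : ℕ} (v : Fin n → ℝ) :
    Measurable (fun z : Fin n → ℝ => ∑ i, v i * z i) := by fun_prop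

lemma gaussianReal_Ioi_le (x : ℝ) (hx : 0 ≤ x) :
    (gaussianReal 0 1).real (Set.Ioi x) ≤ Real.exp (-x ^ 2 / 2) := by
  have h := measure_ge_le_exp_mul_mgf (X := id) (μ := gaussianReal 0 1) x hx
    (by simpa using integrable_exp_mul_gaussianReal (μ := 0) (v := 1) x)
  rw [mgf_id_gaussianReal] at h
  refine (measureReal_mono (fun y hy => ?_)).trans (h.trans_eq ?_)
  · exact le_of_lt (Set.mem_Ioi.1 hy)
  · rw [← Real.exp_add]; congr 1; push_cast; ring

lemma gaussianReal_Iio_neg_le (x : ℝ) (hx : 0 ≤ x) :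
    (gaussianReal 0 1).real (Set.Iio (-x)) ≤ Real.exp (-x ^ 2 / 2) := by
  have h : (gaussianReal 0 1).real (Set.Iio (-x)) = (gaussianReal 0 1).real (Set.Ioi x) := by
    have := gaussianReal_map_neg (μ := 0) (v := 1)
    rw [neg_zero] at this
    conv_lhs => rw [← this]
    rw [map_measureReal_apply (by fun_prop) measurableSet_Iio]
    congr 1; ext y; simp
  rw [h]; exact gaussianReal_Ioi_le x hx

/-- A crude Gaussian lower tail bound: the density on `(x, x + 1]` is at least its value at
`x + 1`. -/
lemma le_gaussianReal_Ioi (x : ℝ) (hx : 0 ≤ x) :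
    Real.exp (-(x + 1) ^ 2 / 2) / 3 ≤ (gaussianReal 0 1).real (Set.Ioi x) := by
  have h1 : Real.exp (-(x + 1) ^ 2 / 2) / 3 ≤ (gaussianReal 0 1).real (Set.Ioc x (x + 1)) := by
    rw [measureReal_def, gaussianReal_apply_eq_integral _ one_ne_zero, ENNReal.toReal_ofReal
      (integral_nonneg fun y => gaussianPDFReal_nonneg _ _ _)]
    have hpi : √(2 * Real.pi) ≤ 3 := by
      rw [Real.sqrt_le_left (by norm_num)]
      linarith [Real.pi_lt_d2]
    have hb : ∀ y ∈ Set.Ioc x (x + 1),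
        Real.exp (-(x + 1) ^ 2 / 2) / 3 ≤ gaussianPDFReal 0 1 y := by
      intro y hy
      have hy2 : y ^ 2 ≤ (x + 1) ^ 2 := pow_le_pow_left₀ (hx.trans hy.1.le) hy.2 2
      rw [gaussianPDFReal, div_eq_inv_mul]
      simp only [NNReal.coe_one, mul_one, sub_zero]
      gcongr
    calc Real.exp (-(x + 1) ^ 2 / 2) / 3
        = ∫ _y in Set.Ioc x (x + 1), Real.exp (-(x + 1) ^ 2 / 2) / 3 := by simp
      _ ≤ _ := setIntegral_mono_on (by simp) (integrable_gaussianPDFReal 0 1).integrableOn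
          measurableSet_Ioc hb
  exact h1.trans (measureReal_mono Set.Ioc_subset_Ioi_self)

lemma nullLaw_dot_gt_le {n : ℕ} (v : Fin n → ℝ) (hv : ∑ i, v i ^ 2 = 1) (x : ℝ) (hx : 0 ≤ x) :
    (nullLaw n).real {z | x < ∑ i, v i * z i} ≤ Real.exp (-x ^ 2 / 2) := by
  have := gaussianReal_Ioi_le x hx
  rwa [← map_dot_nullLaw n v hv, map_measureReal_apply (measurable_dot v) measurableSet_Ioi] at this

lemma nullLaw_dot_lt_le {n : ℕ} (v : Fin n → ℝ) (hv : ∑ i, v i ^ 2 = 1) (x : ℝ) (hx : 0 ≤ x) :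
    (nullLaw n).real {z | ∑ i, v i * z i < -x} ≤ Real.exp (-x ^ 2 / 2) := by
  have := gaussianReal_Iio_neg_le x hx
  rwa [← map_dot_nullLaw n v hv, map_measureReal_apply (measurable_dot v) measurableSet_Iio] at this

lemma le_nullLaw_dot_gt {n : ℕ} (v : Fin n → ℝ) (hv : ∑ i, v i ^ 2 = 1) (x : ℝ) (hx : 0 ≤ x) :
    Real.exp (-(x + 1) ^ 2 / 2) / 3 ≤ (nullLaw n).real {z | x < ∑ i, v i * z i} := by
  have := le_gaussianReal_Ioi x hx
  rwa [← map_dot_nullLaw n v hv, map_measureReal_apply (measurable_dot v) measurableSet_Ioi] at this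

/-! ### Shifts of Gaussian noise -/

lemma gaussianReal_shift_apply (h : ℝ) {s : Set ℝ} (hs : MeasurableSet s) :
    ∫⁻ x in s, ENNReal.ofReal (Real.exp (-(h * x) - h ^ 2 / 2)) ∂(gaussianReal 0 1)
      = gaussianReal (-h) 1 s := by
  rw [gaussianReal_apply _ one_ne_zero, gaussianReal_of_var_ne_zero _ one_ne_zero,
    setLIntegral_withDensity_eq_setLIntegral_mul _ (measurable_gaussianPDF _ _)
      (by fun_prop) hs]
  refine lintegral_congr fun x => ?_
  simp only [Pi.mul_apply, gaussianPDF, gaussianPDFReal]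
  rw [← ENNReal.ofReal_mul (by positivity), mul_assoc, ← Real.exp_add]
  congr 3
  push_cast; ring

/-- The Cameron–Martin formula for the standard Gaussian measure on `ℝⁿ`. -/
lemma map_sub_nullLaw {n : ℕ} (h : Fin n → ℝ) :
    (nullLaw n).map (fun z => z - h) = (nullLaw n).withDensity
      fun z => ∏ i, ENNReal.ofReal (Real.exp (-(h i * z i) - h i ^ 2 / 2)) := by
  have h1 : (nullLaw n).map (fun z => z - h) = Measure.pi fun i => gaussianReal (-(h i)) 1 := by
    have := Measure.pi_map_pi (μ := fun _ : Fin n => gaussianReal 0 1)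
      (f := fun i x => x - h i) (fun i => by fun_prop)
    rw [nullLaw]
    simp_rw [gaussianReal_map_sub_const, zero_sub] at this
    exact this
  rw [h1]
  refine Measure.pi_eq fun s hs => ?_
  rw [withDensity_apply _ (MeasurableSet.univ_pi hs), ← lintegral_indicator (MeasurableSet.univ_pi hs)]
  have e : ∀ z : Fin n → ℝ, (Set.univ.pi s).indicator
      (fun z => ∏ i, ENNReal.ofReal (Real.exp (-(h i * z i) - h i ^ 2 / 2))) z
      = ∏ i, (s i).indicator (fun x => ENNReal.ofReal (Real.exp (-(h i * x) - h i ^ 2 / 2))) (z i) := by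
    intro z
    by_cases hz : z ∈ Set.univ.pi s
    · rw [Set.indicator_of_mem hz]
      exact Finset.prod_congr rfl fun i _ => by rw [Set.indicator_of_mem (hz i (Set.mem_univ i))]
    · rw [Set.indicator_of_notMem hz]
      simp only [Set.mem_univ_pi, not_forall] at hz
      obtain ⟨i, hi⟩ := hz
      exact (Finset.prod_eq_zero (Finset.mem_univ i) (by rw [Set.indicator_of_notMem hi])).symm
  simp_rw [e]
  have hm : ∀ i, Measurable ((s i).indicator
      (fun x => ENNReal.ofReal (Real.exp (-(h i * x) - h i ^ 2 / 2)))) := fun i =>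
    Measurable.indicator (by fun_prop) (hs i)
  rw [lintegral_prod_eq_prod_lintegral_of_indepFun Finset.univ
    (fun i (z : Fin n → ℝ) => (s i).indicator
      (fun x => ENNReal.ofReal (Real.exp (-(h i * x) - h i ^ 2 / 2))) (z i))
    ((iIndepFun_coord n).comp _ hm) (fun i => (hm i).comp (measurable_pi_apply i))]
  refine Finset.prod_congr rfl fun i _ => ?_
  rw [← gaussianReal_shift_apply _ (hs i), ← lintegral_indicator (hs i), ← map_coord_nullLaw n i,
    lintegral_map (hm i) (measurable_pi_apply i)]

/-- Translating an event by `h` costs at most the factor by which the Gaussian density drops. -/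
lemma nullLaw_shift_ge {n : ℕ} (h : Fin n → ℝ) (c : ℝ) {E : Set (Fin n → ℝ)} (hE : MeasurableSet E)
    (hc : ∀ z ∈ E, ∑ i, h i * z i ≤ c) :
    Real.exp (-c - (∑ i, h i ^ 2) / 2) * (nullLaw n).real E ≤ (nullLaw n).real {z | z - h ∈ E} := by
  have key : ENNReal.ofReal (Real.exp (-c - (∑ i, h i ^ 2) / 2)) * nullLaw n E
      ≤ nullLaw n {z | z - h ∈ E} := by
    have e1 : nullLaw n {z | z - h ∈ E} = (nullLaw n).map (fun z => z - h) E := by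
      rw [Measure.map_apply (by fun_prop) hE]; rfl
    rw [e1, map_sub_nullLaw, withDensity_apply _ hE, ← setLIntegral_const]
    refine setLIntegral_mono (by fun_prop) fun z hz => ?_
    rw [← ENNReal.ofReal_prod_of_nonneg fun i _ => (Real.exp_pos _).le, ← Real.exp_sum]
    refine ENNReal.ofReal_le_ofReal (Real.exp_le_exp.2 ?_)
    rw [Finset.sum_sub_distrib, Finset.sum_neg_distrib, ← Finset.sum_div]
    linarith [hc z hz]
  have := ENNReal.toReal_mono (measure_ne_top _ _) key
  rwa [ENNReal.toReal_mul, ENNReal.toReal_ofReal (Real.exp_pos _).le] at this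

/-- Linear functionals of the noise with disjoint supports are independent. -/
lemma iIndepFun_dot {n : ℕ} {ι : Type*} [Finite ι] (v : ι → Fin n → ℝ)
    (hv : ∀ a b, a ≠ b → ∀ i, v a i * v b i = 0) :
    iIndepFun (fun a (z : Fin n → ℝ) => ∑ i, v a i * z i) (nullLaw n) := by
  have hmem : ∀ i : Fin n, MemLp (fun z : Fin n → ℝ => z i) 2 (nullLaw n) := fun i =>
    (memLp_id_gaussianReal' 2 (by simp)).comp_measurePreserving
      (measurePreserving_eval (fun _ : Fin n => gaussianReal 0 1) i)
  have hlaw : HasGaussianLaw (fun (z : Fin n → ℝ) (a : ι) => ∑ i, v a i * z i) (nullLaw n) := by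
    have h0 : HasGaussianLaw (fun (z : Fin n → ℝ) (i : Fin n) => z i) (nullLaw n) :=
      (iIndepFun_coord n).hasGaussianLaw fun i =>
        ⟨by rw [map_coord_nullLaw]; infer_instance⟩
    have := Fintype.ofFinite ι
    let L : (Fin n → ℝ) →L[ℝ] (ι → ℝ) := ContinuousLinearMap.pi fun a =>
      ∑ i, v a i • ContinuousLinearMap.proj (R := ℝ) (φ := fun _ : Fin n => ℝ) i
    have e : (fun (z : Fin n → ℝ) (a : ι) => ∑ i, v a i * z i) = fun z => L fun i => z i := by
      ext z a
      simp only [L, ContinuousLinearMap.coe_pi', sum_apply, smul_apply, ContinuousLinearMap.proj_apply,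
        smul_eq_mul]
    rw [e]
    exact h0.map_fun L
  refine hlaw.iIndepFun_of_covariance_eq_zero fun a b hab => ?_
  rw [covariance_fun_sum_fun_sum (fun i => (hmem i).const_mul (v a i))
    (fun i => (hmem i).const_mul (v b i))]
  refine Finset.sum_eq_zero fun i _ => Finset.sum_eq_zero fun j _ => ?_
  rw [covariance_const_mul_left, covariance_const_mul_right]
  by_cases hij : i = j
  · subst hij
    rw [← mul_assoc, hv a b hab i, zero_mul]
  · rw [((iIndepFun_coord n).indepFun hij).covariance_eq_zero (hmem i) (hmem j)]
    simp

/-! ### Standardized sums and maxima over families of intervals -/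

/-- The unit vector whose inner product with the data is the standardized sum over `(I.1, I.2]`. -/
noncomputable def weight (n : ℕ) (I : ℕ × ℕ) : Fin n → ℝ :=
  fun i => if (i : ℕ) + 1 ∈ Finset.Ioc I.1 I.2 then (√((I.2 : ℝ) - I.1))⁻¹ else 0

/-- The standardized sum of the data over the interval `(I.1, I.2]`. -/
noncomputable def stdSum (n : ℕ) (x : Fin n → ℝ) (I : ℕ × ℕ) : ℝ := ∑ i, weight n I i * x i

/-- The penalty of an interval. -/
noncomputable def penalty (n : ℕ) (I : ℕ × ℕ) : ℝ :=
  √(2 * Real.log (Real.exp 1 * n / ((I.2 : ℝ) - I.1)))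

/-- The number of design points of the interval `(I.1, I.2]` that lie in a block. -/
def overlap (b : ℕ) (S : Finset ℕ) (I : ℕ × ℕ) : ℕ := (Finset.Ioc I.1 I.2 ∩ support b S).card

/-- The penalized scan over a family `F` of intervals. -/
noncomputable def maxOver (n : ℕ) (F : Finset (ℕ × ℕ)) (x : Fin n → ℝ) : ℝ :=
  sSup (penalizedSum n x '' (F : Set (ℕ × ℕ)))

lemma mem_allIntervals {n : ℕ} {I : ℕ × ℕ} : I ∈ allIntervals n ↔ I.1 < I.2 ∧ I.2 ≤ n := by
  simp only [allIntervals, Finset.mem_filter, Finset.mem_product, Finset.mem_range]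
  omega

lemma card_filter_mem_Ioc {n : ℕ} {I : ℕ × ℕ} (hI : I.2 ≤ n) (A : Finset ℕ) :
    (Finset.univ.filter fun i : Fin n => (i : ℕ) + 1 ∈ Finset.Ioc I.1 I.2 ∧ (i : ℕ) + 1 ∈ A).card
      = (Finset.Ioc I.1 I.2 ∩ A).card := by
  refine Finset.card_bij (fun i _ => (i : ℕ) + 1) (fun i hi => ?_) (fun i _ j _ h => ?_)
    fun k hk => ?_
  · simpa using hi
  · exact Fin.ext (by simpa using h)
  · rw [Finset.mem_inter, Finset.mem_Ioc] at hk
    refine ⟨⟨k - 1, by omega⟩, ?_, by simp; omega⟩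
    have : k - 1 + 1 = k := by omega
    simp [this, hk]
    omega

lemma card_filter_mem_Ioc' {n : ℕ} {I : ℕ × ℕ} (hI : I.2 ≤ n) :
    (Finset.univ.filter fun i : Fin n => (i : ℕ) + 1 ∈ Finset.Ioc I.1 I.2).card = I.2 - I.1 := by
  have := card_filter_mem_Ioc hI (Finset.Ioc I.1 I.2)
  simpa using this

lemma len_pos {n : ℕ} {I : ℕ × ℕ} (hI : I ∈ allIntervals n) : (1 : ℝ) ≤ (I.2 : ℝ) - I.1 := by
  have := (mem_allIntervals.1 hI).1
  have h : ((I.1 + 1 : ℕ) : ℝ) ≤ I.2 := by exact_mod_cast this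
  push_cast at h; linarith

lemma len_le {n : ℕ} {I : ℕ × ℕ} (hI : I ∈ allIntervals n) : (I.2 : ℝ) - I.1 ≤ n := by
  have := (mem_allIntervals.1 hI).2
  have h : (I.2 : ℝ) ≤ n := by exact_mod_cast this
  have : (0 : ℝ) ≤ I.1 := Nat.cast_nonneg _
  linarith

lemma sum_weight_sq {n : ℕ} {I : ℕ × ℕ} (hI : I ∈ allIntervals n) :
    ∑ i, weight n I i ^ 2 = 1 := by
  have h1 := mem_allIntervals.1 hI
  have h2 := len_pos hI
  simp only [weight, ite_pow]
  rw [zero_pow two_ne_zero, Finset.sum_ite, Finset.sum_const_zero, add_zero, Finset.sum_const,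
    card_filter_mem_Ioc' h1.2, inv_pow, Real.sq_sqrt (by linarith), nsmul_eq_mul,
    Nat.cast_sub h1.1.le]
  exact mul_inv_cancel₀ (by linarith)

lemma stdSum_eq (n : ℕ) (x : Fin n → ℝ) (I : ℕ × ℕ) :
    stdSum n x I = (∑ i ∈ Finset.univ.filter (fun i : Fin n => (i : ℕ) + 1 ∈ Finset.Ioc I.1 I.2),
      x i) / √((I.2 : ℝ) - I.1) := by
  simp only [stdSum, weight, ite_mul, zero_mul]
  rw [Finset.sum_ite, Finset.sum_const_zero, add_zero, ← Finset.mul_sum, mul_comm]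
  rfl

lemma penalizedSum_eq (n : ℕ) (x : Fin n → ℝ) (I : ℕ × ℕ) :
    penalizedSum n x I = stdSum n x I - penalty n I := by
  rw [stdSum_eq]; rfl

lemma penalizedSum_observe {n b : ℕ} {I : ℕ × ℕ} (hI : I ∈ allIntervals n) (μ : ℝ) (S : Finset ℕ)
    (z : Fin n → ℝ) :
    penalizedSum n (observe n b μ S z) I
      = stdSum n z I + μ * overlap b S I / √((I.2 : ℝ) - I.1) - penalty n I := by
  rw [penalizedSum_eq, stdSum_eq, stdSum_eq]
  simp only [observe]
  rw [Finset.sum_add_distrib, Finset.sum_ite, Finset.sum_const_zero, add_zero, Finset.sum_const,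
    Finset.filter_filter, card_filter_mem_Ioc (mem_allIntervals.1 hI).2, nsmul_eq_mul, overlap]
  ring

lemma maxOver_le_iff {n : ℕ} {F : Finset (ℕ × ℕ)} (hF : F.Nonempty) {x : Fin n → ℝ} {t : ℝ} :
    maxOver n F x ≤ t ↔ ∀ I ∈ F, penalizedSum n x I ≤ t := by
  rw [maxOver, csSup_le_iff (F.finite_toSet.image _).bddAbove (by simpa using hF)]
  exact Set.forall_mem_image

lemma lt_maxOver_iff {n : ℕ} {F : Finset (ℕ × ℕ)} (hF : F.Nonempty) {x : Fin n → ℝ} {t : ℝ} :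
    t < maxOver n F x ↔ ∃ I ∈ F, t < penalizedSum n x I := by
  rw [← not_le, maxOver_le_iff hF]; simp

lemma le_maxOver {n : ℕ} {F : Finset (ℕ × ℕ)} {x : Fin n → ℝ} {I : ℕ × ℕ} (hI : I ∈ F) :
    penalizedSum n x I ≤ maxOver n F x :=
  (maxOver_le_iff ⟨I, hI⟩).1 le_rfl I hI

lemma measurable_penalizedSum (n : ℕ) (I : ℕ × ℕ) :
    Measurable fun x : Fin n → ℝ => penalizedSum n x I := by
  simp_rw [penalizedSum_eq, stdSum]; fun_prop

lemma measurable_maxOver {n : ℕ} {F : Finset (ℕ × ℕ)} (hF : F.Nonempty) :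
    Measurable (maxOver n F) := by
  refine measurable_of_Iic fun t => ?_
  have : maxOver n F ⁻¹' Set.Iic t = ⋂ I ∈ F, {x | penalizedSum n x I ≤ t} := by
    ext x; simp [maxOver_le_iff hF]
  rw [this]
  exact Finset.measurableSet_biInter F fun I _ => measurableSet_le (measurable_penalizedSum n I) measurable_const

lemma measurable_observe (n b : ℕ) (μ : ℝ) (S : Finset ℕ) : Measurable (observe n b μ S) := by
  unfold observe; fun_prop

lemma nullLaw_stdSum_gt_le {n : ℕ} {I : ℕ × ℕ} (hI : I ∈ allIntervals n) {x : ℝ} (hx : 0 ≤ x) :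
    (nullLaw n).real {z | x < stdSum n z I} ≤ Real.exp (-x ^ 2 / 2) :=
  nullLaw_dot_gt_le _ (sum_weight_sq hI) x hx

lemma nullLaw_stdSum_lt_le {n : ℕ} {I : ℕ × ℕ} (hI : I ∈ allIntervals n) {x : ℝ} (hx : 0 ≤ x) :
    (nullLaw n).real {z | stdSum n z I < -x} ≤ Real.exp (-x ^ 2 / 2) :=
  nullLaw_dot_lt_le _ (sum_weight_sq hI) x hx

/-- A union bound for the standardized sums, with a level of its own for every interval. -/
lemma nullLaw_exists_stdSum_gt_le {n : ℕ} (F : Finset (ℕ × ℕ)) (hF : F ⊆ allIntervals n)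
    (q : ℕ × ℕ → ℝ) (hq : ∀ I ∈ F, 0 ≤ q I) :
    (nullLaw n).real {z | ∃ I ∈ F, q I < stdSum n z I} ≤ ∑ I ∈ F, Real.exp (-q I ^ 2 / 2) := by
  have : {z | ∃ I ∈ F, q I < stdSum n z I} = ⋃ I ∈ F, {z | q I < stdSum n z I} := by ext; simp
  rw [this]
  refine (measureReal_biUnion_finset_le F _).trans (Finset.sum_le_sum fun I hI => ?_)
  exact nullLaw_stdSum_gt_le (hF hI) (hq I hI)

lemma nullLaw_exists_stdSum_lt_le {n : ℕ} (F : Finset (ℕ × ℕ)) (hF : F ⊆ allIntervals n)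
    {q : ℝ} (hq : 0 ≤ q) :
    (nullLaw n).real {z | ∃ I ∈ F, stdSum n z I < -q} ≤ F.card * Real.exp (-q ^ 2 / 2) := by
  have : {z | ∃ I ∈ F, stdSum n z I < -q} = ⋃ I ∈ F, {z | stdSum n z I < -q} := by ext; simp
  rw [this, ← nsmul_eq_mul, ← Finset.sum_const]
  exact (measureReal_biUnion_finset_le F _).trans
    (Finset.sum_le_sum fun I hI => nullLaw_stdSum_lt_le (hF hI) hq)

lemma card_allIntervals_le (n : ℕ) : (allIntervals n).card ≤ (n + 1) ^ 2 := by
  refine (Finset.card_filter_le _ _).trans ?_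
  simp [sq]

/-- If the intervals of a family are disjoint, then the probability that all their standardized sums
stay below `x` is the product of the single probabilities. -/
lemma nullLaw_forall_stdSum_le {n : ℕ} (F : Finset (ℕ × ℕ)) (hF : F ⊆ allIntervals n)
    (hd : ∀ I ∈ F, ∀ J ∈ F, I ≠ J → Disjoint (Finset.Ioc I.1 I.2) (Finset.Ioc J.1 J.2))
    {x : ℝ} (hx : 0 ≤ x) :
    (nullLaw n).real {z | ∀ I ∈ F, stdSum n z I ≤ x}
      ≤ (1 - Real.exp (-(x + 1) ^ 2 / 2) / 3) ^ F.card := by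
  have hind : iIndepFun (fun (I : F) (z : Fin n → ℝ) => ∑ i, weight n I i * z i) (nullLaw n) := by
    refine iIndepFun_dot _ fun I J hIJ i => ?_
    have := hd I I.2 J J.2 (fun h => hIJ (Subtype.ext h))
    simp only [weight]
    by_cases h1 : (i : ℕ) + 1 ∈ Finset.Ioc I.1.1 I.1.2
    · rw [if_neg (Finset.disjoint_left.1 this h1), mul_zero]
    · rw [if_neg h1, zero_mul]
  have e : {z | ∀ I ∈ F, stdSum n z I ≤ x}
      = ⋂ I ∈ (Finset.univ : Finset F), (fun z : Fin n → ℝ => ∑ i, weight n I i * z i) ⁻¹' Set.Iic x := by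
    ext z; simp [stdSum]
  rw [e, measureReal_def, hind.measure_inter_preimage_eq_mul Finset.univ (fun _ _ => measurableSet_Iic),
    ENNReal.toReal_prod]
  calc _ ≤ ∏ _I : F, (1 - Real.exp (-(x + 1) ^ 2 / 2) / 3) := by
        refine Finset.prod_le_prod (fun _ _ => ENNReal.toReal_nonneg) fun I _ => ?_
        have h1 := le_nullLaw_dot_gt _ (sum_weight_sq (hF I.2)) x hx
        have h2 : (fun z : Fin n → ℝ => ∑ i, weight n I i * z i) ⁻¹' Set.Iic x
            = {z | x < ∑ i, weight n I i * z i}ᶜ := by ext; simp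
        rw [h2, ← measureReal_def, probReal_compl_eq_one_sub
          (measurableSet_lt measurable_const (measurable_dot _))]
        linarith
    _ = _ := by simp

/-! ### Anti-concentration of a penalized maximum -/

lemma sum_weight_mul_le {n : ℕ} {I J : ℕ × ℕ} (hI : I ∈ allIntervals n) (hJ : J ∈ allIntervals n) :
    ∑ i, weight n J i * weight n I i ≤ 1 := by
  have h1 := sum_weight_sq hI
  have h2 := sum_weight_sq hJ
  have : ∑ i, weight n J i * weight n I i ≤ ∑ i, (weight n J i ^ 2 + weight n I i ^ 2) / 2 :=
    Finset.sum_le_sum fun i _ => by nlinarith [sq_nonneg (weight n J i - weight n I i)]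
  rw [← Finset.sum_div, Finset.sum_add_distrib, h1, h2] at this
  linarith

lemma penalizedSum_add_smul (n : ℕ) (x : Fin n → ℝ) (c : ℝ) (I J : ℕ × ℕ) :
    penalizedSum n (x + c • weight n I) J
      = penalizedSum n x J + c * ∑ i, weight n J i * weight n I i := by
  simp only [penalizedSum_eq, stdSum, Pi.add_apply, Pi.smul_apply, smul_eq_mul, mul_add,
    Finset.sum_add_distrib, Finset.mul_sum]
  rw [Finset.sum_congr rfl fun i _ => mul_left_comm (weight n J i) c (weight n I i)]
  ring

/-- The event that `I` is the maximizing interval of the family `F`, ties being broken by the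
enumeration `Nat.pair` of the pairs. -/
def argmaxSet (n : ℕ) (F : Finset (ℕ × ℕ)) (I : ℕ × ℕ) : Set (Fin n → ℝ) :=
  {z | ∀ J ∈ F, penalizedSum n z J ≤ penalizedSum n z I ∧
    (penalizedSum n z J = penalizedSum n z I → Nat.pair I.1 I.2 ≤ Nat.pair J.1 J.2)}

lemma argmaxSet_unique {n : ℕ} {F : Finset (ℕ × ℕ)} {I J : ℕ × ℕ} (hI : I ∈ F) (hJ : J ∈ F)
    {z : Fin n → ℝ} (h1 : z ∈ argmaxSet n F I) (h2 : z ∈ argmaxSet n F J) : I = J := by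
  have e : penalizedSum n z J = penalizedSum n z I := le_antisymm (h1 J hJ).1 (h2 I hI).1
  have := le_antisymm ((h1 J hJ).2 e) ((h2 I hI).2 e.symm)
  rw [Nat.pair_eq_pair] at this
  exact Prod.ext this.1 this.2

lemma exists_mem_argmaxSet {n : ℕ} {F : Finset (ℕ × ℕ)} (hF : F.Nonempty) (z : Fin n → ℝ) :
    ∃ I ∈ F, z ∈ argmaxSet n F I := by
  obtain ⟨I0, hI0, hmax⟩ := F.exists_max_image (penalizedSum n z) hF
  have hne : (F.filter fun J => penalizedSum n z J = penalizedSum n z I0).Nonempty :=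
    ⟨I0, by simp [hI0]⟩
  obtain ⟨I, hI, hmin⟩ := Finset.exists_min_image _ (fun J : ℕ × ℕ => Nat.pair J.1 J.2) hne
  rw [Finset.mem_filter] at hI
  refine ⟨I, hI.1, fun J hJ => ⟨by rw [hI.2]; exact hmax J hJ, fun h => ?_⟩⟩
  exact hmin J (Finset.mem_filter.2 ⟨hJ, h.trans hI.2⟩)

lemma add_smul_mem_argmaxSet {n : ℕ} {F : Finset (ℕ × ℕ)} (hF : F ⊆ allIntervals n) {I : ℕ × ℕ}
    (hI : I ∈ F) {z : Fin n → ℝ} (hz : z ∈ argmaxSet n F I) {c : ℝ} (hc : 0 ≤ c) :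
    z + c • weight n I ∈ argmaxSet n F I := by
  have hII : ∑ i, weight n I i * weight n I i = 1 := by
    rw [← sum_weight_sq (hF hI)]; exact Finset.sum_congr rfl fun i _ => (sq _).symm
  intro J hJ
  have h1 := hz J hJ
  have h2 := mul_le_mul_of_nonneg_left (sum_weight_mul_le (hF hI) (hF hJ)) hc
  rw [penalizedSum_add_smul, penalizedSum_add_smul, hII]
  exact ⟨by linarith [h1.1], fun h => h1.2 (le_antisymm h1.1 (by linarith))⟩

lemma measurableSet_argmaxSet (n : ℕ) (F : Finset (ℕ × ℕ)) (I : ℕ × ℕ) :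
    MeasurableSet (argmaxSet n F I) := by
  have : argmaxSet n F I = ⋂ J ∈ F, ({z | penalizedSum n z J ≤ penalizedSum n z I} ∩
      ({z | penalizedSum n z J = penalizedSum n z I}ᶜ ∪
        {_z | Nat.pair I.1 I.2 ≤ Nat.pair J.1 J.2})) := by
    ext z
    simp only [argmaxSet, Set.mem_ofPred_eq, Set.mem_iInter, Set.mem_inter_iff, Set.mem_union,
      Set.mem_compl_iff, imp_iff_not_or]
  rw [this]
  refine Finset.measurableSet_biInter F fun J _ => MeasurableSet.inter ?_ (MeasurableSet.union ?_ ?_)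
  · exact measurableSet_le (measurable_penalizedSum n J) (measurable_penalizedSum n I)
  · exact (measurableSet_eq_fun (measurable_penalizedSum n J) (measurable_penalizedSum n I)).compl
  · exact MeasurableSet.const _

/-- The maximum rarely falls into a short window.  Moving the data in the direction of the maximizing
interval moves the value of the maximum but not the maximizer, so the window can be moved to `K`
disjoint positions; each move costs only a constant factor in probability. -/
theorem nullLaw_maxOver_window_le {n : ℕ} {F : Finset (ℕ × ℕ)} (hF : F ⊆ allIntervals n)
    (hne : F.Nonempty) {t ε A : ℝ} (hε : 0 < ε) (hA : 1 ≤ A) (hpen : ∀ I ∈ F, t + penalty n I ≤ A)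
    {K : ℕ} (hK : 0 < K) (hKε : K * ε * A ≤ 1) :
    (nullLaw n).real {z | t - ε < maxOver n F z ∧ maxOver n F z ≤ t} ≤ 8 / K := by
  set E : ℕ × ℕ → Set (Fin n → ℝ) := fun I =>
    argmaxSet n F I ∩ {z | t - ε < penalizedSum n z I ∧ penalizedSum n z I ≤ t} with hE
  have hEm : ∀ I, MeasurableSet (E I) := fun I => (measurableSet_argmaxSet n F I).inter
    ((measurableSet_lt measurable_const (measurable_penalizedSum n I)).inter
      (measurableSet_le (measurable_penalizedSum n I) measurable_const))
  set D : (ℕ × ℕ) × ℕ → Set (Fin n → ℝ) := fun p =>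
    {z | z - (p.2 * ε) • weight n p.1 ∈ E p.1} with hD
  have hDm : ∀ p, MeasurableSet (D p) := fun p =>
    (measurable_id.sub_const _) (hEm p.1)
  -- each translate is almost as likely as the event itself
  have hshift : ∀ I ∈ F, ∀ k ∈ Finset.range K, (nullLaw n).real (E I) / 8 ≤ (nullLaw n).real (D (I, k)) := by
    intro I hI k hk
    have hk' : (k : ℝ) ≤ K := by exact_mod_cast (Finset.mem_range.1 hk).le
    have hkA : k * ε * A ≤ 1 := le_trans (by gcongr) hKε
    have hk0 : 0 ≤ k * ε := by positivity
    have hk1 : k * ε ≤ 1 := by nlinarith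
    have h1 := nullLaw_shift_ge ((k * ε) • weight n I) 1 (hEm I) fun z hz => by
      have h2 : stdSum n z I ≤ A := by
        have := hz.2.2
        rw [penalizedSum_eq] at this
        linarith [hpen I hI]
      have h3 : ∑ i, ((k * ε) • weight n I) i * z i = k * ε * stdSum n z I := by
        simp only [stdSum, Finset.mul_sum, Pi.smul_apply, smul_eq_mul, mul_assoc]
      rw [h3]
      exact (mul_le_mul_of_nonneg_left h2 hk0).trans hkA
    have h4 : ∑ i, ((k * ε) • weight n I) i ^ 2 = (k * ε) ^ 2 := by
      simp only [Pi.smul_apply, smul_eq_mul, mul_pow, ← Finset.mul_sum]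
      rw [← mul_pow, sum_weight_sq (hF hI), mul_one]
    rw [h4] at h1
    refine le_trans ?_ h1
    rw [div_eq_inv_mul]
    gcongr
    have h5 : Real.exp (-2) ≤ Real.exp (-1 - (k * ε) ^ 2 / 2) := Real.exp_le_exp.2 (by nlinarith)
    refine le_trans ?_ h5
    rw [Real.exp_neg, inv_le_inv₀ (by norm_num) (Real.exp_pos _)]
    have h6 : Real.exp 2 = Real.exp 1 * Real.exp 1 := by rw [← Real.exp_add]; norm_num
    rw [h6]
    nlinarith [Real.exp_one_lt_d9, Real.exp_pos 1]
  have hback : ∀ I k, ∀ z ∈ D (I, k), I ∈ F → z ∈ argmaxSet n F I ∧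
      t - ε + k * ε < penalizedSum n z I ∧ penalizedSum n z I ≤ t + k * ε := by
    intro I k z hz hI
    have e : z = (z - (k * ε) • weight n I) + (k * ε) • weight n I := by simp
    have hII : ∑ i, weight n I i * weight n I i = 1 := by
      rw [← sum_weight_sq (hF hI)]; exact Finset.sum_congr rfl fun i _ => (sq _).symm
    have h1 := hz.2
    refine ⟨?_, ?_, ?_⟩
    · rw [e]; exact add_smul_mem_argmaxSet hF hI hz.1 (by positivity)
    · rw [e, penalizedSum_add_smul, hII]
      simp only [Set.mem_ofPred_eq] at h1; linarith
    · rw [e, penalizedSum_add_smul, hII]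
      simp only [Set.mem_ofPred_eq] at h1; linarith
  have hdisj : Set.PairwiseDisjoint (↑(F ×ˢ Finset.range K)) D := by
    rintro ⟨I, k⟩ hp ⟨J, l⟩ hq hpq
    rw [Function.onFun, Set.disjoint_left]
    intro z hz1 hz2
    simp only [Finset.coe_product, Set.mem_prod, Finset.mem_coe] at hp hq
    obtain ⟨a1, b1, c1⟩ := hback I k z hz1 hp.1
    obtain ⟨a2, b2, c2⟩ := hback J l z hz2 hq.1
    have hIJ := argmaxSet_unique hp.1 hq.1 a1 a2
    subst hIJ
    refine hpq (Prod.ext rfl ?_)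
    have h1 : (k : ℝ) < l + 1 := by
      by_contra! h; nlinarith
    have h2 : (l : ℝ) < k + 1 := by
      by_contra! h; nlinarith
    have h1' : k < l + 1 := by exact_mod_cast h1
    have h2' : l < k + 1 := by exact_mod_cast h2
    simp only; omega
  have hsum : ∑ p ∈ F ×ˢ Finset.range K, (nullLaw n).real (D p) ≤ 1 := by
    rw [← measureReal_biUnion_finset hdisj fun p _ => hDm p]
    exact measureReal_le_one
  have hcover : (nullLaw n).real {z | t - ε < maxOver n F z ∧ maxOver n F z ≤ t}
      ≤ ∑ I ∈ F, (nullLaw n).real (E I) := by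
    refine le_trans (measureReal_mono (fun z hz => ?_) (measure_ne_top _ _))
      (measureReal_biUnion_finset_le F E)
    obtain ⟨I, hI, hzI⟩ := exists_mem_argmaxSet hne z
    refine Set.mem_biUnion hI ⟨hzI, ?_, ?_⟩
    · obtain ⟨J, hJ, h⟩ := (lt_maxOver_iff hne).1 hz.1
      exact h.trans_le (hzI J hJ).1
    · exact (le_maxOver hI).trans hz.2
  have h8 : K * ((∑ I ∈ F, (nullLaw n).real (E I)) / 8) ≤ 1 := by
    refine le_trans ?_ hsum
    rw [Finset.sum_product, Finset.sum_div, Finset.mul_sum]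
    refine Finset.sum_le_sum fun I hI => ?_
    have := Finset.card_nsmul_le_sum (Finset.range K) (fun k => (nullLaw n).real (D (I, k))) _
      (hshift I hI)
    simpa using this
  have hK0 : (0 : ℝ) < K := by exact_mod_cast hK
  rw [le_div_iff₀ hK0]
  nlinarith

/-! ### Crude bounds under the null hypothesis -/

lemma tendsto_log_nat : Tendsto (fun n : ℕ => Real.log n) atTop atTop :=
  Real.tendsto_log_atTop.comp tendsto_natCast_atTop_atTop

lemma tendsto_union_bound :
    Tendsto (fun n : ℕ => ((n : ℝ) + 1) ^ 2 * Real.exp (-(Real.log n - 1) ^ 2 / 2)) atTop (𝓝 0) := by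
  have h0 : Tendsto (fun n : ℕ => 4 / (n : ℝ)) atTop (𝓝 0) := tendsto_const_div_atTop_nhds_zero_nat 4
  refine squeeze_zero' (Eventually.of_forall fun n => by positivity) ?_ h0
  filter_upwards [tendsto_log_nat.eventually_ge_atTop 10, eventually_ge_atTop 1] with n hn hn1
  have hn0 : (1 : ℝ) ≤ n := by exact_mod_cast hn1
  have h1 : Real.exp (-(Real.log n - 1) ^ 2 / 2) ≤ Real.exp (-(3 * Real.log n)) :=
    Real.exp_le_exp.2 (by nlinarith)
  have h2 : Real.exp (-(3 * Real.log n)) = ((n : ℝ) ^ 3)⁻¹ := by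
    rw [Real.exp_neg, mul_comm, Real.exp_mul, Real.exp_log (by linarith)]; norm_cast
  calc ((n : ℝ) + 1) ^ 2 * Real.exp (-(Real.log n - 1) ^ 2 / 2)
      ≤ (2 * (n : ℝ)) ^ 2 * ((n : ℝ) ^ 3)⁻¹ := by rw [← h2]; gcongr; linarith
    _ = 4 / (n : ℝ) := by field_simp; norm_num

lemma tendsto_nullLaw_exists_gt_log :
    Tendsto (fun n => (nullLaw n).real {z | ∃ I ∈ allIntervals n, Real.log n - 1 < stdSum n z I})
      atTop (𝓝 0) := by
  refine squeeze_zero' (Eventually.of_forall fun n => measureReal_nonneg) ?_ tendsto_union_bound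
  filter_upwards [tendsto_log_nat.eventually_ge_atTop 1] with n hn
  refine (nullLaw_exists_stdSum_gt_le _ subset_rfl (fun _ => Real.log n - 1)
    fun _ _ => by linarith).trans ?_
  rw [Finset.sum_const, nsmul_eq_mul]
  gcongr
  exact_mod_cast card_allIntervals_le n

lemma tendsto_nullLaw_exists_lt_neg_log :
    Tendsto (fun n => (nullLaw n).real {z | ∃ I ∈ allIntervals n, stdSum n z I < -(Real.log n - 1)})
      atTop (𝓝 0) := by
  refine squeeze_zero' (Eventually.of_forall fun n => measureReal_nonneg) ?_ tendsto_union_bound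
  filter_upwards [tendsto_log_nat.eventually_ge_atTop 1] with n hn
  refine (nullLaw_exists_stdSum_lt_le _ subset_rfl (q := Real.log n - 1) (by linarith)).trans ?_
  gcongr
  exact_mod_cast card_allIntervals_le n

lemma penalty_nonneg (n : ℕ) (I : ℕ × ℕ) : 0 ≤ penalty n I := Real.sqrt_nonneg _

/-- The penalty in terms of logarithms. -/
lemma penalty_eq {n : ℕ} {I : ℕ × ℕ} (hI : I ∈ allIntervals n) :
    penalty n I = √(2 * (1 + Real.log n - Real.log ((I.2 : ℝ) - I.1))) := by
  have h1 := len_pos hI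
  have h2 := len_le hI
  have h3 : (n : ℝ) ≠ 0 := by linarith
  rw [penalty, Real.log_div (mul_ne_zero (Real.exp_ne_zero 1) h3) (by linarith),
    Real.log_mul (Real.exp_ne_zero 1) h3, Real.log_exp]

lemma penalty_le_log : ∀ᶠ n : ℕ in atTop, ∀ I ∈ allIntervals n, penalty n I ≤ Real.log n := by
  filter_upwards [tendsto_log_nat.eventually_ge_atTop 10] with n hn I hI
  rw [penalty_eq hI, Real.sqrt_le_left (by linarith)]
  have := Real.log_nonneg (len_pos hI)
  nlinarith

/-- Uniform anti-concentration for windows that are short on the scale `1 / log n`. -/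
theorem eventually_nullLaw_window_le {F : ℕ → Finset (ℕ × ℕ)} (hF : ∀ n, F n ⊆ allIntervals n)
    (hne : ∀ᶠ n in atTop, (F n).Nonempty) {ε : ℕ → ℝ} (hε0 : ∀ n, 0 ≤ ε n)
    (hε : Tendsto (fun n => ε n * Real.log n) atTop (𝓝 0)) {δ : ℝ} (hδ : 0 < δ) :
    ∀ᶠ n in atTop, ∀ t : ℝ,
      (nullLaw n).real {z | t - ε n < maxOver n (F n) z ∧ maxOver n (F n) z ≤ t} ≤ δ := by
  obtain ⟨K, hK⟩ := exists_nat_gt (8 / δ)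
  have hK0 : (0 : ℝ) < K := lt_trans (by positivity) hK
  filter_upwards [hne, penalty_le_log, tendsto_log_nat.eventually_ge_atTop 1,
    (tendsto_order.1 tendsto_nullLaw_exists_gt_log).2 δ hδ,
    (tendsto_order.1 hε).2 (1 / (2 * K)) (by positivity), eventually_ge_atTop 1,
    (tendsto_order.1 hε).2 1 one_pos] with n h1 h2 h3 h4 h5 h6 h7 t
  have hn : (1 : ℝ) ≤ n := by exact_mod_cast h6
  rcases (hε0 n).eq_or_lt with h0 | h0
  · have : {z : Fin n → ℝ | t - ε n < maxOver n (F n) z ∧ maxOver n (F n) z ≤ t} = ∅ := by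
      ext z; simp [← h0]
    rw [this]; simpa using hδ.le
  rcases le_or_gt t (Real.log n) with ht | ht
  · refine (nullLaw_maxOver_window_le (hF n) h1 h0 (A := 2 * Real.log n) (by linarith)
      (fun I hI => by linarith [h2 I (hF n hI)]) (K := K) (by exact_mod_cast hK0) ?_).trans ?_
    · rw [lt_div_iff₀ (by positivity)] at h5; nlinarith
    · rw [div_le_iff₀ hK0]; rw [div_lt_iff₀ hδ] at hK; linarith
  · refine le_trans (measureReal_mono fun z hz => ?_) h4.le
    obtain ⟨I, hI, h⟩ := (lt_maxOver_iff h1).1 hz.1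
    refine ⟨I, hF n hI, ?_⟩
    rw [penalizedSum_eq] at h
    have := penalty_nonneg n I
    have : ε n ≤ 1 := by nlinarith
    linarith

/-! ### The law of the data under the alternative and two criteria -/

lemma altLaw_real_apply (α β : ℝ) (μ : ℕ → ℝ) (n : ℕ) {E : Set (Fin n → ℝ)} (hE : MeasurableSet E) :
    (altLaw α β μ n).real E
      = (∑ S ∈ placements n (blockLength α n) (numBlocks α β n),
          (nullLaw n).real (observe n (blockLength α n) (μ n) S ⁻¹' E))
        / (placements n (blockLength α n) (numBlocks α β n)).card := by
  rw [altLaw, blocksLaw, measureReal_def, Measure.finsetSum_apply, ENNReal.toReal_sum, Finset.sum_div]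
  · refine Finset.sum_congr rfl fun S hS => ?_
    rw [Measure.smul_apply, Measure.map_apply (measurable_observe _ _ _ _) hE, smul_eq_mul,
      ENNReal.toReal_mul, ENNReal.toReal_inv, ENNReal.toReal_natCast, measureReal_def]
    ring
  · intro S hS
    rw [Measure.smul_apply, Measure.map_apply (measurable_observe _ _ _ _) hE, smul_eq_mul]
    refine ENNReal.mul_ne_top (ENNReal.inv_ne_top.2 ?_) (measure_ne_top _ _)
    exact_mod_cast (Finset.card_pos.2 ⟨S, hS⟩).ne'

/-- Asymptotic power one follows from one sequence of critical values with vanishing errors: critical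
values with nonvanishing level have to lie below that sequence. -/
lemma hasAsymptoticPowerOne_of_tendsto {T : (n : ℕ) → (Fin n → ℝ) → ℝ}
    {Q : (n : ℕ) → Measure (Fin n → ℝ)} [∀ n, IsFiniteMeasure (Q n)] (s : ℕ → ℝ)
    (h1 : Tendsto (fun n => typeI T n (s n)) atTop (𝓝 0))
    (h2 : Tendsto (fun n => typeII T Q n (s n)) atTop (𝓝 0)) : HasAsymptoticPowerOne T Q := by
  refine ⟨⟨s, by simpa using h1.add h2⟩, fun a ha t ht => ?_⟩
  refine squeeze_zero' (Eventually.of_forall fun n => measureReal_nonneg) ?_ h2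
  filter_upwards [ht, (tendsto_order.1 h1).2 a ha] with n hn hn'
  have hlt : t n < s n := by
    by_contra! h
    have : typeI T n (t n) ≤ typeI T n (s n) := measureReal_mono fun z hz => lt_of_le_of_lt h hz
    linarith
  exact measureReal_mono fun z hz => le_trans hz hlt.le

/-- If the blocks, for most placements, raise the maximum by an amount that is negligible on the
scale `1 / log n`, then the test is powerless. -/
theorem isPowerless_of_increment {α β : ℝ} {μ : ℕ → ℝ} (hμ : ∀ n, 0 ≤ μ n)
    {F : ℕ → Finset (ℕ × ℕ)} (hF : ∀ n, F n ⊆ allIntervals n) (hne : ∀ᶠ n in atTop, (F n).Nonempty)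
    (hP : ∀ᶠ n in atTop, (placements n (blockLength α n) (numBlocks α β n)).Nonempty)
    {ε : ℕ → ℝ} (hε0 : ∀ n, 0 ≤ ε n) (hε : Tendsto (fun n => ε n * Real.log n) atTop (𝓝 0))
    (hgood : ∀ δ : ℝ, 0 < δ → ∀ᶠ n in atTop,
      ∃ G ⊆ placements n (blockLength α n) (numBlocks α β n),
        ((placements n (blockLength α n) (numBlocks α β n) \ G).card : ℝ)
          ≤ δ * (placements n (blockLength α n) (numBlocks α β n)).card ∧
        ∀ S ∈ G, (nullLaw n).real {z | maxOver n (F n) z + ε n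
          < maxOver n (F n) (observe n (blockLength α n) (μ n) S z)} ≤ δ) :
    IsPowerless (fun n => maxOver n (F n)) (altLaw α β μ) := by
  intro t
  have key : ∀ δ : ℝ, 0 < δ → ∀ᶠ n in atTop,
      |typeI (fun n => maxOver n (F n)) n (t n)
        + typeII (fun n => maxOver n (F n)) (altLaw α β μ) n (t n) - 1| ≤ 3 * δ := by
    intro δ hδ
    filter_upwards [hgood δ hδ, hP, hne, eventually_nullLaw_window_le hF hne hε0 hε hδ]
      with n ⟨G, hGP, hGc, hG⟩ hPn hnen hwin
    set P := placements n (blockLength α n) (numBlocks α β n) with hPdef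
    set T := maxOver n (F n)
    have hTm : Measurable T := measurable_maxOver hnen
    have hcard : (0 : ℝ) < P.card := by exact_mod_cast Finset.card_pos.2 hPn
    set a := (nullLaw n).real {x | t n < T x} with ha
    have ha1 : (nullLaw n).real {x | T x ≤ t n} = 1 - a := by
      have : {x | T x ≤ t n} = {x | t n < T x}ᶜ := by ext; simp
      rw [this, probReal_compl_eq_one_sub (measurableSet_lt measurable_const hTm)]
    have hle : ∀ S ∈ P, (nullLaw n).real (observe n (blockLength α n) (μ n) S ⁻¹' {x | T x ≤ t n})
        ≤ 1 - a := by
      intro S _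
      rw [← ha1]
      refine measureReal_mono fun z hz => ?_
      refine (maxOver_le_iff hnen).2 fun I hI => le_trans ?_ ((maxOver_le_iff hnen).1 hz I hI)
      rw [penalizedSum_observe (hF n hI), penalizedSum_eq]
      have : 0 ≤ μ n * overlap (blockLength α n) S I / √((I.2 : ℝ) - I.1) :=
        div_nonneg (mul_nonneg (hμ n) (Nat.cast_nonneg _)) (Real.sqrt_nonneg _)
      linarith
    have hge : ∀ S ∈ G, 1 - a - 2 * δ
        ≤ (nullLaw n).real (observe n (blockLength α n) (μ n) S ⁻¹' {x | T x ≤ t n}) := by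
      intro S hS
      have hsub : {x | T x ≤ t n} ⊆ observe n (blockLength α n) (μ n) S ⁻¹' {x | T x ≤ t n} ∪
          ({z | T z + ε n < T (observe n (blockLength α n) (μ n) S z)} ∪
            {z | t n - ε n < T z ∧ T z ≤ t n}) := by
        intro z hz
        by_contra! hcon
        simp only [Set.mem_union, Set.mem_preimage, Set.mem_ofPred_eq, not_or, not_and, not_le,
          not_lt] at hcon hz
        obtain ⟨c1, c2, c3⟩ := hcon
        by_cases h : t n - ε n < T z
        · linarith [c3 h]
        · linarith
      have h1 := measureReal_mono (μ := nullLaw n) hsub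
      have h2 := measureReal_union_le (μ := nullLaw n)
        (observe n (blockLength α n) (μ n) S ⁻¹' {x | T x ≤ t n})
        ({z | T z + ε n < T (observe n (blockLength α n) (μ n) S z)} ∪
            {z | t n - ε n < T z ∧ T z ≤ t n})
      have h3 := measureReal_union_le (μ := nullLaw n)
        {z | T z + ε n < T (observe n (blockLength α n) (μ n) S z)}
        {z | t n - ε n < T z ∧ T z ≤ t n}
      linarith [hG S hS, hwin (t n)]
    have hII : typeII (fun n => maxOver n (F n)) (altLaw α β μ) n (t n)
        = (∑ S ∈ P, (nullLaw n).real (observe n (blockLength α n) (μ n) S ⁻¹' {x | T x ≤ t n}))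
          / P.card := altLaw_real_apply α β μ n (measurableSet_le hTm measurable_const)
    have hup : typeII (fun n => maxOver n (F n)) (altLaw α β μ) n (t n) ≤ 1 - a := by
      rw [hII, div_le_iff₀ hcard]
      refine (Finset.sum_le_sum hle).trans_eq ?_
      rw [Finset.sum_const, nsmul_eq_mul, mul_comm]
    have hlow : 1 - a - 3 * δ ≤ typeII (fun n => maxOver n (F n)) (altLaw α β μ) n (t n) := by
      rw [hII, le_div_iff₀ hcard]
      have h1 : ∑ S ∈ G, (1 - a - 2 * δ)
          ≤ ∑ S ∈ P, (nullLaw n).real (observe n (blockLength α n) (μ n) S ⁻¹' {x | T x ≤ t n}) :=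
        (Finset.sum_le_sum hge).trans
          (Finset.sum_le_sum_of_subset_of_nonneg hGP fun _ _ _ => measureReal_nonneg)
      refine le_trans ?_ h1
      rw [Finset.sum_const, nsmul_eq_mul]
      have h2 : (G.card : ℝ) + (P \ G).card = P.card := by
        rw [← Finset.card_sdiff_add_card_eq_card hGP]; push_cast; ring
      have ha0 : 0 ≤ a := measureReal_nonneg
      have hd : (0 : ℝ) ≤ (P \ G).card := Nat.cast_nonneg _
      nlinarith
    have hIeq : typeI (fun n => maxOver n (F n)) n (t n) = a := rfl
    rw [hIeq, abs_le]
    constructor <;> linarith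
  rw [Metric.tendsto_atTop']
  intro δ hδ
  obtain ⟨N, hN⟩ := eventually_atTop.1 (key (δ / 6) (by positivity))
  refine ⟨N, fun n hn => ?_⟩
  rw [Real.dist_eq]
  linarith [hN n hn.le]

/-! ### Counting placements -/

lemma mem_placements {n b m : ℕ} {S : Finset ℕ} : S ∈ placements n b m ↔
    S ⊆ Finset.range (n + 1) ∧ S.card = m ∧ (∀ j ∈ S, j + b ≤ n) ∧
      ∀ j ∈ S, ∀ k ∈ S, j ≠ k → Disjoint (Finset.Ioc j (j + b)) (Finset.Ioc k (k + b)) := by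
  simp only [placements, Finset.mem_filter, Finset.mem_powersetCard, and_assoc]

lemma disjoint_blocks_iff {b : ℕ} (hb : 0 < b) {j k : ℕ} :
    Disjoint (Finset.Ioc j (j + b)) (Finset.Ioc k (k + b)) ↔ j + b ≤ k ∨ k + b ≤ j := by
  constructor
  · intro h
    by_contra! hcon
    have : max j k + 1 ∈ Finset.Ioc j (j + b) ∩ Finset.Ioc k (k + b) := by
      simp only [Finset.mem_inter, Finset.mem_Ioc]; omega
    rw [Finset.disjoint_iff_inter_eq_empty.1 h] at this
    simp at this
  · intro h
    rw [Finset.disjoint_left]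
    intro x; simp only [Finset.mem_Ioc]; omega

lemma placements_nonempty {n b m : ℕ} (hb : 0 < b) (h : m * b ≤ n) :
    (placements n b m).Nonempty := by
  refine ⟨(Finset.range m).image (· * b), mem_placements.2 ⟨?_, ?_, ?_, ?_⟩⟩
  · intro x hx
    obtain ⟨i, hi, rfl⟩ := Finset.mem_image.1 hx
    have := Nat.mul_le_mul_right b (Finset.mem_range.1 hi).le
    simp only [Finset.mem_range]; omega
  · rw [Finset.card_image_of_injective _ fun i j h => Nat.eq_of_mul_eq_mul_right hb h, Finset.card_range]
  · intro x hx
    obtain ⟨i, hi, rfl⟩ := Finset.mem_image.1 hx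
    have := Nat.mul_le_mul_right b (Nat.succ_le_of_lt (Finset.mem_range.1 hi))
    simp only [Nat.succ_eq_add_one, add_mul, one_mul] at this ⊢; omega
  · intro x hx y hy hxy
    obtain ⟨i, hi, rfl⟩ := Finset.mem_image.1 hx
    obtain ⟨j, hj, rfl⟩ := Finset.mem_image.1 hy
    rw [disjoint_blocks_iff hb]
    rcases lt_trichotomy i j with hij | hij | hij
    · have := Nat.mul_le_mul_right b (Nat.succ_le_of_lt hij)
      left; simpa [add_mul] using this
    · exact absurd (by rw [hij]) hxy
    · have := Nat.mul_le_mul_right b (Nat.succ_le_of_lt hij)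
      right; simpa [add_mul] using this

lemma placements_subset {n b m : ℕ} {S T : Finset ℕ} (hS : S ∈ placements n b m) (hT : T ⊆ S) :
    T ∈ placements n b T.card := by
  rw [mem_placements] at hS ⊢
  exact ⟨hT.trans hS.1, rfl, fun j hj => hS.2.2.1 j (hT hj),
    fun j hj k hk => hS.2.2.2 j (hT hj) k (hT hk)⟩

/-- A placement of `k` blocks leaves at least `n - 2 (k + 1) b` positions for one more block. -/
lemma card_placements_succ_ge {n b k : ℕ} (hb : 0 < b) :
    (placements n b k).card * (n - 2 * ((k + 1) * b)) ≤ (k + 1) * (placements n b (k + 1)).card := by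
  set free : Finset ℕ → Finset ℕ := fun R =>
    (Finset.range (n + 1 - b)) \ R.biUnion fun r => Finset.Ico (r + 1 - b) (r + b) with hfree
  have hfree_card : ∀ R ∈ placements n b k, n - 2 * ((k + 1) * b) ≤ (free R).card := by
    intro R hR
    have h1 := Finset.le_card_sdiff (R.biUnion fun r => Finset.Ico (r + 1 - b) (r + b))
      (Finset.range (n + 1 - b))
    have h2 : (R.biUnion fun r => Finset.Ico (r + 1 - b) (r + b)).card ≤ R.card * (2 * b) := by
      refine Finset.card_biUnion_le_card_mul _ _ _ fun r _ => ?_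
      rw [Nat.card_Ico]; omega
    rw [(mem_placements.1 hR).2.1] at h2
    rw [Finset.card_range] at h1
    have h3 : 2 * ((k + 1) * b) = k * (2 * b) + 2 * b := by ring
    simp only [hfree]
    omega
  have hmaps : ∀ p ∈ (placements n b k).sigma free,
      (⟨insert p.2 p.1, p.2⟩ : Σ _ : Finset ℕ, ℕ) ∈ (placements n b (k + 1)).sigma fun S => S := by
    rintro ⟨R, j⟩ hp
    simp only [Finset.mem_sigma] at hp ⊢
    obtain ⟨hR, hj⟩ := hp
    have hR' := mem_placements.1 hR
    simp only [hfree, Finset.mem_sdiff, Finset.mem_range, Finset.mem_biUnion, Finset.mem_Ico,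
      not_exists, not_and, not_lt] at hj
    have hjR : ∀ r ∈ R, j + b ≤ r ∨ r + b ≤ j := by
      intro r hr
      have := hj.2 r hr
      by_cases h : r + 1 - b ≤ j
      · right; exact this h
      · left; omega
    have hjn : j ∉ R := fun h => by have := hjR j h; omega
    refine ⟨mem_placements.2 ⟨?_, ?_, ?_, ?_⟩, Finset.mem_insert_self _ _⟩
    · refine Finset.insert_subset ?_ hR'.1
      simp only [Finset.mem_range]; omega
    · rw [Finset.card_insert_of_notMem hjn, hR'.2.1]
    · intro x hx
      rcases Finset.mem_insert.1 hx with rfl | hx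
      · omega
      · exact hR'.2.2.1 x hx
    · intro x hx y hy hxy
      rcases Finset.mem_insert.1 hx with hx1 | hx <;> rcases Finset.mem_insert.1 hy with hy1 | hy
      · exact absurd (hx1.trans hy1.symm) hxy
      · rw [disjoint_blocks_iff hb, hx1]; exact hjR y hy
      · rw [disjoint_blocks_iff hb, hy1]; exact (hjR x hx).symm
      · exact hR'.2.2.2 x hx y hy hxy
  have hinj : Set.InjOn (fun p : Σ _ : Finset ℕ, ℕ => (⟨insert p.2 p.1, p.2⟩ : Σ _ : Finset ℕ, ℕ))
      ↑((placements n b k).sigma free) := by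
    have hnot : ∀ p ∈ (placements n b k).sigma free, p.2 ∉ p.1 := by
      rintro ⟨R, j⟩ hp hjR
      simp only [Finset.mem_sigma, hfree, Finset.mem_sdiff, Finset.mem_range, Finset.mem_biUnion,
        Finset.mem_Ico, not_exists, not_and, not_lt] at hp
      have := hp.2.2 j hjR (by omega)
      omega
    rintro ⟨R, j⟩ hp ⟨R', j'⟩ hp' h
    simp only [Sigma.mk.injEq, heq_eq_eq] at h
    obtain ⟨h1, rfl⟩ := h
    have e1 := Finset.erase_insert (hnot _ hp)
    have e2 := Finset.erase_insert (hnot _ hp')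
    simp only at e1 e2
    rw [← e1, ← e2, h1]
  have hcard := Finset.card_le_card_of_injOn _ hmaps hinj
  rw [Finset.card_sigma, Finset.card_sigma] at hcard
  calc (placements n b k).card * (n - 2 * ((k + 1) * b))
      ≤ ∑ R ∈ placements n b k, (free R).card := by
        simpa using Finset.card_nsmul_le_sum _ _ _ hfree_card
    _ ≤ ∑ S ∈ placements n b (k + 1), S.card := hcard
    _ = (k + 1) * (placements n b (k + 1)).card := by
        rw [Finset.sum_congr rfl fun S hS => (mem_placements.1 hS).2.1]
        simp [mul_comm]

lemma card_placements_sub_mul_pow_le {n b m : ℕ} (hb : 0 < b) (k : ℕ) (hk : k ≤ m) :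
    (placements n b (m - k)).card * (n - 2 * (m * b)) ^ k ≤ m ^ k * (placements n b m).card := by
  induction k with
  | zero => simp
  | succ k ih =>
    have h1 := card_placements_succ_ge (n := n) (b := b) (k := m - (k + 1)) hb
    have e : m - (k + 1) + 1 = m - k := by omega
    rw [e] at h1
    have h2 : (n - 2 * (m * b)) ≤ n - 2 * ((m - k) * b) := by
      have := Nat.mul_le_mul_right b (Nat.sub_le m k)
      omega
    calc (placements n b (m - (k + 1))).card * (n - 2 * (m * b)) ^ (k + 1)
        = ((placements n b (m - (k + 1))).card * (n - 2 * (m * b))) * (n - 2 * (m * b)) ^ k := by ring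
      _ ≤ ((m - k) * (placements n b (m - k)).card) * (n - 2 * (m * b)) ^ k := by
          exact Nat.mul_le_mul_right _ ((Nat.mul_le_mul_left _ h2).trans h1)
      _ ≤ m * ((placements n b (m - k)).card * (n - 2 * (m * b)) ^ k) := by
          rw [mul_assoc]; gcongr; omega
      _ ≤ m * (m ^ k * (placements n b m).card) := Nat.mul_le_mul_left _ (ih (by omega))
      _ = _ := by ring

/-- The factorial moment bound for the number of left endpoints that fall into a set `A`: removing
`k` of them loses little, since each removed block has at least `n - 2 m b` alternative positions. -/
theorem card_placements_many_mul_le {n b m : ℕ} (hb : 0 < b) (A : Finset ℕ) (k q : ℕ) (hk : k ≤ m) :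
    ((placements n b m).filter fun S => q ≤ (S ∩ A).card).card
        * ((q + 1 - k) * (n - 2 * (m * b))) ^ k
      ≤ (placements n b m).card * (m * A.card) ^ k := by
  set B := (placements n b m).filter fun S => q ≤ (S ∩ A).card with hB
  have h1 : B.card * q.choose k ≤ (placements n b (m - k)).card * A.card.choose k := by
    have hinj : (B.sigma fun S => (S ∩ A).powersetCard k).card
        ≤ ((placements n b (m - k)) ×ˢ A.powersetCard k).card := by
      refine Finset.card_le_card_of_injOn (fun p => (p.1 \ p.2, p.2)) ?_ ?_
      · rintro ⟨S, C⟩ hp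
        simp only [Finset.coe_sigma, Set.mem_sigma_iff, Finset.mem_coe, Finset.mem_powersetCard, hB,
          Finset.mem_filter] at hp
        have hCS : C ⊆ S := hp.2.1.trans Finset.inter_subset_left
        simp only [Finset.coe_product, Set.mem_prod, Finset.mem_coe, Finset.mem_powersetCard]
        refine ⟨?_, hp.2.1.trans Finset.inter_subset_right, hp.2.2⟩
        have := placements_subset hp.1.1 (Finset.sdiff_subset (s := S) (t := C))
        rwa [Finset.card_sdiff_of_subset hCS, (mem_placements.1 hp.1.1).2.1, hp.2.2] at this
      · rintro ⟨S, C⟩ hp ⟨S', C'⟩ hp' h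
        simp only [Finset.coe_sigma, Set.mem_sigma_iff, Finset.mem_coe, Finset.mem_powersetCard]
          at hp hp'
        simp only [Prod.mk.injEq] at h
        obtain ⟨h1, rfl⟩ := h
        have e1 := Finset.sdiff_union_of_subset (hp.2.1.trans Finset.inter_subset_left)
        have e2 := Finset.sdiff_union_of_subset (hp'.2.1.trans Finset.inter_subset_left)
        rw [← e1, ← e2, h1]
    rw [Finset.card_sigma, Finset.card_product, Finset.card_powersetCard] at hinj
    refine le_trans ?_ hinj
    have := Finset.card_nsmul_le_sum B (fun S => ((S ∩ A).powersetCard k).card) (q.choose k)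
      fun S hS => by
        rw [Finset.card_powersetCard]
        exact Nat.choose_le_choose k (Finset.mem_filter.1 hS).2
    simpa using this
  have h2 : B.card * (q + 1 - k) ^ k ≤ (placements n b (m - k)).card * A.card ^ k := by
    calc B.card * (q + 1 - k) ^ k ≤ B.card * q.descFactorial k := by
          gcongr; exact Nat.pow_sub_le_descFactorial q k
      _ = k.factorial * (B.card * q.choose k) := by
          rw [Nat.descFactorial_eq_factorial_mul_choose]; ring
      _ ≤ k.factorial * ((placements n b (m - k)).card * A.card.choose k) := by gcongr
      _ = (placements n b (m - k)).card * A.card.descFactorial k := by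
          rw [Nat.descFactorial_eq_factorial_mul_choose]; ring
      _ ≤ _ := by gcongr; exact Nat.descFactorial_le_pow _ _
  calc B.card * ((q + 1 - k) * (n - 2 * (m * b))) ^ k
      = (B.card * (q + 1 - k) ^ k) * (n - 2 * (m * b)) ^ k := by ring
    _ ≤ ((placements n b (m - k)).card * A.card ^ k) * (n - 2 * (m * b)) ^ k := by gcongr
    _ = ((placements n b (m - k)).card * (n - 2 * (m * b)) ^ k) * A.card ^ k := by ring
    _ ≤ (m ^ k * (placements n b m).card) * A.card ^ k :=
        Nat.mul_le_mul_right _ (card_placements_sub_mul_pow_le hb k hk)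
    _ = _ := by ring

/-! ### Overlap of an interval with the blocks -/

lemma overlap_le_len (b : ℕ) (S : Finset ℕ) (I : ℕ × ℕ) : overlap b S I ≤ I.2 - I.1 := by
  refine (Finset.card_le_card Finset.inter_subset_left).trans ?_
  simp

lemma overlap_le_mul (b : ℕ) (S : Finset ℕ) (I : ℕ × ℕ) :
    overlap b S I ≤ (S ∩ Finset.Ico (I.1 + 1 - b) I.2).card * b := by
  have h : Finset.Ioc I.1 I.2 ∩ support b S
      ⊆ (S ∩ Finset.Ico (I.1 + 1 - b) I.2).biUnion fun j => Finset.Ioc j (j + b) := by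
    intro x hx
    simp only [support, Finset.mem_inter, Finset.mem_Ioc, Finset.mem_biUnion, Finset.mem_Ico] at hx ⊢
    obtain ⟨hx1, j, hj, hx2⟩ := hx
    exact ⟨j, ⟨hj, by omega, by omega⟩, hx2⟩
  refine (Finset.card_le_card h).trans (Finset.card_biUnion_le_card_mul _ _ _ fun j _ => ?_)
  simp

lemma card_support {n b m : ℕ} {S : Finset ℕ} (hS : S ∈ placements n b m) :
    (support b S).card = m * b := by
  rw [support, Finset.card_biUnion fun j hj k hk hjk => (mem_placements.1 hS).2.2.2 j hj k hk hjk]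
  simp [(mem_placements.1 hS).2.1]

lemma le_overlap {n b m : ℕ} {S : Finset ℕ} (hS : S ∈ placements n b m) (D : ℕ) :
    (S.filter fun j => j + b ≤ D).card * b ≤ overlap b S (0, D) := by
  have h : ((S.filter fun j => j + b ≤ D).biUnion fun j => Finset.Ioc j (j + b))
      ⊆ Finset.Ioc 0 D ∩ support b S := by
    intro x hx
    simp only [support, Finset.mem_inter, Finset.mem_Ioc, Finset.mem_biUnion, Finset.mem_filter]
      at hx ⊢
    obtain ⟨j, hj, hx⟩ := hx
    exact ⟨by omega, j, hj.1, hx⟩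
  refine le_trans (le_of_eq ?_) (Finset.card_le_card h)
  rw [Finset.card_biUnion fun j hj k hk hjk => (mem_placements.1 hS).2.2.2 j (Finset.mem_filter.1 hj).1 k (Finset.mem_filter.1 hk).1 hjk]
  simp

/-! ### Maxima of standardized sums over nets of intervals -/

/-- The dyadic level of an interval: `2 ^ level I ≤ |I| < 2 ^ (level I + 1)`. -/
def level (I : ℕ × ℕ) : ℕ := Nat.log 2 (I.2 - I.1)

/-- The mesh of the net at level `l`: intervals of that level are approximated with relative
precision `n ^ (-η)`, and exactly if that is finer than the integers. -/
noncomputable def mesh (η : ℝ) (n l : ℕ) : ℕ := max 1 ⌊(2 : ℝ) ^ l * (n : ℝ) ^ (-η)⌋₊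

lemma mesh_pos (η : ℝ) (n l : ℕ) : 0 < mesh η n l := lt_of_lt_of_le one_pos (le_max_left _ _)

lemma mesh_eq_one_or_le (η : ℝ) (n l : ℕ) :
    mesh η n l = 1 ∨ (mesh η n l : ℝ) ≤ (2 : ℝ) ^ l * (n : ℝ) ^ (-η) := by
  unfold mesh
  rcases max_choice 1 ⌊(2 : ℝ) ^ l * (n : ℝ) ^ (-η)⌋₊ with h | h
  · exact Or.inl h
  · rw [h]; exact Or.inr (Nat.floor_le (by positivity))

lemma pow_le_mesh {η : ℝ} {n : ℕ} (hn : 0 < n) (l : ℕ) :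
    (2 : ℝ) ^ l ≤ 2 * (n : ℝ) ^ η * mesh η n l := by
  have hn' : (0 : ℝ) < n := by exact_mod_cast hn
  have h1 : (2 : ℝ) ^ l = (n : ℝ) ^ η * ((2 : ℝ) ^ l * (n : ℝ) ^ (-η)) := by
    rw [mul_left_comm, ← Real.rpow_add hn', add_neg_cancel, Real.rpow_zero, mul_one]
  have h2 : (2 : ℝ) ^ l * (n : ℝ) ^ (-η) ≤ 2 * mesh η n l := by
    have ha := Nat.lt_floor_add_one ((2 : ℝ) ^ l * (n : ℝ) ^ (-η))
    have hb : (⌊(2 : ℝ) ^ l * (n : ℝ) ^ (-η)⌋₊ : ℝ) ≤ mesh η n l :=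
      Nat.cast_le.2 (le_max_right _ _)
    have hc : (1 : ℝ) ≤ mesh η n l := by exact_mod_cast mesh_pos η n l
    linarith
  rw [h1]
  have : 0 ≤ (n : ℝ) ^ η := by positivity
  nlinarith

lemma mesh_le_pow {η : ℝ} (hη : 0 ≤ η) {n : ℕ} (hn : 0 < n) (l : ℕ) :
    (mesh η n l : ℝ) ≤ (2 : ℝ) ^ l := by
  have hn' : (1 : ℝ) ≤ n := by exact_mod_cast hn
  rcases mesh_eq_one_or_le η n l with h | h
  · rw [h, Nat.cast_one]; exact one_le_pow₀ one_le_two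
  · refine h.trans (mul_le_of_le_one_right (by positivity) ?_)
    exact Real.rpow_le_one_of_one_le_of_nonpos hn' (by linarith)

lemma two_pow_level_le {n : ℕ} {I : ℕ × ℕ} (hI : I ∈ allIntervals n) :
    2 ^ level I ≤ I.2 - I.1 :=
  Nat.pow_log_le_self 2 (by have := (mem_allIntervals.1 hI).1; omega)

lemma lt_two_pow_level_succ (I : ℕ × ℕ) : I.2 - I.1 < 2 ^ (level I + 1) :=
  Nat.lt_pow_succ_log_self one_lt_two _

lemma cast_len {n : ℕ} {I : ℕ × ℕ} (hI : I ∈ allIntervals n) :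
    ((I.2 - I.1 : ℕ) : ℝ) = (I.2 : ℝ) - I.1 := Nat.cast_sub (mem_allIntervals.1 hI).1.le

lemma level_le_log {n : ℕ} {I : ℕ × ℕ} (hI : I ∈ allIntervals n) : level I ≤ Nat.log 2 n :=
  Nat.log_mono_right (by have := (mem_allIntervals.1 hI).2; omega)

/-- The largest interval inside `I` with endpoints on the grid `g ℤ`. -/
def innerInterval (g : ℕ) (I : ℕ × ℕ) : ℕ × ℕ := (g * ((I.1 + g - 1) / g), g * (I.2 / g))

lemma innerInterval_spec {g : ℕ} (hg : 0 < g) (I : ℕ × ℕ) :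
    I.1 ≤ (innerInterval g I).1 ∧ (innerInterval g I).1 ≤ I.1 + (g - 1) ∧
      (innerInterval g I).2 ≤ I.2 ∧ I.2 ≤ (innerInterval g I).2 + (g - 1) := by
  have h1 := Nat.div_add_mod (I.1 + g - 1) g
  have h2 := Nat.mod_lt (I.1 + g - 1) hg
  have h3 := Nat.div_add_mod I.2 g
  have h4 := Nat.mod_lt I.2 hg
  simp only [innerInterval]
  omega

/-- The plain sum of the data over `(a, b]`. -/
noncomputable def rawSum (n : ℕ) (z : Fin n → ℝ) (a b : ℕ) : ℝ :=
  ∑ i ∈ Finset.univ.filter (fun i : Fin n => (i : ℕ) + 1 ∈ Finset.Ioc a b), z i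

lemma rawSum_add {n : ℕ} (z : Fin n → ℝ) {a b c : ℕ} (hab : a ≤ b) (hbc : b ≤ c) :
    rawSum n z a c = rawSum n z a b + rawSum n z b c := by
  rw [rawSum, rawSum, rawSum, ← Finset.sum_union]
  · congr 1
    ext i; simp only [Finset.mem_filter, Finset.mem_union, Finset.mem_univ, true_and, Finset.mem_Ioc]
    omega
  · rw [Finset.disjoint_left]
    intro i; simp only [Finset.mem_filter, Finset.mem_univ, true_and, Finset.mem_Ioc]
    omega

lemma rawSum_le {n : ℕ} {z : Fin n → ℝ} {B : ℝ} (hz : ∀ I ∈ allIntervals n, stdSum n z I ≤ B)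
    {a b : ℕ} (hab : a ≤ b) (hb : b ≤ n) : rawSum n z a b ≤ √((b : ℝ) - a) * B := by
  rcases hab.eq_or_lt with rfl | hab
  · simp [rawSum]
  · have h1 := hz (a, b) (mem_allIntervals.2 ⟨hab, hb⟩)
    have h2 : (0 : ℝ) < √((b : ℝ) - a) := Real.sqrt_pos.2 (sub_pos.2 (by exact_mod_cast hab))
    rw [stdSum_eq, div_le_iff₀ h2] at h1
    rw [mul_comm]; exact h1

/-- Shrinking an interval to a grid of small relative mesh hardly lowers its standardized sum. -/
lemma stdSum_le_innerInterval {n g : ℕ} (hg : 0 < g) {I : ℕ × ℕ} (hI : I ∈ allIntervals n) {ρ : ℝ}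
    (hρ : ρ ≤ 1 / 4) (hρ0 : 0 ≤ ρ) (hgρ : g = 1 ∨ (g : ℝ) ≤ ((I.2 : ℝ) - I.1) * ρ) {B : ℝ}
    (hB : 0 ≤ B) {z : Fin n → ℝ} (hz : ∀ I ∈ allIntervals n, stdSum n z I ≤ B) :
    innerInterval g I ∈ allIntervals n ∧
      stdSum n z I ≤ max (stdSum n z (innerInterval g I)) 0 + 2 * √ρ * B := by
  obtain ⟨s1, s2, s3, s4⟩ := innerInterval_spec hg I
  obtain ⟨hI1, hI2⟩ := mem_allIntervals.1 hI
  set J := innerInterval g I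
  have hlen := len_pos hI
  set ℓ : ℝ := (I.2 : ℝ) - I.1 with hℓ
  have hg1 : (g : ℝ) - 1 ≤ ℓ * ρ := by
    rcases hgρ with h | h
    · rw [h]; push_cast; nlinarith
    · linarith
  have hgm : ((g - 1 : ℕ) : ℝ) = g - 1 := by rw [Nat.cast_sub hg]; simp
  have c1 : (I.1 : ℝ) ≤ J.1 := by exact_mod_cast s1
  have c2 : (J.1 : ℝ) ≤ I.1 + (g - 1) := by rw [← hgm]; exact_mod_cast s2
  have c3 : (J.2 : ℝ) ≤ I.2 := by exact_mod_cast s3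
  have c4 : (I.2 : ℝ) ≤ J.2 + (g - 1) := by rw [← hgm]; exact_mod_cast s4
  have hJ12 : (J.1 : ℝ) < J.2 := by
    have : ℓ * ρ ≤ ℓ / 4 := by nlinarith
    linarith
  have hJ : J ∈ allIntervals n := mem_allIntervals.2 ⟨by exact_mod_cast hJ12, s3.trans hI2⟩
  refine ⟨hJ, ?_⟩
  have hJ12' : J.1 ≤ J.2 := by exact_mod_cast hJ12.le
  have hsum : rawSum n z I.1 I.2 = rawSum n z I.1 J.1 + rawSum n z J.1 J.2 + rawSum n z J.2 I.2 := by
    rw [rawSum_add z (s1.trans hJ12') s3, rawSum_add z s1 hJ12']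
  have r1 : rawSum n z I.1 J.1 ≤ √ℓ * √ρ * B := by
    refine (rawSum_le hz s1 (hJ12'.trans (s3.trans hI2))).trans ?_
    rw [← Real.sqrt_mul (by linarith)]
    gcongr; linarith
  have r2 : rawSum n z J.2 I.2 ≤ √ℓ * √ρ * B := by
    refine (rawSum_le hz s3 hI2).trans ?_
    rw [← Real.sqrt_mul (by linarith)]
    gcongr; linarith
  have hJpos : (0 : ℝ) < √((J.2 : ℝ) - J.1) := Real.sqrt_pos.2 (by linarith)
  have r3 : rawSum n z J.1 J.2 ≤ √ℓ * max (stdSum n z J) 0 := by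
    have e : rawSum n z J.1 J.2 = √((J.2 : ℝ) - J.1) * stdSum n z J := by
      rw [stdSum_eq, mul_div_cancel₀ _ hJpos.ne']; rfl
    rw [e]
    calc √((J.2 : ℝ) - J.1) * stdSum n z J ≤ √((J.2 : ℝ) - J.1) * max (stdSum n z J) 0 := by
          gcongr; exact le_max_left _ _
      _ ≤ √ℓ * max (stdSum n z J) 0 := by gcongr; linarith
  have hℓ0 : (0 : ℝ) < √ℓ := Real.sqrt_pos.2 (by linarith)
  rw [stdSum_eq]
  change rawSum n z I.1 I.2 / √ℓ ≤ _
  rw [div_le_iff₀ hℓ0, hsum]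
  linarith

/-- The intervals of the net at a level with mesh `g`, for a set `U` of left grid points and at most
`N` right grid points for each of them. -/
def netIntervals (n g : ℕ) (U : Finset ℕ) (N : ℕ) : Finset (ℕ × ℕ) :=
  ((U ×ˢ Finset.range N).image fun p => (g * p.1, g * (p.1 + p.2 + 1))).filter
    fun J => J ∈ allIntervals n

lemma card_netIntervals_le (n g : ℕ) (U : Finset ℕ) (N : ℕ) :
    (netIntervals n g U N).card ≤ U.card * N := by
  refine (Finset.card_filter_le _ _).trans (Finset.card_image_le.trans ?_)
  rw [Finset.card_product, Finset.card_range]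

lemma netIntervals_subset (n g : ℕ) (U : Finset ℕ) (N : ℕ) :
    netIntervals n g U N ⊆ allIntervals n := fun _ h => (Finset.mem_filter.1 h).2

/-- The left grid points that the intervals of level `l` in the family `F` give rise to. -/
noncomputable def leftGrid (η : ℝ) (n : ℕ) (F : Finset (ℕ × ℕ)) (l : ℕ) : Finset ℕ :=
  (F.filter fun I => level I = l).image fun I => (I.1 + mesh η n l - 1) / mesh η n l

lemma innerInterval_mem_net {η : ℝ} {n : ℕ} (hn : 0 < n) {F : Finset (ℕ × ℕ)} {I : ℕ × ℕ}
    (hI : I ∈ F)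
    (hJ : innerInterval (mesh η n (level I)) I ∈ allIntervals n) :
    innerInterval (mesh η n (level I)) I ∈ netIntervals n (mesh η n (level I))
      (leftGrid η n F (level I)) ⌊4 * (n : ℝ) ^ η⌋₊ := by
  set g := mesh η n (level I)
  have hg : 0 < g := mesh_pos _ _ _
  refine Finset.mem_filter.2 ⟨Finset.mem_image.2 ?_, hJ⟩
  set u := (I.1 + g - 1) / g with hu
  set v := I.2 / g with hv
  have huv : u < v := by
    have := (mem_allIntervals.1 hJ).1
    exact lt_of_mul_lt_mul_left this hg.le
  refine ⟨(u, v - u - 1), Finset.mem_product.2 ⟨?_, ?_⟩, ?_⟩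
  · exact Finset.mem_image.2 ⟨I, Finset.mem_filter.2 ⟨hI, rfl⟩, rfl⟩
  · rw [Finset.mem_range]
    have hsp := innerInterval_spec hg I
    have h1 : g * (v - u) ≤ I.2 - I.1 := by
      rw [Nat.mul_sub]
      have a1 : I.1 ≤ g * u := hsp.1
      have a2 : g * v ≤ I.2 := hsp.2.2.1
      omega
    have h2 := lt_two_pow_level_succ I
    have h3 := pow_le_mesh (η := η) hn (level I)
    have h4 : ((g * (v - u) : ℕ) : ℝ) ≤ 2 * (2 : ℝ) ^ level I := by
      have : g * (v - u) ≤ 2 * 2 ^ level I := by rw [pow_succ] at h2; omega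
      exact_mod_cast this
    have hg' : (0 : ℝ) < g := by exact_mod_cast hg
    have h5 : ((v - u : ℕ) : ℝ) ≤ 4 * (n : ℝ) ^ η := by
      refine le_of_mul_le_mul_left ?_ hg'
      push_cast at h4
      change (2 : ℝ) ^ level I ≤ 2 * (n : ℝ) ^ η * g at h3
      linarith
    have h6 := Nat.le_floor h5
    simp only
    omega
  · simp only [innerInterval, Prod.mk.injEq]
    refine ⟨rfl, ?_⟩
    congr 1
    omega

lemma tendsto_rpow_neg_mul_log {c : ℝ} (hc : 0 < c) :
    Tendsto (fun n : ℕ => (n : ℝ) ^ (-c) * Real.log n) atTop (𝓝 0) := by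
  have h := (isLittleO_log_rpow_atTop hc).tendsto_div_nhds_zero.comp tendsto_natCast_atTop_atTop
  refine h.congr fun n => ?_
  simp only [Function.comp]
  rw [Real.rpow_neg (Nat.cast_nonneg n), div_eq_inv_mul]

lemma tendsto_rpow_neg_nat {c : ℝ} (hc : 0 < c) :
    Tendsto (fun n : ℕ => (n : ℝ) ^ (-c)) atTop (𝓝 0) :=
  (tendsto_rpow_neg_atTop hc).comp tendsto_natCast_atTop_atTop

/-- A bound for all standardized sums over a family of intervals that is sharp up to the factor
`n ^ η` in the number of left grid points `exp (Q l)` at level `l`. -/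
theorem eventually_nullLaw_net_le {η δ : ℝ} (hη : 0 < η) (hδ : 0 < δ) :
    ∀ᶠ n : ℕ in atTop, ∀ F ⊆ allIntervals n, ∀ Q : ℕ → ℝ, (∀ l ≤ Nat.log 2 n, 0 ≤ Q l) →
      (∀ l ≤ Nat.log 2 n, ((leftGrid η n F l).card : ℝ) ≤ Real.exp (Q l) * (n : ℝ) ^ η) →
      (nullLaw n).real {z | ∃ I ∈ F,
        √(2 * Q (level I) + 6 * η * Real.log n) + 1 < stdSum n z I} ≤ δ := by
  have hlog2 : ∀ n : ℕ, 0 < n → ((Nat.log 2 n : ℕ) : ℝ) ≤ 2 * Real.log n := by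
    intro n hn
    have h1 : ((2 : ℝ) ^ Nat.log 2 n) ≤ n := by exact_mod_cast Nat.pow_log_le_self 2 hn.ne'
    have h2 := Real.log_le_log (by positivity) h1
    rw [Real.log_pow] at h2
    have h3 : (1 / 2 : ℝ) ≤ Real.log 2 := by linarith [Real.log_two_gt_d9]
    have : (0 : ℝ) ≤ (Nat.log 2 n : ℕ) := Nat.cast_nonneg _
    nlinarith
  have hsmall : Tendsto (fun n : ℕ => 8 * ((n : ℝ) ^ (-η) * Real.log n) + 4 * (n : ℝ) ^ (-η))
      atTop (𝓝 0) := by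
    simpa using ((tendsto_rpow_neg_mul_log hη).const_mul 8).add ((tendsto_rpow_neg_nat hη).const_mul 4)
  have hsq : Tendsto (fun n : ℕ => 2 * ((n : ℝ) ^ (-(η / 2)) * Real.log n)) atTop (𝓝 0) := by
    simpa using (tendsto_rpow_neg_mul_log (half_pos hη)).const_mul 2
  filter_upwards [(tendsto_order.1 hsmall).2 (δ / 2) (by positivity),
    (tendsto_order.1 hsq).2 1 one_pos,
    (tendsto_order.1 tendsto_nullLaw_exists_gt_log).2 (δ / 2) (by positivity),
    (tendsto_order.1 (tendsto_rpow_neg_nat hη)).2 (1 / 4) (by norm_num),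
    tendsto_log_nat.eventually_ge_atTop 1, eventually_gt_atTop 0]
    with n h1 h2 h3 h4 h5 hn F hF Q hQ hcard
  have hn' : (0 : ℝ) < n := by exact_mod_cast hn
  set q : ℕ → ℝ := fun l => √(2 * Q l + 6 * η * Real.log n) with hq
  set N := ⌊4 * (n : ℝ) ^ η⌋₊ with hN
  set net : ℕ → Finset (ℕ × ℕ) := fun l => netIntervals n (mesh η n l) (leftGrid η n F l) N with hnet
  -- the union bound over the net
  have hlevel : ∀ l ∈ Finset.range (Nat.log 2 n + 1),
      (nullLaw n).real {z | ∃ J ∈ net l, q l < stdSum n z J} ≤ 4 * (n : ℝ) ^ (-η) := by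
    intro l hl
    have hl' : l ≤ Nat.log 2 n := by have := Finset.mem_range.1 hl; omega
    refine (nullLaw_exists_stdSum_gt_le _ (netIntervals_subset _ _ _ _) (fun _ => q l)
      fun _ _ => Real.sqrt_nonneg _).trans ?_
    rw [Finset.sum_const, nsmul_eq_mul]
    have hq2 : q l ^ 2 = 2 * Q l + 6 * η * Real.log n :=
      Real.sq_sqrt (by have := hQ l hl'; positivity)
    have he : Real.exp (-q l ^ 2 / 2) = Real.exp (-Q l) * (n : ℝ) ^ (-(3 * η)) := by
      rw [Real.rpow_def_of_pos hn', ← Real.exp_add, hq2]; congr 1; ring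
    have hc : ((net l).card : ℝ) ≤ Real.exp (Q l) * (n : ℝ) ^ η * (4 * (n : ℝ) ^ η) := by
      have : ((net l).card : ℝ) ≤ (leftGrid η n F l).card * N := by
        exact_mod_cast card_netIntervals_le _ _ _ _
      refine this.trans ?_
      gcongr
      · exact hcard l hl'
      · exact Nat.floor_le (by positivity)
    rw [he]
    calc ((net l).card : ℝ) * (Real.exp (-Q l) * (n : ℝ) ^ (-(3 * η)))
        ≤ (Real.exp (Q l) * (n : ℝ) ^ η * (4 * (n : ℝ) ^ η)) *
          (Real.exp (-Q l) * (n : ℝ) ^ (-(3 * η))) := by gcongr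
      _ = 4 * (Real.exp (Q l) * Real.exp (-Q l)) *
          ((n : ℝ) ^ η * (n : ℝ) ^ η * (n : ℝ) ^ (-(3 * η))) := by ring
      _ = 4 * (n : ℝ) ^ (-η) := by
          rw [← Real.exp_add, ← Real.rpow_add hn', ← Real.rpow_add hn', add_neg_cancel,
            Real.exp_zero, mul_one]
          congr 2; ring
  have hunion : (nullLaw n).real {z | ∃ l ∈ Finset.range (Nat.log 2 n + 1), ∃ J ∈ net l,
      q l < stdSum n z J} ≤ δ / 2 := by
    have e : {z | ∃ l ∈ Finset.range (Nat.log 2 n + 1), ∃ J ∈ net l, q l < stdSum n z J}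
        = ⋃ l ∈ Finset.range (Nat.log 2 n + 1), {z | ∃ J ∈ net l, q l < stdSum n z J} := by
      ext z; simp
    rw [e]
    refine (measureReal_biUnion_finset_le _ _).trans ((Finset.sum_le_sum hlevel).trans ?_)
    rw [Finset.sum_const, Finset.card_range, nsmul_eq_mul]
    push_cast
    have := hlog2 n hn
    have h0 : (0 : ℝ) ≤ (n : ℝ) ^ (-η) := by positivity
    nlinarith
  refine le_trans (measureReal_mono (s₂ := {z | ∃ I ∈ allIntervals n, Real.log n - 1 < stdSum n z I} ∪
      {z | ∃ l ∈ Finset.range (Nat.log 2 n + 1), ∃ J ∈ net l, q l < stdSum n z J})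
      (fun z hz => ?_)) ((measureReal_union_le _ _).trans (by linarith))
  by_contra hcon
  simp only [Set.mem_union, Set.mem_ofPred_eq, not_or, not_exists, not_and, not_lt] at hcon
  obtain ⟨hc1, hc2⟩ := hcon
  obtain ⟨I, hI, hzI⟩ := hz
  have hIn := hF hI
  have hlen : (2 : ℝ) ^ level I ≤ (I.2 : ℝ) - I.1 := by
    rw [← cast_len hIn]; exact_mod_cast two_pow_level_le hIn
  have hmesh : mesh η n (level I) = 1 ∨
      (mesh η n (level I) : ℝ) ≤ ((I.2 : ℝ) - I.1) * (n : ℝ) ^ (-η) := by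
    refine (mesh_eq_one_or_le η n (level I)).imp_right fun h => h.trans ?_
    gcongr
  obtain ⟨hJ, hle⟩ := stdSum_le_innerInterval (mesh_pos η n (level I)) hIn h4.le (by positivity)
    hmesh (B := Real.log n - 1) (by linarith) hc1
  have hJle := hc2 (level I) (Finset.mem_range.2 (by have := level_le_log hIn; omega)) _
    (innerInterval_mem_net hn hI hJ)
  have hmax : max (stdSum n z (innerInterval (mesh η n (level I)) I)) 0 ≤ q (level I) :=
    max_le hJle (Real.sqrt_nonneg _)
  have hs : √((n : ℝ) ^ (-η)) = (n : ℝ) ^ (-(η / 2)) := by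
    rw [Real.sqrt_eq_rpow, ← Real.rpow_mul hn'.le]; congr 1; ring
  rw [hs] at hle
  have hp : 0 ≤ (n : ℝ) ^ (-(η / 2)) := by positivity
  have : q (level I) + 1 < stdSum n z I := hzI
  nlinarith

/-! ### The maximum under the null hypothesis -/

lemma card_leftGrid_allIntervals_le {η : ℝ} {n : ℕ} (hη : 0 ≤ η) (hn : 0 < n) {l : ℕ}
    (hl : l ≤ Nat.log 2 n) :
    ((leftGrid η n (allIntervals n) l).card : ℝ)
      ≤ Real.exp (Real.log (6 * n / 2 ^ l)) * (n : ℝ) ^ η := by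
  set g := mesh η n l with hgdef
  have hg : 0 < g := mesh_pos _ _ _
  have hn' : (0 : ℝ) < n := by exact_mod_cast hn
  rw [Real.exp_log (by positivity)]
  have hsub : leftGrid η n (allIntervals n) l ⊆ Finset.range (n / g + 2) := by
    intro u hu
    obtain ⟨I, hI, rfl⟩ := Finset.mem_image.1 hu
    have hI' := mem_allIntervals.1 (Finset.mem_filter.1 hI).1
    rw [Finset.mem_range]
    have h1 : (I.1 + g - 1) / g ≤ (n + g) / g := Nat.div_le_div_right (by omega)
    rw [Nat.add_div_right _ hg] at h1
    show (I.1 + g - 1) / g < _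
    omega
  have hc : ((leftGrid η n (allIntervals n) l).card : ℝ) ≤ (n : ℝ) / g + 2 := by
    have h1 := Finset.card_le_card hsub
    rw [Finset.card_range] at h1
    have h2 : ((n / g + 2 : ℕ) : ℝ) ≤ (n : ℝ) / g + 2 := by
      push_cast; gcongr; exact Nat.cast_div_le
    exact le_trans (by exact_mod_cast h1) h2
  have h2l : (2 : ℝ) ^ l ≤ n := by
    have : 2 ^ l ≤ n := (Nat.pow_le_pow_right two_pos hl).trans (Nat.pow_log_le_self 2 hn.ne')
    exact_mod_cast this
  have hgl := mesh_le_pow hη hn l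
  have hgl2 := pow_le_mesh (η := η) hn l
  have hg' : (0 : ℝ) < g := by exact_mod_cast hg
  have h2l0 : (0 : ℝ) < 2 ^ l := by positivity
  have h3 : 2 ≤ 2 * ((n : ℝ) / g) := by
    have : 1 ≤ (n : ℝ) / g := by rw [le_div_iff₀ hg']; linarith
    linarith
  have h4 : (n : ℝ) / g ≤ 2 * n * (n : ℝ) ^ η / 2 ^ l := by
    rw [div_le_div_iff₀ hg' h2l0]
    have := mul_le_mul_of_nonneg_left hgl2 hn'.le
    linarith
  calc _ ≤ 3 * ((n : ℝ) / g) := by linarith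
    _ ≤ 3 * (2 * n * (n : ℝ) ^ η / 2 ^ l) := by gcongr
    _ = _ := by ring

lemma sqrt_add_le (a b : ℝ) : √(a + b) ≤ √a + √b := by
  rcases le_or_gt 0 a with ha | ha
  · rcases le_or_gt 0 b with hb | hb
    · rw [Real.sqrt_le_left (by positivity)]
      nlinarith [Real.sq_sqrt ha, Real.sq_sqrt hb, Real.sqrt_nonneg a, Real.sqrt_nonneg b]
    · exact (Real.sqrt_le_sqrt (by linarith)).trans (le_add_of_nonneg_right (Real.sqrt_nonneg b))
  · exact (Real.sqrt_le_sqrt (by linarith)).trans (le_add_of_nonneg_left (Real.sqrt_nonneg a))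

/-- The penalty compensates the noise at every scale: under the null hypothesis the penalized maximum
is of smaller order than `√(log n)`. -/
theorem tendsto_nullLaw_penalized_gt {ε : ℝ} (hε : 0 < ε) :
    Tendsto (fun n => (nullLaw n).real {z | ∃ I ∈ allIntervals n,
      ε * √(Real.log n) < penalizedSum n z I}) atTop (𝓝 0) := by
  set η : ℝ := ε ^ 2 / 24 with hη
  have hη0 : 0 < η := by positivity
  rw [tendsto_order]
  refine ⟨fun a ha => Eventually.of_forall fun n => ha.trans_le measureReal_nonneg, fun δ hδ => ?_⟩
  have hs : Tendsto (fun n : ℕ => ε / 2 * √(Real.log n)) atTop atTop :=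
    ((Real.tendsto_sqrt_atTop.comp tendsto_log_nat).const_mul_atTop (by positivity))
  filter_upwards [eventually_nullLaw_net_le hη0 (half_pos hδ), eventually_gt_atTop 0,
    hs.eventually_ge_atTop (√(2 * Real.log 12) + 1), tendsto_log_nat.eventually_ge_atTop 1]
    with n hnet hn h1 hL
  have hn' : (0 : ℝ) < n := by exact_mod_cast hn
  refine lt_of_le_of_lt ?_ (half_lt_self hδ)
  refine le_trans (measureReal_mono fun z hz => ?_) (hnet (allIntervals n) subset_rfl
    (fun l => Real.log (6 * n / 2 ^ l)) (fun l hl => ?_) fun l hl =>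
      card_leftGrid_allIntervals_le hη0.le hn hl)
  · obtain ⟨I, hI, h⟩ := hz
    refine ⟨I, hI, ?_⟩
    rw [penalizedSum_eq, penalty_eq hI] at h
    set ℓ : ℝ := (I.2 : ℝ) - I.1 with hℓ
    have hℓ1 : 1 ≤ ℓ := len_pos hI
    have hlev : ℓ ≤ 2 * 2 ^ level I := by
      rw [hℓ, ← cast_len hI]
      have := (lt_two_pow_level_succ I).le
      rw [pow_succ, mul_comm] at this
      exact_mod_cast this
    have hQ : Real.log (6 * n / 2 ^ level I) ≤ Real.log 12 + (Real.log n - Real.log ℓ) := by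
      rw [← Real.log_div hn'.ne' (by linarith), ← Real.log_mul (by norm_num) (by positivity)]
      refine Real.log_le_log (by positivity) ?_
      rw [← mul_div_assoc, div_le_div_iff₀ (by positivity) (by linarith)]
      nlinarith
    have e1 : √(2 * Real.log (6 * n / 2 ^ level I) + 6 * η * Real.log n)
        ≤ √(2 * (1 + Real.log n - Real.log ℓ)) + √(2 * Real.log 12) + ε / 2 * √(Real.log n) := by
      have : ε / 2 * √(Real.log n) = √(6 * η * Real.log n) := by
        rw [hη, show 6 * (ε ^ 2 / 24) * Real.log n = (ε / 2) ^ 2 * Real.log n by ring,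
          Real.sqrt_mul (by positivity), Real.sqrt_sq (by positivity)]
      rw [this]
      refine (sqrt_add_le _ _).trans ?_
      gcongr
      refine le_trans (Real.sqrt_le_sqrt ?_) (sqrt_add_le _ _)
      linarith
    show √(2 * Real.log (6 * n / 2 ^ level I) + 6 * η * Real.log n) + 1 < _
    linarith
  · have h2l : (2 : ℝ) ^ l ≤ n := by
      have : 2 ^ l ≤ n := (Nat.pow_le_pow_right two_pos hl).trans (Nat.pow_log_le_self 2 hn.ne')
      exact_mod_cast this
    refine Real.log_nonneg ?_
    rw [le_div_iff₀ (by positivity)]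
    linarith

/-! ### Intervals that meet a block -/

lemma card_leftGrid_overlap_le {η : ℝ} {n b m : ℕ} (hη : 0 ≤ η) (hn : 0 < n) (hm : 0 < m)
    {S : Finset ℕ} (hS : S ∈ placements n b m) (l : ℕ) :
    ((leftGrid η n ((allIntervals n).filter fun I => 0 < overlap b S I) l).card : ℝ)
      ≤ Real.exp (Real.log (2 * m * (b / 2 ^ l + 5))) * (n : ℝ) ^ η := by
  set g := mesh η n l with hgdef
  have hg : 0 < g := mesh_pos _ _ _
  have hn' : (0 : ℝ) < n := by exact_mod_cast hn
  have hm' : (0 : ℝ) < m := by exact_mod_cast hm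
  rw [Real.exp_log (by positivity)]
  set w : ℕ := (b + 2 * 2 ^ l) / g with hw
  have hsub : leftGrid η n ((allIntervals n).filter fun I => 0 < overlap b S I) l
      ⊆ S.biUnion fun j => Finset.Ico ((j - 2 * 2 ^ l) / g) ((j - 2 * 2 ^ l) / g + (w + 3)) := by
    intro u hu
    obtain ⟨I, hI, rfl⟩ := Finset.mem_image.1 hu
    rw [Finset.mem_filter, Finset.mem_filter] at hI
    obtain ⟨⟨hIn, hov⟩, hlev⟩ := hI
    obtain ⟨x, hx⟩ := Finset.card_pos.1 hov
    simp only [support, Finset.mem_inter, Finset.mem_biUnion, Finset.mem_Ioc] at hx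
    obtain ⟨⟨x1, x2⟩, j, hj, x3, x4⟩ := hx
    have hlt := lt_two_pow_level_succ I
    rw [hlev, pow_succ] at hlt
    refine Finset.mem_biUnion.2 ⟨j, hj, ?_⟩
    change (I.1 + g - 1) / g ∈ _
    rw [Finset.mem_Ico]
    refine ⟨Nat.div_le_div_right (by omega), ?_⟩
    have a1 : (I.1 + g - 1) / g ≤ ((j - 2 * 2 ^ l) + (b + 2 * 2 ^ l) + g) / g :=
      Nat.div_le_div_right (by omega)
    rw [Nat.add_div_right _ hg] at a1
    have a2 : ((j - 2 * 2 ^ l) + (b + 2 * 2 ^ l)) / g ≤ (j - 2 * 2 ^ l) / g + w + 1 := by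
      rw [Nat.add_div hg]; split_ifs <;> omega
    omega
  have hc : (leftGrid η n ((allIntervals n).filter fun I => 0 < overlap b S I) l).card
      ≤ m * (w + 3) := by
    refine (Finset.card_le_card hsub).trans ?_
    rw [← (mem_placements.1 hS).2.1]
    exact Finset.card_biUnion_le_card_mul _ _ _ fun j _ => by simp
  have hgl := mesh_le_pow hη hn l
  have hgl2 := pow_le_mesh (η := η) hn l
  have hg' : (0 : ℝ) < g := by exact_mod_cast hg
  have h2l0 : (0 : ℝ) < 2 ^ l := by positivity
  have hw' : (w : ℝ) ≤ (b + 2 * 2 ^ l) / g := by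
    refine le_trans (Nat.cast_div_le (α := ℝ)) ?_
    push_cast; exact le_rfl
  have h3 : (3 : ℝ) ≤ 3 * 2 ^ l / g := by rw [le_div_iff₀ hg']; linarith
  have h4 : (2 : ℝ) ^ l / g ≤ 2 * (n : ℝ) ^ η := by rw [div_le_iff₀ hg']; exact hgl2
  calc ((leftGrid η n ((allIntervals n).filter fun I => 0 < overlap b S I) l).card : ℝ)
      ≤ m * (w + 3) := by exact_mod_cast hc
    _ ≤ m * ((b + 2 * 2 ^ l) / g + 3 * 2 ^ l / g) := by gcongr
    _ = m * (b / 2 ^ l + 5) * (2 ^ l / g) := by field_simp; ring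
    _ ≤ m * (b / 2 ^ l + 5) * (2 * (n : ℝ) ^ η) := by gcongr
    _ = _ := by ring

/-! ### The approximating set -/

lemma mem_appIntervals {n : ℕ} {I : ℕ × ℕ} : I ∈ appIntervals n ↔ ∃ l ≤ maxLevel n,
    I ∈ allIntervals n ∧ spacing n l ∣ I.1 ∧ spacing n l ∣ I.2 ∧ 2 ^ l < 2 * (I.2 - I.1) ∧
      I.2 - I.1 ≤ 2 ^ l := by
  simp only [appIntervals, appIntervalsAt, Finset.mem_biUnion, Finset.mem_range, Finset.mem_filter,
    Nat.lt_succ_iff]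

lemma appIntervals_subset (n : ℕ) : appIntervals n ⊆ allIntervals n := fun _ hI =>
  let ⟨_, _, h, _⟩ := mem_appIntervals.1 hI; h

/-- The approximating set contains an interval `(0, D]` that covers at least the proportion `1 / 16`
of the design points. -/
lemma exists_long_mem_appIntervals {n : ℕ} (hn : 9 ≤ n) :
    ∃ D, (0, D) ∈ appIntervals n ∧ n ≤ 16 * D := by
  have hn' : (9 : ℝ) ≤ n := by exact_mod_cast hn
  have hpos : 0 < Real.logb 2 ((n : ℝ) / 8) := Real.logb_pos one_lt_two (by linarith)
  set l := maxLevel n with hl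
  have hl1 : 0 < l := Nat.ceil_pos.2 hpos
  obtain ⟨k, hk⟩ : ∃ k, l = k + 1 := ⟨l - 1, by omega⟩
  have hup : (n : ℝ) / 8 ≤ 2 ^ l := by
    have := Nat.le_ceil (Real.logb 2 ((n : ℝ) / 8))
    rw [Real.logb_le_iff_le_rpow one_lt_two (by positivity)] at this
    exact_mod_cast this
  have hlow : (2 : ℝ) ^ k < (n : ℝ) / 8 := by
    have := Nat.ceil_lt_add_one hpos.le
    change (l : ℝ) < _ at this
    rw [hk] at this
    push_cast at this
    have h2 : (k : ℝ) < Real.logb 2 ((n : ℝ) / 8) := by linarith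
    rw [Real.lt_logb_iff_rpow_lt one_lt_two (by positivity)] at h2
    exact_mod_cast h2
  have hz : (2 : ℝ) ^ ((l : ℤ) - 1) = 2 ^ k := by rw [hk]; simp
  have hp1 : precision n l ≤ 1 := by
    rw [precision, hz]
    have : 1 ≤ √(Real.logb 2 ((n : ℝ) / 2 ^ k)) := by
      rw [Real.one_le_sqrt, Real.le_logb_iff_rpow_le one_lt_two (by positivity), Real.rpow_one,
        le_div_iff₀ (by positivity)]
      linarith
    rw [div_le_one (by positivity)]
    linarith
  have hp0 : 0 < precision n l := by
    rw [precision, hz]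
    have : 0 < Real.logb 2 ((n : ℝ) / 2 ^ k) := by
      refine Real.logb_pos one_lt_two ?_
      rw [lt_div_iff₀ (by positivity)]; linarith
    positivity
  set d := spacing n l with hd
  have hdle : d ≤ 2 ^ k := by
    rw [hd, spacing, hz, Nat.ceil_le]
    push_cast
    exact mul_le_of_le_one_left (by positivity) hp1
  have hd0 : 0 < d := by
    rw [hd, spacing, hz, Nat.ceil_pos]; positivity
  have h1 := Nat.div_add_mod (2 ^ l) d
  have h2 := Nat.mod_lt (2 ^ l) hd0
  have h2l : 2 ^ l = 2 * 2 ^ k := by rw [hk, pow_succ]; ring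
  have hnk : 8 * 2 ^ k < n := by
    have : (8 : ℝ) * 2 ^ k < n := by linarith
    exact_mod_cast this
  have hnl : n ≤ 8 * 2 ^ l := by
    have : (n : ℝ) ≤ 8 * 2 ^ l := by linarith
    exact_mod_cast this
  refine ⟨d * (2 ^ l / d), mem_appIntervals.2 ⟨l, le_rfl, mem_allIntervals.2 ⟨?_, ?_⟩,
    dvd_zero _, dvd_mul_right _ _, ?_, ?_⟩, ?_⟩ <;> (try dsimp only) <;> omega

/-- Every short interval contains an interval of the approximating set of almost the same length. -/
lemma eventually_exists_inner_mem_appIntervals {a δ : ℝ} (ha : a < 1) (hδ : 0 < δ)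
    (hδ1 : δ < 1 / 2) :
    ∀ᶠ n : ℕ in atTop, ∀ b j : ℕ, 0 < b → (b : ℝ) ≤ (n : ℝ) ^ a → j + b ≤ n →
      ∃ J ∈ appIntervals n, j ≤ J.1 ∧ J.2 ≤ j + b ∧ (1 - δ) * b ≤ (J.2 : ℝ) - J.1 := by
  set η := δ / 2 with hη
  have hη0 : 0 < η := by positivity
  filter_upwards [eventually_gt_atTop 0,
    (tendsto_order.1 (tendsto_rpow_neg_nat (sub_pos.2 ha))).2 (1 / 16) (by norm_num),
    tendsto_log_nat.eventually_ge_atTop ((1 / η) ^ 2 / (1 - a))] with n hn h16 hlog b j hb hbn hjb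
  have hn' : (0 : ℝ) < n := by exact_mod_cast hn
  have hb' : (1 : ℝ) ≤ b := by exact_mod_cast hb
  set c := ⌈(1 - η) * b⌉₊ with hc
  set l := Nat.clog 2 c with hl
  have hcl : (1 - η) * b ≤ (2 : ℝ) ^ l := by
    have h1 := Nat.le_ceil ((1 - η) * b)
    have h2 : (c : ℝ) ≤ (2 : ℝ) ^ l := by exact_mod_cast Nat.le_pow_clog one_lt_two c
    exact h1.trans h2
  have hlc : (2 : ℝ) ^ l < 2 * ((1 - η / 2) * b) := by
    rcases Nat.eq_zero_or_pos l with h0 | h0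
    · rw [h0, pow_zero]; nlinarith
    · have hc1 : 1 < c := by
        by_contra! h
        rw [hl, Nat.clog_of_right_le_one h] at h0
        omega
      have h1 : 2 ^ (l - 1) < c := Nat.pow_pred_clog_lt_self one_lt_two hc1
      have h2 := Nat.lt_ceil.1 h1
      push_cast at h2
      have h3 : (2 : ℝ) ^ l = 2 * 2 ^ (l - 1) := by
        rw [← pow_succ', Nat.sub_add_cancel h0]
      rw [h3]; nlinarith
  have hl2b : (2 : ℝ) ^ l ≤ 2 * b := by nlinarith
  have hna : (n : ℝ) ^ a = n * (n : ℝ) ^ (-(1 - a)) := by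
    rw [show (n : ℝ) * (n : ℝ) ^ (-(1 - a)) = (n : ℝ) ^ (1 : ℝ) * (n : ℝ) ^ (-(1 - a)) by
      rw [Real.rpow_one], ← Real.rpow_add hn']
    congr 1; ring
  have hlmax : l ≤ maxLevel n := by
    have : (l : ℝ) ≤ Real.logb 2 ((n : ℝ) / 8) := by
      rw [Real.le_logb_iff_rpow_le one_lt_two (by positivity), Real.rpow_natCast]
      nlinarith
    exact_mod_cast this.trans (Nat.le_ceil _)
  have hzp : (2 : ℝ) ^ ((l : ℤ) - 1) = 2 ^ l / 2 := by
    rw [zpow_sub₀ two_ne_zero, zpow_natCast, zpow_one]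
  -- the relative precision tends to zero since `n / b` grows polynomially
  have hX : (1 / η) ^ 2 ≤ Real.logb 2 ((n : ℝ) / (2 ^ l / 2)) := by
    have h1 : Real.log ((n : ℝ) ^ (1 - a)) ≤ Real.log ((n : ℝ) / (2 ^ l / 2)) := by
      refine Real.log_le_log (by positivity) ?_
      rw [le_div_iff₀ (by positivity)]
      calc (n : ℝ) ^ (1 - a) * (2 ^ l / 2) ≤ (n : ℝ) ^ (1 - a) * (n : ℝ) ^ a := by
            gcongr; linarith
        _ = n := by rw [← Real.rpow_add hn']; simp
    rw [Real.log_rpow hn'] at h1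
    have h2 : (1 / η) ^ 2 ≤ (1 - a) * Real.log n := by
      rw [div_le_iff₀ (by linarith)] at hlog; linarith
    have h3 : 0 < (1 / η) ^ 2 := by positivity
    rw [Real.logb, le_div_iff₀ (Real.log_pos one_lt_two)]
    have : Real.log 2 ≤ 1 := by linarith [Real.log_two_lt_d9]
    nlinarith
  have hprec : precision n l ≤ η / 4 := by
    rw [precision, hzp]
    have h1 : 1 / η ≤ √(Real.logb 2 ((n : ℝ) / (2 ^ l / 2))) := Real.le_sqrt_of_sq_le hX
    have h2 : 0 < 1 / η := by positivity
    calc 1 / (6 * √(Real.logb 2 ((n : ℝ) / (2 ^ l / 2)))) ≤ 1 / (6 * (1 / η)) := by gcongr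
      _ = η / 6 := by field_simp
      _ ≤ η / 4 := by linarith
  have hprec0 : 0 < precision n l := by
    rw [precision, hzp]
    have : 0 < Real.logb 2 ((n : ℝ) / (2 ^ l / 2)) := lt_of_lt_of_le (by positivity) hX
    positivity
  set g := spacing n l with hg
  have hg0 : 0 < g := by
    rw [hg, spacing, Nat.ceil_pos]; positivity
  have hg1 : (g : ℝ) - 1 ≤ η / 4 * (2 ^ l / 2) := by
    have h1 := Nat.ceil_lt_add_one (a := precision n l * (2 : ℝ) ^ ((l : ℤ) - 1)) (by positivity)
    change (g : ℝ) < _ at h1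
    rw [hzp] at h1
    have : precision n l * (2 ^ l / 2) ≤ η / 4 * (2 ^ l / 2) := by gcongr
    linarith
  set b' := min b (2 ^ l) with hb'def
  obtain ⟨s1, s2, s3, s4⟩ := innerInterval_spec hg0 (j, j + b')
  set J := innerInterval g (j, j + b') with hJ
  simp only at s1 s2 s3 s4
  have hgm : ((g - 1 : ℕ) : ℝ) = g - 1 := by rw [Nat.cast_sub hg0]; simp
  have c2 : (J.1 : ℝ) ≤ j + (g - 1) := by rw [← hgm]; exact_mod_cast s2
  have c4 : (j : ℝ) + b' ≤ J.2 + (g - 1) := by rw [← hgm]; exact_mod_cast s4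
  have hb'le : b' ≤ b := min_le_left _ _
  have hb'le2 : b' ≤ 2 ^ l := min_le_right _ _
  have h2l0 : (0 : ℝ) < 2 ^ l := by positivity
  have hb'ge : (1 - η) * b ≤ b' - η / 4 * 2 ^ l + η / 2 * b ∧ (2 : ℝ) ^ l < 2 * (b' - η / 4 * 2 ^ l) := by
    have k1 : η / 4 * 2 ^ l ≤ η / 4 * (2 * b) := by gcongr
    have k2 : η * 2 ^ l ≤ 1 * 2 ^ l := by gcongr; linarith
    rcases min_choice b (2 ^ l) with h | h
    · rw [hb'def, h]; constructor <;> linarith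
    · rw [hb'def, h]; push_cast; constructor <;> linarith
  have hlenJ : (b' : ℝ) - η / 4 * 2 ^ l ≤ (J.2 : ℝ) - J.1 := by linarith
  have hJlt : (J.1 : ℝ) < J.2 := by linarith [hb'ge.2]
  have hJlt' : J.1 < J.2 := by exact_mod_cast hJlt
  refine ⟨J, mem_appIntervals.2 ⟨l, hlmax, mem_allIntervals.2 ⟨hJlt', by omega⟩, dvd_mul_right _ _,
    dvd_mul_right _ _, ?_, by omega⟩, s1, by omega, ?_⟩
  · have h1 : (2 : ℝ) ^ l < 2 * ((J.2 - J.1 : ℕ) : ℝ) := by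
      rw [Nat.cast_sub hJlt'.le]; linarith [hb'ge.2]
    exact_mod_cast h1
  · have : η / 2 * b ≤ η * b := by gcongr; linarith
    have h2 : δ = 2 * η := by rw [hη]; ring
    rw [h2]
    linarith [hb'ge.1]

/-! ### Number and length of the blocks -/

section Sizes

variable {α β : ℝ} {n : ℕ}

lemma blockLength_le (α : ℝ) (n : ℕ) : (blockLength α n : ℝ) ≤ (n : ℝ) ^ α :=
  Nat.floor_le (by positivity)

lemma blockLength_pos (hα : 0 ≤ α) (hn : 0 < n) : 0 < blockLength α n :=
  Nat.floor_pos.2 (Real.one_le_rpow (by exact_mod_cast hn) hα)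

lemma le_two_mul_floor {x : ℝ} (hx : 1 ≤ x) : x ≤ 2 * (⌊x⌋₊ : ℝ) := by
  have h1 := Nat.lt_floor_add_one x
  have h2 : (1 : ℝ) ≤ ⌊x⌋₊ := by exact_mod_cast Nat.floor_pos.2 hx
  linarith

lemma rpow_le_blockLength (hα : 0 ≤ α) (hn : 0 < n) :
    (n : ℝ) ^ α ≤ 2 * (blockLength α n : ℝ) :=
  le_two_mul_floor (Real.one_le_rpow (by exact_mod_cast hn) hα)

lemma numBlocks_le (α β : ℝ) (n : ℕ) : (numBlocks α β n : ℝ) ≤ (n : ℝ) ^ (1 - α - β) :=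
  Nat.floor_le (by positivity)

lemma numBlocks_pos (h : α + β ≤ 1) (hn : 0 < n) : 0 < numBlocks α β n :=
  Nat.floor_pos.2 (Real.one_le_rpow (by exact_mod_cast hn) (by linarith))

lemma rpow_le_numBlocks (h : α + β ≤ 1) (hn : 0 < n) :
    (n : ℝ) ^ (1 - α - β) ≤ 2 * (numBlocks α β n : ℝ) :=
  le_two_mul_floor (Real.one_le_rpow (by exact_mod_cast hn) (by linarith))

lemma numBlocks_mul_blockLength_le (hn : 0 < n) :
    (numBlocks α β n : ℝ) * blockLength α n ≤ (n : ℝ) ^ (1 - β) := by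
  have hn' : (0 : ℝ) < n := by exact_mod_cast hn
  calc (numBlocks α β n : ℝ) * blockLength α n ≤ (n : ℝ) ^ (1 - α - β) * (n : ℝ) ^ α := by
        gcongr
        · exact numBlocks_le α β n
        · exact blockLength_le α n
    _ = _ := by rw [← Real.rpow_add hn']; congr 1; ring

lemma eventually_placements_nonempty (hα : 0 ≤ α) (hβ : 0 ≤ β) :
    ∀ᶠ n in atTop, (placements n (blockLength α n) (numBlocks α β n)).Nonempty := by
  filter_upwards [eventually_gt_atTop 0] with n hn
  refine placements_nonempty (blockLength_pos hα hn) ?_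
  have h1 := numBlocks_mul_blockLength_le (α := α) (β := β) hn
  have h2 : (n : ℝ) ^ (1 - β) ≤ n := by
    calc (n : ℝ) ^ (1 - β) ≤ (n : ℝ) ^ (1 : ℝ) :=
          Real.rpow_le_rpow_of_exponent_le (by exact_mod_cast hn) (by linarith)
      _ = n := Real.rpow_one _
  exact_mod_cast h1.trans h2

end Sizes

/-! ### Most placements are spread out -/

open Classical in
lemma card_placements_crowded_le {n b m L k : ℕ} (hb : 0 < b) (hL : 0 < L) (hk : 0 < k) :
    ((placements n b m).filter fun S => ∃ a, k ≤ (S ∩ Finset.Ico a (a + L)).card).card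
        * (n - 2 * (m * b)) ^ k
      ≤ (n / L + 1) * ((placements n b m).card * (m * (2 * L)) ^ k) := by
  rcases le_or_gt k m with hkm | hkm
  · have hsub : ((placements n b m).filter fun S => ∃ a, k ≤ (S ∩ Finset.Ico a (a + L)).card)
        ⊆ (Finset.range (n / L + 1)).biUnion fun i =>
          (placements n b m).filter fun S => k ≤ (S ∩ Finset.Ico (i * L) (i * L + 2 * L)).card := by
      intro S hS
      obtain ⟨hSP, a, ha⟩ := Finset.mem_filter.1 hS
      have han : a ≤ n := by
        obtain ⟨x, hx⟩ := Finset.card_pos.1 (lt_of_lt_of_le hk ha)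
        rw [Finset.mem_inter, Finset.mem_Ico] at hx
        have := Finset.mem_range.1 ((mem_placements.1 hSP).1 hx.1)
        omega
      refine Finset.mem_biUnion.2 ⟨a / L, ?_, Finset.mem_filter.2 ⟨hSP, ha.trans ?_⟩⟩
      · rw [Finset.mem_range, Nat.lt_succ_iff]; exact Nat.div_le_div_right han
      · refine Finset.card_le_card (Finset.inter_subset_inter_left ?_)
        have h1 := Nat.div_add_mod a L
        have h2 := Nat.mod_lt a hL
        rw [mul_comm] at h1
        intro x; simp only [Finset.mem_Ico]; omega
    have h1 : ((placements n b m).filter fun S => ∃ a, k ≤ (S ∩ Finset.Ico a (a + L)).card).card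
        ≤ ∑ i ∈ Finset.range (n / L + 1),
          ((placements n b m).filter fun S =>
            k ≤ (S ∩ Finset.Ico (i * L) (i * L + 2 * L)).card).card :=
      (Finset.card_le_card hsub).trans Finset.card_biUnion_le
    refine (Nat.mul_le_mul_right _ h1).trans ?_
    rw [Finset.sum_mul]
    refine (Finset.sum_le_card_nsmul _ _ _ fun i _ => ?_).trans_eq
      (by rw [Finset.card_range, smul_eq_mul])
    have := card_placements_many_mul_le (n := n) (m := m) hb
      (Finset.Ico (i * L) (i * L + 2 * L)) k k hkm
    simpa using this
  · have : ((placements n b m).filter fun S => ∃ a, k ≤ (S ∩ Finset.Ico a (a + L)).card) = ∅ := by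
      refine Finset.filter_eq_empty_iff.2 fun S hS => ?_
      rintro ⟨a, ha⟩
      have := Finset.card_le_card (Finset.inter_subset_left (s₁ := S) (s₂ := Finset.Ico a (a + L)))
      rw [(mem_placements.1 hS).2.1] at this
      omega
    rw [this]; simp

lemma eventually_half_le {α β : ℝ} (hβ : 0 < β) :
    ∀ᶠ n : ℕ in atTop,
      (n : ℝ) / 2 ≤ ((n - 2 * (numBlocks α β n * blockLength α n) : ℕ) : ℝ) := by
  filter_upwards [eventually_gt_atTop 0,
    (tendsto_order.1 (tendsto_rpow_neg_nat hβ)).2 (1 / 4) (by norm_num)] with n hn h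
  have hn' : (0 : ℝ) < n := by exact_mod_cast hn
  have h1 := numBlocks_mul_blockLength_le (α := α) (β := β) hn
  have h2 : (n : ℝ) ^ (1 - β) = n * (n : ℝ) ^ (-β) := by
    rw [sub_eq_add_neg, Real.rpow_add hn', Real.rpow_one]
  have h3 : (n : ℝ) ≤ ((n - 2 * (numBlocks α β n * blockLength α n) : ℕ) : ℝ)
      + ((2 * (numBlocks α β n * blockLength α n) : ℕ) : ℝ) := by
    exact_mod_cast le_tsub_add
  push_cast at h3 ⊢
  nlinarith

open Classical in
/-- For most placements no window of length `n ^ s` contains `k` left endpoints, provided that the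
expected number of `k`-tuples of left endpoints in such windows tends to zero. -/
theorem eventually_spread {α β s : ℝ} (hα : 0 ≤ α) (hβ : 0 < β) (hs0 : 0 ≤ s)
    (hs1 : s ≤ 1) {k : ℕ} (hk : 0 < k) (hks : 1 - s < k * (α + β - s)) {δ : ℝ} (hδ : 0 < δ) :
    ∀ᶠ n : ℕ in atTop, ∃ G ⊆ placements n (blockLength α n) (numBlocks α β n),
      ((placements n (blockLength α n) (numBlocks α β n) \ G).card : ℝ)
          ≤ δ * (placements n (blockLength α n) (numBlocks α β n)).card ∧
        ∀ S ∈ G, ∀ a, (S ∩ Finset.Ico a (a + ⌈(n : ℝ) ^ s⌉₊)).card < k := by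
  have hc : 0 < k * (α + β - s) - (1 - s) := by linarith
  have hlim : Tendsto (fun n : ℕ => 2 * 8 ^ k * (n : ℝ) ^ (-(k * (α + β - s) - (1 - s)))) atTop
      (𝓝 0) := by simpa using (tendsto_rpow_neg_nat hc).const_mul (2 * 8 ^ k)
  filter_upwards [eventually_gt_atTop 0, eventually_half_le (α := α) hβ,
    (tendsto_order.1 hlim).2 δ hδ] with n hn hW hlt
  have hn' : (0 : ℝ) < n := by exact_mod_cast hn
  have hn1 : (1 : ℝ) ≤ n := by exact_mod_cast hn
  set b := blockLength α n
  set m := numBlocks α β n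
  set L := ⌈(n : ℝ) ^ s⌉₊ with hL
  set W := n - 2 * (m * b) with hWdef
  have hns1 : 1 ≤ (n : ℝ) ^ s := Real.one_le_rpow hn1 hs0
  have hL0 : 0 < L := Nat.ceil_pos.2 (by linarith)
  have hL1 : (n : ℝ) ^ s ≤ L := Nat.le_ceil _
  have hL2 : (L : ℝ) ≤ 2 * (n : ℝ) ^ s := by
    have := Nat.ceil_lt_add_one (a := (n : ℝ) ^ s) (by positivity)
    linarith
  set P := placements n b m with hP
  set B := P.filter fun S => ∃ a, k ≤ (S ∩ Finset.Ico a (a + L)).card with hB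
  refine ⟨P \ B, Finset.sdiff_subset, ?_, fun S hS a => ?_⟩
  · have hBP : P \ (P \ B) = B := by
      rw [Finset.sdiff_sdiff_eq_self (Finset.filter_subset _ _)]
    rw [hBP]
    have h1 : (B.card : ℝ) * (W : ℝ) ^ k
        ≤ ((n / L : ℕ) + 1) * (P.card * (m * (2 * L)) ^ k) := by
      exact_mod_cast card_placements_crowded_le (n := n) (m := m) (blockLength_pos hα hn) hL0 hk
    have hWpos : (0 : ℝ) < W := lt_of_lt_of_le (by positivity) hW
    have h2 : ((n / L : ℕ) : ℝ) + 1 ≤ 2 * (n : ℝ) ^ (1 - s) := by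
      have a1 : ((n / L : ℕ) : ℝ) ≤ n / L := Nat.cast_div_le
      have a2 : (n : ℝ) / L ≤ (n : ℝ) ^ (1 - s) := by
        rw [Real.rpow_sub hn', Real.rpow_one]; gcongr
      have a3 : 1 ≤ (n : ℝ) ^ (1 - s) := Real.one_le_rpow hn1 (by linarith)
      linarith
    have h3 : (m : ℝ) * (2 * L) ≤ 8 * (n : ℝ) ^ (s - α - β) * W := by
      calc (m : ℝ) * (2 * L) ≤ (n : ℝ) ^ (1 - α - β) * (2 * (2 * (n : ℝ) ^ s)) := by
            gcongr; exact numBlocks_le α β n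
        _ = 8 * (n : ℝ) ^ (s - α - β) * (n / 2) := by
            have : (n : ℝ) ^ (1 - α - β) * (n : ℝ) ^ s = (n : ℝ) ^ (s - α - β) * n := by
              rw [← Real.rpow_add hn', ← Real.rpow_add_one hn'.ne']; congr 1; ring
            linarith
        _ ≤ _ := by gcongr
    have h4 : (B.card : ℝ) * (W : ℝ) ^ k ≤ (δ * P.card) * (W : ℝ) ^ k := by
      calc (B.card : ℝ) * (W : ℝ) ^ k ≤ ((n / L : ℕ) + 1) * (P.card * (m * (2 * L)) ^ k) := h1
        _ ≤ 2 * (n : ℝ) ^ (1 - s) * (P.card * (8 * (n : ℝ) ^ (s - α - β) * W) ^ k) := by gcongr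
        _ = (2 * 8 ^ k * ((n : ℝ) ^ (1 - s) * ((n : ℝ) ^ (s - α - β)) ^ k)) * P.card * (W : ℝ) ^ k := by
            rw [mul_pow, mul_pow]; ring
        _ = (2 * 8 ^ k * (n : ℝ) ^ (-(k * (α + β - s) - (1 - s)))) * P.card * (W : ℝ) ^ k := by
            congr 3
            rw [← Real.rpow_natCast, ← Real.rpow_mul hn'.le, ← Real.rpow_add hn']
            congr 1; ring
        _ ≤ δ * P.card * (W : ℝ) ^ k := by gcongr
    exact le_of_mul_le_mul_right h4 (by positivity)
  · by_contra! h
    rw [Finset.mem_sdiff] at hS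
    exact hS.2 (Finset.mem_filter.2 ⟨hS.1, a, h⟩)

/-- If no window of length `L` contains more than `k` points of `S`, then a long window contains at
most `k` points for every `L` units of its length. -/
lemma card_inter_Ico_le {S : Finset ℕ} {L k : ℕ} (hL : 0 < L)
    (hS : ∀ a, (S ∩ Finset.Ico a (a + L)).card ≤ k) (a c : ℕ) :
    (S ∩ Finset.Ico a c).card ≤ ((c - a) / L + 1) * k := by
  have hsub : S ∩ Finset.Ico a c ⊆ (Finset.range ((c - a) / L + 1)).biUnion fun i =>
      S ∩ Finset.Ico (a + i * L) (a + i * L + L) := by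
    intro x hx
    rw [Finset.mem_inter, Finset.mem_Ico] at hx
    have h1 := Nat.div_add_mod (x - a) L
    have h2 := Nat.mod_lt (x - a) hL
    rw [mul_comm] at h1
    refine Finset.mem_biUnion.2 ⟨(x - a) / L, ?_, Finset.mem_inter.2 ⟨hx.1, ?_⟩⟩
    · rw [Finset.mem_range, Nat.lt_succ_iff]; exact Nat.div_le_div_right (by omega)
    · rw [Finset.mem_Ico]; omega
  refine (Finset.card_le_card hsub).trans ((Finset.card_biUnion_le_card_mul _ _ k fun i _ => hS _).trans_eq ?_)
  rw [Finset.card_range]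

lemma overlap_le_of_spread {n b L k : ℕ} {S : Finset ℕ} (hL : 0 < L) (hbL : b ≤ L)
    (hS : ∀ a, (S ∩ Finset.Ico a (a + L)).card ≤ k) {I : ℕ × ℕ} (hI : I ∈ allIntervals n) :
    (overlap b S I : ℝ) ≤ k * b * (((I.2 : ℝ) - I.1) / L + 2) := by
  have hI1 := (mem_allIntervals.1 hI).1
  have h1 := overlap_le_mul b S I
  have h2 := card_inter_Ico_le hL hS (I.1 + 1 - b) I.2
  have h3 : (I.2 - (I.1 + 1 - b)) / L + 1 ≤ (I.2 - I.1) / L + 2 := by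
    have : (I.2 - (I.1 + 1 - b)) / L ≤ ((I.2 - I.1) + L) / L := Nat.div_le_div_right (by omega)
    rw [Nat.add_div_right _ hL] at this
    omega
  have h4 : overlap b S I ≤ ((I.2 - I.1) / L + 2) * k * b :=
    h1.trans (Nat.mul_le_mul_right _ (h2.trans (Nat.mul_le_mul_right _ h3)))
  have h5 : (((I.2 - I.1) / L : ℕ) : ℝ) ≤ ((I.2 : ℝ) - I.1) / L := by
    refine Nat.cast_div_le.trans ?_
    rw [cast_len hI]
  calc (overlap b S I : ℝ) ≤ (((I.2 - I.1) / L : ℕ) + 2) * k * b := by exact_mod_cast h4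
    _ ≤ (((I.2 : ℝ) - I.1) / L + 2) * k * b := by gcongr
    _ = _ := by ring

/-! ### The increments caused by the blocks -/

/-- The shift of the standardized sum over an interval of length `ℓ` caused by `v` elevated means. -/
lemma increment_le_sqrt {μ v ℓ : ℝ} (hμ : 0 ≤ μ) (hℓ : 0 < ℓ) (hv : v ≤ ℓ) :
    μ * v / √ℓ ≤ μ * √ℓ := by
  rw [div_le_iff₀ (Real.sqrt_pos.2 hℓ), mul_assoc, Real.mul_self_sqrt hℓ.le]
  gcongr

lemma overlap_le_len_real {n : ℕ} {I : ℕ × ℕ} (hI : I ∈ allIntervals n) (b : ℕ) (S : Finset ℕ) :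
    (overlap b S I : ℝ) ≤ (I.2 : ℝ) - I.1 := by
  rw [← cast_len hI]; exact_mod_cast overlap_le_len b S I

lemma sqrt_rpow {x : ℝ} (hx : 0 ≤ x) (a : ℝ) : √(x ^ a) = x ^ (a / 2) := by
  rw [Real.sqrt_eq_rpow, ← Real.rpow_mul hx]; congr 1; ring

/-- The increments over intervals longer than `n ^ (α + 2 τ)`, for spread placements. -/
lemma increment_le_of_spread {n k : ℕ} {α s τ M : ℝ} (hn : 0 < n) (hM : 0 ≤ M) (hαs : α ≤ s)
    {S : Finset ℕ} (hS : ∀ a, (S ∩ Finset.Ico a (a + ⌈(n : ℝ) ^ s⌉₊)).card ≤ k) {I : ℕ × ℕ}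
    (hI : I ∈ allIntervals n) (hlong : (n : ℝ) ^ (α + 2 * τ) ≤ (I.2 : ℝ) - I.1) :
    M / √((n : ℝ) ^ α) * overlap (blockLength α n) S I / √((I.2 : ℝ) - I.1)
      ≤ M * k * ((n : ℝ) ^ ((1 + α) / 2 - s) + 2 * (n : ℝ) ^ (-τ)) := by
  have hn' : (0 : ℝ) < n := by exact_mod_cast hn
  have hn1 : (1 : ℝ) ≤ n := by exact_mod_cast hn
  set ℓ : ℝ := (I.2 : ℝ) - I.1 with hℓdef
  have hℓ : 1 ≤ ℓ := len_pos hI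
  have hℓn : ℓ ≤ n := len_le hI
  have hL1 : (n : ℝ) ^ s ≤ ⌈(n : ℝ) ^ s⌉₊ := Nat.le_ceil _
  have hns : 0 < (n : ℝ) ^ s := by positivity
  have hbL : blockLength α n ≤ ⌈(n : ℝ) ^ s⌉₊ := by
    have : (blockLength α n : ℝ) ≤ ⌈(n : ℝ) ^ s⌉₊ :=
      (blockLength_le α n).trans ((Real.rpow_le_rpow_of_exponent_le hn1 hαs).trans hL1)
    exact_mod_cast this
  have h1 := overlap_le_of_spread (Nat.ceil_pos.2 hns) hbL hS hI
  have h2 : (overlap (blockLength α n) S I : ℝ) ≤ k * (n : ℝ) ^ α * (ℓ / (n : ℝ) ^ s + 2) := by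
    refine h1.trans ?_
    gcongr
    exact blockLength_le α n
  have hsl : 0 < √ℓ := Real.sqrt_pos.2 (by linarith)
  rw [sqrt_rpow hn'.le]
  have hsn : √ℓ ≤ (n : ℝ) ^ (1 / 2 : ℝ) := by rw [← Real.sqrt_eq_rpow]; gcongr
  have hsl2 : (n : ℝ) ^ (α / 2 + τ) ≤ √ℓ := by
    have := Real.sqrt_le_sqrt hlong
    rw [sqrt_rpow hn'.le] at this
    convert this using 2; ring
  have e1 : (n : ℝ) ^ α / (n : ℝ) ^ (α / 2) = (n : ℝ) ^ (α / 2) := by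
    rw [← Real.rpow_sub hn']; congr 1; ring
  calc M / (n : ℝ) ^ (α / 2) * overlap (blockLength α n) S I / √ℓ
      ≤ M / (n : ℝ) ^ (α / 2) * (k * (n : ℝ) ^ α * (ℓ / (n : ℝ) ^ s + 2)) / √ℓ := by gcongr
    _ = M * k * ((n : ℝ) ^ α / (n : ℝ) ^ (α / 2)) * ((ℓ / √ℓ) / (n : ℝ) ^ s + 2 / √ℓ) := by
        field_simp
    _ = M * k * ((n : ℝ) ^ (α / 2) * √ℓ / (n : ℝ) ^ s + 2 * ((n : ℝ) ^ (α / 2) / √ℓ)) := by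
        rw [e1, Real.div_sqrt]; ring
    _ ≤ M * k * ((n : ℝ) ^ (α / 2) * (n : ℝ) ^ (1 / 2 : ℝ) / (n : ℝ) ^ s
          + 2 * ((n : ℝ) ^ (α / 2) / (n : ℝ) ^ (α / 2 + τ))) := by gcongr
    _ = _ := by
        rw [← Real.rpow_add hn', ← Real.rpow_sub hn', ← Real.rpow_sub hn']
        congr 3
        · congr 1; ring
        · congr 2; ring

lemma maxOver_observe_le {n b : ℕ} {F : Finset (ℕ × ℕ)} (hF : F ⊆ allIntervals n) (hne : F.Nonempty)
    {μ ε : ℝ} {S : Finset ℕ} {z : Fin n → ℝ}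
    (h : ∀ I ∈ F, μ * overlap b S I / √((I.2 : ℝ) - I.1) ≤ ε ∨
      penalizedSum n (observe n b μ S z) I ≤ maxOver n F z + ε) :
    maxOver n F (observe n b μ S z) ≤ maxOver n F z + ε := by
  refine (maxOver_le_iff hne).2 fun I hI => ?_
  rcases h I hI with h | h
  · have h1 := le_maxOver (x := z) hI
    rw [penalizedSum_eq] at h1
    rw [penalizedSum_observe (hF hI)]
    linarith
  · exact h

/-! ### The dense case below the boundary -/

/-- Below the dense boundary the increments caused by the blocks are, for most placements, bounded by a
negative power of `n`, whatever the noise. -/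
theorem isPowerless_dense {α β r : ℝ} (hα₀ : 0 ≤ α) (hβ : 0 ≤ β)
    (hαβ₁ : α + β ≤ 1) (hd : β < (1 - α) / 2) (hr : r < β - (1 - α) / 2)
    {F : ℕ → Finset (ℕ × ℕ)} (hF : ∀ n, F n ⊆ allIntervals n)
    (hne : ∀ᶠ n in atTop, (F n).Nonempty) :
    IsPowerless (fun n => maxOver n (F n)) (altLaw α β (denseMean α r)) := by
  have hP := eventually_placements_nonempty hα₀ hβ
  have hμ : ∀ n, 0 ≤ denseMean α r n := fun n => by unfold denseMean; positivity
  rcases hβ.eq_or_lt with h0 | h0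
  · -- without sparsity the Cauchy–Schwarz bound for the increments suffices
    subst h0
    have hc : 0 < -(r + (1 - α) / 2) := by linarith
    refine isPowerless_of_increment hμ hF hne hP
      (ε := fun n => (n : ℝ) ^ (-(-(r + (1 - α) / 2)))) (fun n => by positivity)
      (tendsto_rpow_neg_mul_log hc) fun δ hδ => ?_
    filter_upwards [eventually_gt_atTop 0, hne] with n hn hnen
    have hn' : (0 : ℝ) < n := by exact_mod_cast hn
    refine ⟨_, subset_rfl, by simpa using by positivity, fun S hS => ?_⟩
    have : {z | maxOver n (F n) z + (n : ℝ) ^ (-(-(r + (1 - α) / 2)))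
        < maxOver n (F n) (observe n (blockLength α n) (denseMean α r n) S z)} = ∅ := by
      refine Set.eq_empty_of_forall_notMem fun z hz => ?_
      rw [Set.mem_ofPred_eq] at hz
      refine hz.not_ge ?_
      refine maxOver_observe_le (hF n) hnen fun I hI => Or.inl ?_
      have hIn := hF n hI
      refine (increment_le_sqrt (hμ n) (by linarith [len_pos hIn])
        (overlap_le_len_real hIn _ _)).trans ?_
      calc denseMean α r n * √((I.2 : ℝ) - I.1) ≤ denseMean α r n * √n := by
            have := hμ n
            have := len_le hIn
            gcongr
        _ = _ := by
            rw [denseMean, sqrt_rpow hn'.le, Real.sqrt_eq_rpow, ← Real.rpow_sub hn',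
              ← Real.rpow_add hn']
            congr 1; ring
    rw [this]; simpa using hδ.le
  · obtain ⟨γ, hγ0, hγ⟩ : ∃ γ, 0 < γ ∧ γ < min β (β - (1 - α) / 2 - r) :=
      exists_between (lt_min h0 (by linarith))
    have hγβ := hγ.trans_le (min_le_left _ _)
    have hγr := hγ.trans_le (min_le_right _ _)
    obtain ⟨k, hk⟩ := exists_nat_gt (1 / γ)
    have hk0 : 0 < k := by
      have : (0 : ℝ) < k := lt_trans (by positivity) hk
      exact_mod_cast this
    rw [div_lt_iff₀ hγ0] at hk
    set c := min (-r) (β - (1 - α) / 2 - r - γ) with hc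
    have hc0 : 0 < c := lt_min (by linarith) (by linarith)
    refine isPowerless_of_increment hμ hF hne hP
      (ε := fun n => 3 * k * (n : ℝ) ^ (-c)) (fun n => by positivity) ?_ fun δ hδ => ?_
    · have := (tendsto_rpow_neg_mul_log hc0).const_mul (3 * (k : ℝ))
      simpa [mul_assoc] using this
    filter_upwards [eventually_gt_atTop 0, hne, eventually_spread (s := α + β - γ) hα₀ h0
      (by linarith) (by linarith) hk0 (by nlinarith) hδ] with n hn hnen ⟨G, hGP, hGc, hG⟩
    have hn' : (0 : ℝ) < n := by exact_mod_cast hn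
    have hn1 : (1 : ℝ) ≤ n := by exact_mod_cast hn
    refine ⟨G, hGP, hGc, fun S hS => ?_⟩
    have hk1 : (1 : ℝ) ≤ k := by exact_mod_cast hk0
    have : {z | maxOver n (F n) z + 3 * k * (n : ℝ) ^ (-c)
        < maxOver n (F n) (observe n (blockLength α n) (denseMean α r n) S z)} = ∅ := by
      refine Set.eq_empty_of_forall_notMem fun z hz => ?_
      rw [Set.mem_ofPred_eq] at hz
      refine hz.not_ge ?_
      refine maxOver_observe_le (hF n) hnen fun I hI => Or.inl ?_
      have hIn := hF n hI
      have hr1 : (n : ℝ) ^ r ≤ (n : ℝ) ^ (-c) :=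
        Real.rpow_le_rpow_of_exponent_le hn1 (by linarith [min_le_left (-r) (β - (1 - α) / 2 - r - γ)])
      have hnc : 0 ≤ (n : ℝ) ^ (-c) := by positivity
      rcases le_or_gt ((n : ℝ) ^ α) ((I.2 : ℝ) - I.1) with hl | hl
      · refine (increment_le_of_spread (τ := 0) hn (by positivity) (by linarith)
          (fun a => (hG S hS a).le) hIn (by simpa using hl)).trans ?_
        have h2 : (n : ℝ) ^ r * (n : ℝ) ^ ((1 + α) / 2 - (α + β - γ)) ≤ (n : ℝ) ^ (-c) := by
          rw [← Real.rpow_add hn']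
          refine Real.rpow_le_rpow_of_exponent_le hn1 ?_
          linarith [min_le_right (-r) (β - (1 - α) / 2 - r - γ)]
        rw [neg_zero, Real.rpow_zero]
        calc _ = k * ((n : ℝ) ^ r * (n : ℝ) ^ ((1 + α) / 2 - (α + β - γ)) + 2 * (n : ℝ) ^ r) := by
              ring
          _ ≤ k * ((n : ℝ) ^ (-c) + 2 * (n : ℝ) ^ (-c)) := by gcongr
          _ = _ := by ring
      · refine (increment_le_sqrt (hμ n) (by linarith [len_pos hIn])
          (overlap_le_len_real hIn _ _)).trans ?_
        have h3 : denseMean α r n * √((I.2 : ℝ) - I.1) ≤ (n : ℝ) ^ r := by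
          rw [denseMean, div_mul_eq_mul_div, div_le_iff₀ (by positivity)]
          gcongr
        nlinarith
    rw [this]; simpa using hδ.le

/-! ### The sparse case below the boundary -/

lemma sqrt_mul_log (a : ℝ) {L : ℝ} (hL : 0 ≤ L) : √(2 * a * L) = √2 * √a * √L := by
  rw [Real.sqrt_mul' _ hL, Real.sqrt_mul (by norm_num)]

/-- Intervals of length about `n ^ α` that meet a single block: the sum of the maximal noise near the
`n ^ (1 - α - β)` blocks and of the signal stays below the penalty. -/
lemma noise_add_signal_le_of_length_eq {L x Q α κ τ η r G : ℝ} (hL : 0 ≤ L)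
    (hτG : 2 * √(2 * τ) ≤ G / 4) (hηG : √(3 * η) ≤ G / 4) (hG : √κ + √r + G ≤ √(1 - α)) (hG0 : 0 ≤ G)
    (hx : x ≤ (α + 2 * τ) * L) (hQ : Q ≤ Real.log 14 + (κ + 2 * τ) * L) :
    √(2 * Q + 6 * η * L) + √(2 * r * L) - √(2 * (1 + L - x))
      ≤ √(2 * Real.log 14) - G / 2 * √L := by
  have e1 : √(2 * Q + 6 * η * L) ≤ √(2 * Real.log 14) + (√2 * √κ * √L + (√2 * √(2 * τ) * √L +
      √2 * √(3 * η) * √L)) := by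
    rw [← sqrt_mul_log _ hL, ← sqrt_mul_log _ hL, ← sqrt_mul_log _ hL]
    refine le_trans (Real.sqrt_le_sqrt (y := 2 * Real.log 14 +
      (2 * κ * L + (2 * (2 * τ) * L + 2 * (3 * η) * L))) (by linarith)) ?_
    exact (sqrt_add_le _ _).trans (add_le_add_right ((sqrt_add_le _ _).trans
      (add_le_add_right (sqrt_add_le _ _) _)) _)
  have e2 : √2 * √(1 - α) * √L ≤ √(2 * (1 + L - x)) + √2 * √(2 * τ) * √L := by
    rw [← sqrt_mul_log _ hL, ← sqrt_mul_log _ hL]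
    refine le_trans (Real.sqrt_le_sqrt ?_) (sqrt_add_le _ _)
    linarith
  rw [sqrt_mul_log r hL]
  have hs : 0 ≤ √L := Real.sqrt_nonneg L
  have h2 : 1 ≤ √2 := Real.one_le_sqrt.2 one_le_two
  have e3 : √2 * √L * (√κ + √r + G) ≤ √2 * √L * √(1 - α) := by gcongr
  have e4 : √2 * √L * (2 * √(2 * τ) + √(3 * η)) ≤ √2 * √L * (G / 2) :=
    mul_le_mul_of_nonneg_left (by linarith) (by positivity)
  have e5 : G / 2 * √L * 1 ≤ G / 2 * √L * √2 := by gcongr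
  linarith

/-- Intervals that are much shorter than the blocks: the signal is negligible, and the noise near the
blocks stays below the penalty since only few of these intervals meet a block. -/
lemma noise_le_of_length_lt {L x Q α β η : ℝ} (hL : 0 ≤ L) (hβ : 0 ≤ β)
    (hηβ : √(6 * η) ≤ β / 4) (hαβ : α + β ≤ 1) (hα : 0 ≤ α) (hx0 : 0 ≤ x) (hx : x ≤ α * L)
    (hQ : Q ≤ Real.log 14 + ((1 - β) * L - x)) :
    √(2 * Q + 6 * η * L) - √(2 * (1 + L - x)) ≤ √(2 * Real.log 14) - β / 4 * √L := by
  have e1 : √(2 * Q + 6 * η * L) ≤ √(2 * Real.log 14) + (√(2 * ((1 - β) * L - x)) + √(6 * η) * √L) := by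
    rw [← Real.sqrt_mul' _ hL]
    refine le_trans (Real.sqrt_le_sqrt (y := 2 * Real.log 14 +
      (2 * ((1 - β) * L - x) + 6 * η * L)) (by linarith)) ?_
    exact (sqrt_add_le _ _).trans (add_le_add_right (sqrt_add_le _ _) _)
  set A := 2 * (L - x) with hA
  have hAL : 2 * β * L ≤ A := by nlinarith
  have hA0 : 0 ≤ A := le_trans (by positivity) hAL
  have e2 : √A ≤ √(2 * (1 + L - x)) := Real.sqrt_le_sqrt (by linarith)
  have hsL := Real.sqrt_nonneg L
  have hsA := Real.sqrt_nonneg A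
  have q1 := Real.sq_sqrt hL
  have q2 := Real.sq_sqrt hA0
  have hβ1 : β ≤ 1 := by linarith
  have e3 : β / 2 * √L ≤ √A := by
    refine Real.le_sqrt_of_sq_le ?_
    rw [mul_pow, q1]
    nlinarith
  have hsAL : √A ≤ 2 * √L := by
    rw [Real.sqrt_le_left (by positivity), mul_pow, q1]
    linarith
  have e4 : √(2 * ((1 - β) * L - x)) ≤ √A - β / 2 * √L := by
    rw [Real.sqrt_le_left (by linarith)]
    have e : (√A - β / 2 * √L) ^ 2 = A - β * (√A * √L) + β ^ 2 / 4 * L := by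
      rw [sub_sq, q2, mul_pow, q1]; ring
    have h1 : √A * √L ≤ 2 * L := by
      calc √A * √L ≤ (2 * √L) * √L := by gcongr
        _ = 2 * L := by rw [mul_assoc, Real.mul_self_sqrt hL]
    have h2 : β * (√A * √L) ≤ β * (2 * L) := by gcongr
    have h3 : 0 ≤ β ^ 2 / 4 * L := by positivity
    rw [e]
    linarith
  have e5 : √(6 * η) * √L ≤ β / 4 * √L := by gcongr
  linarith

lemma tendsto_sqrt_log : Tendsto (fun n : ℕ => √(Real.log n)) atTop atTop :=
  Real.tendsto_sqrt_atTop.comp tendsto_log_nat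

lemma increment_le_amplitude {M A v ℓ : ℝ} (hM : 0 ≤ M) (hA : 0 < A) (hℓ : 0 < ℓ) (hv0 : 0 ≤ v)
    (hvℓ : v ≤ ℓ) (hvA : v ≤ A) : M / √A * v / √ℓ ≤ M := by
  have h1 : v ≤ √A * √ℓ := by
    rw [← Real.sqrt_mul hA.le]
    refine Real.le_sqrt_of_sq_le ?_
    rw [sq]
    exact mul_le_mul hvA hvℓ hv0 hA.le
  have hsA : 0 < √A := Real.sqrt_pos.2 hA
  have hsℓ : 0 < √ℓ := Real.sqrt_pos.2 hℓ
  calc M / √A * v / √ℓ ≤ M / √A * (√A * √ℓ) / √ℓ := by gcongr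
    _ = M := by field_simp

lemma increment_le_of_short {n : ℕ} {α τ M v ℓ : ℝ} (hn : 0 < n) (hM : 0 ≤ M) (hℓ : 0 < ℓ)
    (hvℓ : v ≤ ℓ) (hshort : ℓ ≤ (n : ℝ) ^ (α - 2 * τ)) :
    M / √((n : ℝ) ^ α) * v / √ℓ ≤ M * (n : ℝ) ^ (-τ) := by
  have hn' : (0 : ℝ) < n := by exact_mod_cast hn
  have h1 : √ℓ ≤ √((n : ℝ) ^ α) * (n : ℝ) ^ (-τ) := by
    rw [sqrt_rpow hn'.le, ← Real.rpow_add hn']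
    refine (Real.sqrt_le_sqrt hshort).trans_eq ?_
    rw [sqrt_rpow hn'.le]; congr 1; ring
  have h2 : √((n : ℝ) ^ α) ≠ 0 := by positivity
  calc _ ≤ M / √((n : ℝ) ^ α) * √ℓ := increment_le_sqrt (by positivity) hℓ hvℓ
    _ ≤ M / √((n : ℝ) ^ α) * (√((n : ℝ) ^ α) * (n : ℝ) ^ (-τ)) := by gcongr
    _ = _ := by field_simp

/-- Below the sparse boundary the intervals of length at most `n ^ (α + 2 τ)` that meet a single
block are not competitive. -/
lemma eventually_short_le {α β r τ η G c : ℝ} (hα₀ : 0 ≤ α) (hβ : 0 < β) (hαβ₁ : α + β ≤ 1)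
    (hτ : 0 < τ) (hG0 : 0 < G)
    (hτG : 2 * √(2 * τ) ≤ G / 4) (hηG : √(3 * η) ≤ G / 4) (hηβ : √(6 * η) ≤ β / 4)
    (hG : √(1 - α - β) + √r + G ≤ √(1 - α)) (hcG : c ≤ G / 4) (hcβ : c ≤ β / 8) :
    ∀ᶠ n : ℕ in atTop, ∀ (l : ℕ) (ℓ v : ℝ), 1 ≤ ℓ → ℓ ≤ 2 * 2 ^ l → v ≤ ℓ → 0 ≤ v →
      v ≤ (n : ℝ) ^ α → ℓ < (n : ℝ) ^ (α + 2 * τ) →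
      √(2 * Real.log (2 * numBlocks α β n * (blockLength α n / 2 ^ l + 5)) + 6 * η * Real.log n) + 1
        + √(2 * r * Real.log n) / √((n : ℝ) ^ α) * v / √ℓ - √(2 * (1 + Real.log n - Real.log ℓ))
      ≤ -(c * √(Real.log n)) := by
  have hlim1 := (tendsto_sqrt_log.const_mul_atTop (by positivity : 0 < G / 4)).eventually_ge_atTop
    (√(2 * Real.log 14) + 2)
  have hlim2 := (tendsto_sqrt_log.const_mul_atTop (by positivity : 0 < β / 8)).eventually_ge_atTop
    (√(2 * Real.log 14) + 2)
  have hlim3 : Tendsto (fun n : ℕ => √(2 * r) * ((n : ℝ) ^ (-τ) * Real.log n)) atTop (𝓝 0) := by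
    simpa using (tendsto_rpow_neg_mul_log hτ).const_mul (√(2 * r))
  filter_upwards [hlim1, hlim2, (tendsto_order.1 hlim3).2 1 one_pos, eventually_gt_atTop 0,
    tendsto_log_nat.eventually_ge_atTop 1] with n h1 h2 h3 hn hL l ℓ v hℓ hℓl hvℓ hv0 hv hshort
  have hn' : (0 : ℝ) < n := by exact_mod_cast hn
  have hn1 : (1 : ℝ) ≤ n := by exact_mod_cast hn
  set L := Real.log n with hLdef
  set m := numBlocks α β n
  set b := blockLength α n
  have hm0 : (0 : ℝ) < m := by exact_mod_cast numBlocks_pos hαβ₁ hn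
  have hb0 : (0 : ℝ) < b := by exact_mod_cast blockLength_pos hα₀ hn
  have hm : (m : ℝ) ≤ (n : ℝ) ^ (1 - α - β) := numBlocks_le α β n
  have hb : (b : ℝ) ≤ (n : ℝ) ^ α := blockLength_le α n
  have hℓ0 : 0 < ℓ := by linarith
  have hsℓ : 0 < √ℓ := Real.sqrt_pos.2 hℓ0
  have hx0 : 0 ≤ Real.log ℓ := Real.log_nonneg hℓ
  have hbl : (b : ℝ) / 2 ^ l ≤ 2 * (n : ℝ) ^ α / ℓ := by
    rw [div_le_div_iff₀ (by positivity) hℓ0]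
    calc (b : ℝ) * ℓ ≤ (n : ℝ) ^ α * (2 * 2 ^ l) := by gcongr
      _ = _ := by ring
  set Q := Real.log (2 * m * (b / 2 ^ l + 5)) with hQ
  have hQ1 : Q ≤ Real.log (2 * (n : ℝ) ^ (1 - α - β) * (2 * (n : ℝ) ^ α / ℓ + 5)) := by
    refine Real.log_le_log (by positivity) ?_
    gcongr
  have hy := Real.sqrt_nonneg L
  rcases le_or_gt ((n : ℝ) ^ (α - 2 * τ)) ℓ with hcase | hcase
  · have hQ2 : Q ≤ Real.log 14 + (1 - α - β + 2 * τ) * L := by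
      rw [← Real.log_rpow hn', ← Real.log_mul (by norm_num) (by positivity)]
      refine hQ1.trans (Real.log_le_log (by positivity) ?_)
      have a1 : (n : ℝ) ^ α / ℓ ≤ (n : ℝ) ^ (2 * τ) := by
        rw [div_le_iff₀ hℓ0]
        calc (n : ℝ) ^ α = (n : ℝ) ^ (2 * τ) * (n : ℝ) ^ (α - 2 * τ) := by
              rw [← Real.rpow_add hn']; congr 1; ring
          _ ≤ _ := by gcongr
      have a2 : 1 ≤ (n : ℝ) ^ (2 * τ) := Real.one_le_rpow hn1 (by linarith)
      rw [Real.rpow_add hn' (1 - α - β)]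
      have a3 : 0 ≤ (n : ℝ) ^ (1 - α - β) := by positivity
      rw [mul_div_assoc]
      nlinarith
    have hx : Real.log ℓ ≤ (α + 2 * τ) * L := by
      rw [← Real.log_rpow hn']; exact Real.log_le_log hℓ0 hshort.le
    have key := noise_add_signal_le_of_length_eq (r := r) (by linarith) hτG hηG hG hG0.le hx hQ2
    have hinc : √(2 * r * L) / √((n : ℝ) ^ α) * v / √ℓ ≤ √(2 * r * L) :=
      increment_le_amplitude (Real.sqrt_nonneg _) (by positivity) hℓ0 hv0 hvℓ hv
    have hc : c * √L ≤ G / 4 * √L := by gcongr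
    linarith
  · have hx : Real.log ℓ ≤ (α - 2 * τ) * L := by
      rw [← Real.log_rpow hn']; exact Real.log_le_log hℓ0 hcase.le
    have hℓα : ℓ ≤ (n : ℝ) ^ α :=
      hcase.le.trans (Real.rpow_le_rpow_of_exponent_le hn1 (by linarith))
    have hQ2 : Q ≤ Real.log 14 + ((1 - β) * L - Real.log ℓ) := by
      rw [← Real.log_rpow hn', ← Real.log_div (by positivity) hℓ0.ne',
        ← Real.log_mul (by norm_num) (by positivity)]
      refine hQ1.trans (Real.log_le_log (by positivity) ?_)
      have a1 : 1 ≤ (n : ℝ) ^ α / ℓ := by rw [le_div_iff₀ hℓ0]; linarith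
      calc 2 * (n : ℝ) ^ (1 - α - β) * (2 * (n : ℝ) ^ α / ℓ + 5)
          ≤ 2 * (n : ℝ) ^ (1 - α - β) * (2 * ((n : ℝ) ^ α / ℓ) + 5 * ((n : ℝ) ^ α / ℓ)) := by
            rw [mul_div_assoc]; gcongr; linarith
        _ = 14 * ((n : ℝ) ^ (1 - α - β) * (n : ℝ) ^ α / ℓ) := by ring
        _ = _ := by rw [← Real.rpow_add hn']; congr 3; ring
    have key := noise_le_of_length_lt (by linarith) hβ.le hηβ hαβ₁ hα₀ hx0
      (hx.trans (by gcongr; linarith)) hQ2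
    have hinc : √(2 * r * L) / √((n : ℝ) ^ α) * v / √ℓ ≤ 1 := by
      refine (increment_le_of_short hn (Real.sqrt_nonneg _) hℓ0 hvℓ hcase.le).trans ?_
      have a6 : √(2 * r * L) ≤ √(2 * r) * L := by
        rw [Real.sqrt_mul' _ (by linarith)]
        refine mul_le_mul_of_nonneg_left ?_ (Real.sqrt_nonneg _)
        rw [Real.sqrt_le_left (by linarith)]
        nlinarith
      have a7 : √(2 * r * L) * (n : ℝ) ^ (-τ) ≤ √(2 * r) * L * (n : ℝ) ^ (-τ) :=
        mul_le_mul_of_nonneg_right a6 (by positivity)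
      linarith
    have hc : c * √L ≤ β / 8 * √L := by gcongr
    linarith

lemma penalty_le_of_long {n : ℕ} {I : ℕ × ℕ} (hI : I ∈ allIntervals n)
    (h : (n : ℝ) ≤ 16 * ((I.2 : ℝ) - I.1)) : penalty n I ≤ √(2 * (1 + Real.log 16)) := by
  have h1 := len_pos hI
  have h2 := len_le hI
  rw [penalty_eq hI]
  refine Real.sqrt_le_sqrt ?_
  have : Real.log n ≤ Real.log 16 + Real.log ((I.2 : ℝ) - I.1) := by
    rw [← Real.log_mul (by norm_num) (by linarith)]
    exact Real.log_le_log (by linarith) h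
  linarith

lemma eventually_nonempty_of_appIntervals_subset {F : ℕ → Finset (ℕ × ℕ)}
    (hA : ∀ n, appIntervals n ⊆ F n) : ∀ᶠ n in atTop, (F n).Nonempty := by
  filter_upwards [eventually_ge_atTop 9] with n hn
  obtain ⟨D, hD, _⟩ := exists_long_mem_appIntervals hn
  exact ⟨_, hA n hD⟩

set_option maxHeartbeats 1000000 in
/-- Below the sparse boundary long intervals gain a negative power of `n`, while the short intervals that
meet a block do not reach the maximum of the pure noise. -/
theorem isPowerless_sparse {α β r : ℝ} (hα₀ : 0 ≤ α) (hβ : 0 < β)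
    (hαβ₁ : α + β ≤ 1) (hd : (1 - α) / 2 < β)
    (hr : √r < √(1 - α) - √(1 - α - β))
    {F : ℕ → Finset (ℕ × ℕ)} (hF : ∀ n, F n ⊆ allIntervals n) (hA : ∀ n, appIntervals n ⊆ F n) :
    IsPowerless (fun n => maxOver n (F n)) (altLaw α β (sparseMean α r)) := by
  have hne := eventually_nonempty_of_appIntervals_subset hA
  have hP := eventually_placements_nonempty hα₀ hβ.le
  have hμ : ∀ n, 0 ≤ sparseMean α r n := fun n => by unfold sparseMean; positivity
  set G := √(1 - α) - √(1 - α - β) - √r with hGdef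
  have hG0 : 0 < G := by linarith
  obtain ⟨γ, hγ0, hγ⟩ : ∃ γ, 0 < γ ∧ γ < min β (β - (1 - α) / 2) :=
    exists_between (lt_min hβ (by linarith))
  have hγβ := hγ.trans_le (min_le_left _ _)
  have hγr := hγ.trans_le (min_le_right _ _)
  obtain ⟨k, hk⟩ := exists_nat_gt (1 / γ)
  have hk0 : 0 < k := by
    have : (0 : ℝ) < k := lt_trans (by positivity) hk
    exact_mod_cast this
  rw [div_lt_iff₀ hγ0] at hk
  -- `τ` is small compared with the gap `G` and with the room for separated blocks
  set τ := min (G ^ 2 / 128) (min ((1 - α) / 3) ((β - (1 - α) / 2) / 3)) with hτdef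
  have hτ0 : 0 < τ := lt_min (by positivity) (lt_min (by linarith) (by linarith))
  have hτ1 : τ ≤ G ^ 2 / 128 := min_le_left _ _
  have hτ2 : τ ≤ (1 - α) / 3 := (min_le_right _ _).trans (min_le_left _ _)
  have hτ3 : τ ≤ (β - (1 - α) / 2) / 3 := (min_le_right _ _).trans (min_le_right _ _)
  set η := min (G ^ 2 / 48) (β ^ 2 / 96) with hηdef
  have hη0 : 0 < η := lt_min (by positivity) (by positivity)
  have hη1 : η ≤ G ^ 2 / 48 := min_le_left _ _
  have hη2 : η ≤ β ^ 2 / 96 := min_le_right _ _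
  set c := min (G / 4) (β / 8) with hcdef
  have hc0 : 0 < c := lt_min (by positivity) (by positivity)
  have hτG : 2 * √(2 * τ) ≤ G / 4 := by
    have : √(2 * τ) ≤ G / 8 := by
      rw [Real.sqrt_le_left (by positivity)]; linarith
    linarith
  have hηG : √(3 * η) ≤ G / 4 := by rw [Real.sqrt_le_left (by positivity)]; linarith
  have hηβ : √(6 * η) ≤ β / 4 := by rw [Real.sqrt_le_left (by positivity)]; linarith
  set e := min (β - (1 - α) / 2 - γ) τ with hedef
  have he0 : 0 < e := lt_min (by linarith) hτ0
  have hshort := eventually_short_le (r := r) hα₀ hβ hαβ₁ hτ0 hG0 hτG hηG hηβ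
    (by rw [hGdef]; linarith) (min_le_left _ _) (min_le_right _ _)
  refine isPowerless_of_increment hμ hF hne hP
    (ε := fun n => √(2 * r * Real.log n) * k * (3 * (n : ℝ) ^ (-e))) (fun n => by positivity) ?_
    fun δ hδ => ?_
  · have h1 := (((tendsto_rpow_neg_mul_log (half_pos he0)).pow 2).const_mul (√(2 * r) * k * 3))
    rw [zero_pow two_ne_zero, mul_zero] at h1
    refine squeeze_zero' ?_ ?_ h1
    · filter_upwards [tendsto_log_nat.eventually_ge_atTop 1] with n hL
      positivity
    · filter_upwards [tendsto_log_nat.eventually_ge_atTop 1, eventually_gt_atTop 0] with n hL hn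
      have hn' : (0 : ℝ) < n := by exact_mod_cast hn
      have a1 : √(Real.log n) ≤ Real.log n := by
        rw [Real.sqrt_le_left (by linarith)]; nlinarith
      have a2 : (n : ℝ) ^ (-e) = ((n : ℝ) ^ (-(e / 2))) ^ 2 := by
        rw [← Real.rpow_natCast, ← Real.rpow_mul hn'.le]; congr 1; push_cast; ring
      rw [Real.sqrt_mul' _ (by linarith), a2]
      calc √(2 * r) * √(Real.log n) * k * (3 * ((n : ℝ) ^ (-(e / 2))) ^ 2) * Real.log n
          ≤ √(2 * r) * Real.log n * k * (3 * ((n : ℝ) ^ (-(e / 2))) ^ 2) * Real.log n := by gcongr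
        _ = _ := by ring
  have hnoise : Tendsto (fun n : ℕ => Real.exp (-(c * √(Real.log n) - √(2 * (1 + Real.log 16))) ^ 2 / 2))
      atTop (𝓝 0) := by
    refine Real.tendsto_exp_atBot.comp ?_
    have h1 : Tendsto (fun n : ℕ => c * √(Real.log n) - √(2 * (1 + Real.log 16))) atTop atTop :=
      tendsto_atTop_add_const_right _ _ (tendsto_sqrt_log.const_mul_atTop hc0)
    have h2 := ((tendsto_pow_atTop two_ne_zero).comp h1).atTop_div_const (by norm_num : (0 : ℝ) < 2)
    refine (tendsto_neg_atTop_atBot.comp h2).congr fun n => ?_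
    simp only [Function.comp]; ring
  filter_upwards [eventually_ge_atTop 9, hne, hshort,
    eventually_spread (s := α + β - γ) hα₀ hβ (by linarith) (by linarith) hk0 (by rw [sub_sub_cancel]; linarith)
      (half_pos hδ),
    eventually_spread (s := α + 3 * τ) (k := 2) hα₀ hβ (by linarith) (by linarith) two_pos
      (by push_cast; linarith) (half_pos hδ),
    eventually_nullLaw_net_le hη0 (half_pos hδ),
    (tendsto_order.1 hnoise).2 (δ / 2) (by positivity),
    (tendsto_sqrt_log.const_mul_atTop hc0).eventually_ge_atTop (√(2 * (1 + Real.log 16))),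
    ((tendsto_rpow_atTop hτ0).comp tendsto_natCast_atTop_atTop).eventually_ge_atTop 2]
    with n hn9 hnen hsh ⟨G1, hG1P, hG1c, hG1⟩ ⟨G2, hG2P, hG2c, hG2⟩ hnet hno hcy hnτ
  have hn : 0 < n := by omega
  have hn' : (0 : ℝ) < n := by exact_mod_cast hn
  have hn1 : (1 : ℝ) ≤ n := by exact_mod_cast hn
  set b := blockLength α n
  set m := numBlocks α β n
  set P := placements n b m
  refine ⟨G1 ∩ G2, Finset.inter_subset_left.trans hG1P, ?_, fun S hS => ?_⟩
  · have h1 : P \ (G1 ∩ G2) ⊆ (P \ G1) ∪ (P \ G2) := by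
      intro x; simp only [Finset.mem_sdiff, Finset.mem_inter, Finset.mem_union]; tauto
    have h2 : ((P \ (G1 ∩ G2)).card : ℝ) ≤ (P \ G1).card + (P \ G2).card := by
      exact_mod_cast (Finset.card_le_card h1).trans (Finset.card_union_le _ _)
    linarith
  rw [Finset.mem_inter] at hS
  have hSP : S ∈ P := hG1P hS.1
  have hm0 : 0 < m := numBlocks_pos hαβ₁ hn
  obtain ⟨D, hD, hD16⟩ := exists_long_mem_appIntervals hn9
  have hDall := hF n (hA n hD)
  set near := (allIntervals n).filter fun I => 0 < overlap b S I with hnear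
  set C := √(2 * (1 + Real.log 16)) with hC
  have hnear_le := hnet near (Finset.filter_subset _ _)
    (fun l => Real.log (2 * m * (b / 2 ^ l + 5)))
    (fun l _ => Real.log_nonneg (by
      have h1 : (1 : ℝ) ≤ m := by exact_mod_cast hm0
      have h2 : (0 : ℝ) ≤ b / 2 ^ l := by positivity
      exact one_le_mul_of_one_le_of_one_le (by linarith) (by linarith)))
    (fun l _ => card_leftGrid_overlap_le hη0.le hn hm0 hSP l)
  have hlow := nullLaw_stdSum_lt_le hDall (x := c * √(Real.log n) - C) (by linarith)
  refine le_trans (measureReal_mono (s₂ := {z | ∃ I ∈ near,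
      √(2 * Real.log (2 * m * (b / 2 ^ level I + 5)) + 6 * η * Real.log n) + 1 < stdSum n z I} ∪
      {z | stdSum n z (0, D) < -(c * √(Real.log n) - C)}) (fun z hz => ?_))
    ((measureReal_union_le _ _).trans (by linarith))
  by_contra hcon
  simp only [Set.mem_union, Set.mem_ofPred_eq, not_or, not_exists, not_and, not_lt] at hcon
  obtain ⟨hc1, hc2⟩ := hcon
  rw [Set.mem_ofPred_eq] at hz
  refine hz.not_ge (maxOver_observe_le (hF n) hnen fun I hI => ?_)
  have hIn := hF n hI
  have hMk : 0 ≤ √(2 * r * Real.log n) * k := by positivity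
  rcases Nat.eq_zero_or_pos (overlap b S I) with h0 | h0
  · left; rw [h0]; simp; positivity
  rcases le_or_gt ((n : ℝ) ^ (α + 2 * τ)) ((I.2 : ℝ) - I.1) with hlong | hlong
  · left
    refine (increment_le_of_spread hn (Real.sqrt_nonneg _) (by linarith)
      (fun a => (hG1 S hS.1 a).le) hIn hlong).trans ?_
    gcongr
    have a1 : (n : ℝ) ^ ((1 + α) / 2 - (α + β - γ)) ≤ (n : ℝ) ^ (-e) :=
      Real.rpow_le_rpow_of_exponent_le hn1 (by linarith [min_le_left (β - (1 - α) / 2 - γ) τ])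
    have a2 : (n : ℝ) ^ (-τ) ≤ (n : ℝ) ^ (-e) :=
      Real.rpow_le_rpow_of_exponent_le hn1 (by linarith [min_le_right (β - (1 - α) / 2 - γ) τ])
    linarith
  · right
    have hT : -(c * √(Real.log n)) ≤ maxOver n (F n) z := by
      have h1 := le_maxOver (x := z) (hA n hD)
      rw [penalizedSum_eq] at h1
      have h2 := penalty_le_of_long hDall (by
        have : (n : ℝ) ≤ 16 * D := by exact_mod_cast hD16
        simpa using this)
      linarith
    -- the interval is too short to meet two blocks
    have hov : overlap b S I ≤ b := by
      refine (overlap_le_mul b S I).trans ?_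
      have h1 : (S ∩ Finset.Ico (I.1 + 1 - b) I.2).card < 2 := by
        refine lt_of_le_of_lt (Finset.card_le_card (Finset.inter_subset_inter_left ?_))
          (hG2 S hS.2 (I.1 + 1 - b))
        have h2 : (I.2 - I.1 : ℕ) + b ≤ ⌈(n : ℝ) ^ (α + 3 * τ)⌉₊ := by
          have h3 : (((I.2 - I.1 : ℕ) + b : ℕ) : ℝ) ≤ (n : ℝ) ^ (α + 3 * τ) := by
            rw [Nat.cast_add, cast_len hIn]
            have h4 : (b : ℝ) ≤ (n : ℝ) ^ (α + 2 * τ) := (blockLength_le α n).trans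
              (Real.rpow_le_rpow_of_exponent_le hn1 (by linarith))
            have h5 : (n : ℝ) ^ (α + 3 * τ) = (n : ℝ) ^ (α + 2 * τ) * (n : ℝ) ^ τ := by
              rw [← Real.rpow_add hn']; congr 1; ring
            have h6 : (2 : ℝ) ≤ (n : ℝ) ^ τ := hnτ
            have h7 : 0 ≤ (n : ℝ) ^ (α + 2 * τ) := by positivity
            rw [h5]
            linarith [mul_le_mul_of_nonneg_left h6 h7]
          exact_mod_cast h3.trans (Nat.le_ceil _)
        have := (mem_allIntervals.1 hIn).1
        refine Finset.Ico_subset_Ico le_rfl ?_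
        omega
      calc _ ≤ 1 * b := Nat.mul_le_mul_right _ (by omega)
        _ = b := one_mul b
    have hlev : (I.2 : ℝ) - I.1 ≤ 2 * 2 ^ level I := by
      rw [← cast_len hIn]
      have := (lt_two_pow_level_succ I).le
      rw [pow_succ, mul_comm] at this
      exact_mod_cast this
    have h1 := hc1 I (Finset.mem_filter.2 ⟨hIn, h0⟩)
    have h2 := hsh (level I) _ (overlap b S I) (len_pos hIn) hlev (overlap_le_len_real hIn b S)
      (Nat.cast_nonneg _) ((Nat.cast_le.2 hov).trans (blockLength_le α n)) hlong
    rw [penalizedSum_observe hIn, penalty_eq hIn, sparseMean]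
    have h3 : 0 ≤ √(2 * r * Real.log n) * k * (3 * (n : ℝ) ^ (-e)) := by positivity
    linarith

/-! ### A criterion for a vanishing type II error -/

instance isFiniteMeasure_altLaw (α β : ℝ) (μ : ℕ → ℝ) (n : ℕ) :
    IsFiniteMeasure (altLaw α β μ n) := by
  refine ⟨?_⟩
  rw [altLaw, blocksLaw, Measure.finsetSum_apply]
  refine ENNReal.sum_lt_top.2 fun S hS => ?_
  rw [Measure.smul_apply, smul_eq_mul]
  have := Measure.isProbabilityMeasure_map (μ := nullLaw n)
    (measurable_observe n (blockLength α n) (μ n) S).aemeasurable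
  refine ENNReal.mul_lt_top (ENNReal.inv_lt_top.2 ?_) (measure_lt_top _ _)
  exact_mod_cast Finset.card_pos.2 ⟨S, hS⟩

/-- The type II error vanishes if, for most placements, the maximum exceeds the critical value with
high probability. -/
lemma tendsto_typeII {α β : ℝ} {μ : ℕ → ℝ} {F : ℕ → Finset (ℕ × ℕ)}
    (hne : ∀ᶠ n in atTop, (F n).Nonempty)
    (hP : ∀ᶠ n in atTop, (placements n (blockLength α n) (numBlocks α β n)).Nonempty) {s : ℕ → ℝ}
    (hgood : ∀ δ : ℝ, 0 < δ → ∀ᶠ n in atTop,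
      ∃ G ⊆ placements n (blockLength α n) (numBlocks α β n),
        ((placements n (blockLength α n) (numBlocks α β n) \ G).card : ℝ)
          ≤ δ * (placements n (blockLength α n) (numBlocks α β n)).card ∧
        ∀ S ∈ G, (nullLaw n).real {z |
          maxOver n (F n) (observe n (blockLength α n) (μ n) S z) ≤ s n} ≤ δ) :
    Tendsto (fun n => typeII (fun n => maxOver n (F n)) (altLaw α β μ) n (s n)) atTop (𝓝 0) := by
  rw [tendsto_order]
  refine ⟨fun a ha => Eventually.of_forall fun n => ha.trans_le measureReal_nonneg, fun δ hδ => ?_⟩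
  filter_upwards [hgood (δ / 3) (by positivity), hP, hne] with n ⟨G, hGP, hGc, hG⟩ hPn hnen
  set P := placements n (blockLength α n) (numBlocks α β n) with hPdef
  have hcard : (0 : ℝ) < P.card := by exact_mod_cast Finset.card_pos.2 hPn
  have hII : typeII (fun n => maxOver n (F n)) (altLaw α β μ) n (s n)
      = (∑ S ∈ P, (nullLaw n).real
          (observe n (blockLength α n) (μ n) S ⁻¹' {x | maxOver n (F n) x ≤ s n})) / P.card :=
    altLaw_real_apply α β μ n (measurableSet_le (measurable_maxOver hnen) measurable_const)
  rw [hII, div_lt_iff₀ hcard, ← Finset.sum_sdiff hGP]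
  have h1 : ∑ S ∈ P \ G, (nullLaw n).real
      (observe n (blockLength α n) (μ n) S ⁻¹' {x | maxOver n (F n) x ≤ s n}) ≤ (P \ G).card := by
    refine (Finset.sum_le_card_nsmul _ _ 1 fun S _ => measureReal_le_one).trans_eq ?_
    simp
  have h2 : ∑ S ∈ G, (nullLaw n).real
      (observe n (blockLength α n) (μ n) S ⁻¹' {x | maxOver n (F n) x ≤ s n})
      ≤ G.card * (δ / 3) := by
    refine (Finset.sum_le_card_nsmul _ _ (δ / 3) fun S hS => hG S hS).trans_eq ?_
    rw [nsmul_eq_mul]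
  have h3 : (G.card : ℝ) ≤ P.card := by exact_mod_cast Finset.card_le_card hGP
  have h4 : (G.card : ℝ) * (δ / 3) ≤ P.card * (δ / 3) := by gcongr
  have h5 : 0 < δ * P.card := by positivity
  linarith

/-! ### The dense case above the boundary -/

/-- If there is no sparsity, the blocks cover almost all design points. -/
lemma eventually_half_le_overlap_of_covering {α : ℝ} (hα₀ : 0 < α) (hα₁ : α < 1) :
    ∀ᶠ n : ℕ in atTop, ∀ S ∈ placements n (blockLength α n) (numBlocks α 0 n), ∀ D ≤ n,
      n ≤ 16 * D → (n : ℝ) / 256 ≤ overlap (blockLength α n) S (0, D) := by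
  filter_upwards [eventually_gt_atTop 0,
    (tendsto_order.1 (tendsto_rpow_neg_nat hα₀)).2 (1 / 64) (by norm_num),
    (tendsto_order.1 (tendsto_rpow_neg_nat (sub_pos.2 hα₁))).2 (1 / 64) (by norm_num)]
    with n hn h1 h2 S hS D hDn hD
  have hn' : (0 : ℝ) < n := by exact_mod_cast hn
  set b := blockLength α n
  set m := numBlocks α 0 n
  have hsub : support b S ⊆ (Finset.Ioc 0 D ∩ support b S) ∪ Finset.Ioc D n := by
    intro x hx
    rw [Finset.mem_union, Finset.mem_inter, Finset.mem_Ioc, Finset.mem_Ioc]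
    have hx' := hx
    simp only [support, Finset.mem_biUnion, Finset.mem_Ioc] at hx'
    obtain ⟨j, hj, hjx⟩ := hx'
    have := (mem_placements.1 hS).2.2.1 j hj
    by_cases h : x ≤ D
    · left; exact ⟨⟨by omega, h⟩, hx⟩
    · right; omega
  have hc : m * b ≤ overlap b S (0, D) + (n - D) := by
    rw [← card_support hS]
    refine (Finset.card_le_card hsub).trans ((Finset.card_union_le _ _).trans_eq ?_)
    rw [Nat.card_Ioc]; rfl
  have hc' : (m : ℝ) * b ≤ overlap b S (0, D) + (n - D) := by
    rw [← Nat.cast_sub hDn]; exact_mod_cast hc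
  have hm : (n : ℝ) ^ (1 - α) - 1 ≤ m := by
    have := Nat.lt_floor_add_one ((n : ℝ) ^ (1 - α - 0))
    rw [sub_zero] at this
    have e : (m : ℝ) = ⌊(n : ℝ) ^ (1 - α)⌋₊ := by
      show ((numBlocks α 0 n : ℕ) : ℝ) = _
      rw [numBlocks, sub_zero]
    linarith
  have hb : (n : ℝ) ^ α - 1 ≤ b := by
    have := Nat.lt_floor_add_one ((n : ℝ) ^ α)
    have e : (b : ℝ) = ⌊(n : ℝ) ^ α⌋₊ := rfl
    linarith
  have hn1 : (1 : ℝ) ≤ n := by exact_mod_cast hn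
  have hm0 : 1 ≤ (n : ℝ) ^ (1 - α) := Real.one_le_rpow hn1 (by linarith)
  have hb0 : 1 ≤ (n : ℝ) ^ α := Real.one_le_rpow hn1 hα₀.le
  have hmb : ((n : ℝ) ^ (1 - α) - 1) * ((n : ℝ) ^ α - 1) ≤ m * b := by
    gcongr
  have e1 : (n : ℝ) ^ (1 - α) * (n : ℝ) ^ α = n := by rw [← Real.rpow_add hn']; simp
  have e2 : (n : ℝ) ^ (1 - α) = n * (n : ℝ) ^ (-α) := by
    rw [sub_eq_add_neg, Real.rpow_add hn', Real.rpow_one]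
  have e3 : (n : ℝ) ^ α = n * (n : ℝ) ^ (-(1 - α)) := by
    rw [← Real.rpow_one_add' hn'.le (by linarith)]; congr 1; ring
  have e4 : (n : ℝ) ^ (1 - α) ≤ n / 64 := by
    rw [e2]
    calc (n : ℝ) * (n : ℝ) ^ (-α) ≤ n * (1 / 64) := by gcongr
      _ = n / 64 := by ring
  have e5 : (n : ℝ) ^ α ≤ n / 64 := by
    rw [e3]
    calc (n : ℝ) * (n : ℝ) ^ (-(1 - α)) ≤ n * (1 / 64) := by gcongr
      _ = n / 64 := by ring
  have hD' : (n : ℝ) ≤ 16 * D := by exact_mod_cast hD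
  have e6 : ((n : ℝ) ^ (1 - α) - 1) * ((n : ℝ) ^ α - 1)
      = n - (n : ℝ) ^ (1 - α) - (n : ℝ) ^ α + 1 := by rw [sub_mul, mul_sub, e1]; ring
  linarith

open Classical in
/-- With sparsity, most placements put a fixed proportion of the blocks into `(0, D]` when `D` is at
least `n / 16`.  Otherwise almost all left endpoints would fall into the complement, which occupies
at most the proportion `15 / 16` of the positions; by the factorial moment bound of order `k` the
probability of this is at most `(99 / 100) ^ k`, where `k` is arbitrary. -/
lemma eventually_le_overlap_of_sparse {α β δ : ℝ} (hα₀ : 0 ≤ α) (hα₁ : α < 1) (hβ : 0 < β)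
    (hαβ : α + β < 1) (hδ : 0 < δ) :
    ∀ᶠ n : ℕ in atTop, ∀ D ≤ n, n ≤ 16 * D →
      ∃ G ⊆ placements n (blockLength α n) (numBlocks α β n),
        ((placements n (blockLength α n) (numBlocks α β n) \ G).card : ℝ)
          ≤ δ * (placements n (blockLength α n) (numBlocks α β n)).card ∧
        ∀ S ∈ G, (n : ℝ) ^ (1 - β) / 256 ≤ overlap (blockLength α n) S (0, D) := by
  obtain ⟨k, hk⟩ := exists_pow_lt_of_lt_one hδ (by norm_num : (99 / 100 : ℝ) < 1)
  have hκ : 0 < 1 - α - β := by linarith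
  filter_upwards [eventually_gt_atTop 0,
    (tendsto_order.1 (tendsto_rpow_neg_nat hβ)).2 (1 / 2000) (by norm_num),
    (tendsto_order.1 (tendsto_rpow_neg_nat (sub_pos.2 hα₁))).2 (1 / 1000) (by norm_num),
    ((tendsto_rpow_atTop hκ).comp tendsto_natCast_atTop_atTop).eventually_ge_atTop (2 * (64 * k + 1))]
    with n hn h1 h2 h3 D hDn hD
  have hn' : (0 : ℝ) < n := by exact_mod_cast hn
  have hn1 : (1 : ℝ) ≤ n := by exact_mod_cast hn
  set b := blockLength α n
  set m := numBlocks α β n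
  set P := placements n b m
  have hb := blockLength_le α n
  have hbpos : 0 < b := blockLength_pos hα₀ hn
  have hm2 : 64 * (k : ℝ) + 1 ≤ m := by
    have h4 := rpow_le_numBlocks hαβ.le hn
    have h5 : 2 * (64 * (k : ℝ) + 1) ≤ (n : ℝ) ^ (1 - α - β) := h3
    have h6 : (n : ℝ) ^ (1 - α - β) ≤ 2 * m := h4
    linarith
  have hmk : 64 * k + 1 ≤ m := by exact_mod_cast hm2
  set A := Finset.Ico (D + 1 - b) (n + 1) with hA
  set q := ⌈63 / 64 * (m : ℝ)⌉₊ with hq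
  set B := P.filter fun S => q ≤ (S ∩ A).card with hB
  refine ⟨P \ B, Finset.sdiff_subset, ?_, fun S hS => ?_⟩
  · rw [Finset.sdiff_sdiff_eq_self (Finset.filter_subset _ _)]
    have hmain := card_placements_many_mul_le (n := n) (m := m) hbpos A k q (by omega)
    set W := n - 2 * (m * b) with hW
    have hWge : 999 / 1000 * (n : ℝ) ≤ W := by
      have a1 : (n : ℝ) ≤ (W : ℝ) + ((2 * (m * b) : ℕ) : ℝ) := by exact_mod_cast le_tsub_add
      have a2 := numBlocks_mul_blockLength_le (α := α) (β := β) hn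
      have a3 : (n : ℝ) ^ (1 - β) = n * (n : ℝ) ^ (-β) := by
        rw [sub_eq_add_neg, Real.rpow_add hn', Real.rpow_one]
      have a4 : (n : ℝ) * (n : ℝ) ^ (-β) ≤ n * (1 / 2000) := by gcongr
      push_cast at a1
      change (m : ℝ) * b ≤ _ at a2
      linarith
    have hAle : (A.card : ℝ) ≤ 939 / 1000 * n := by
      rw [hA, Nat.card_Ico]
      have a1 : n + 1 - (D + 1 - b) ≤ (n - D) + b := by omega
      have a2 : ((n + 1 - (D + 1 - b) : ℕ) : ℝ) ≤ (n - D) + b := by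
        rw [← Nat.cast_sub hDn]; exact_mod_cast a1
      have a3 : (n : ℝ) ^ α = n * (n : ℝ) ^ (-(1 - α)) := by
        rw [show (n : ℝ) ^ α = (n : ℝ) ^ (1 + -(1 - α)) by congr 1; ring, Real.rpow_add hn',
          Real.rpow_one]
      have a4 : (n : ℝ) * (n : ℝ) ^ (-(1 - α)) ≤ n * (1 / 1000) := by gcongr
      have a5 : (n : ℝ) ≤ 16 * D := by exact_mod_cast hD
      change (b : ℝ) ≤ _ at hb
      linarith
    have hqge : 31 / 32 * (m : ℝ) ≤ ((q + 1 - k : ℕ) : ℝ) := by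
      have a1 : ((q + 1 : ℕ) : ℝ) ≤ ((q + 1 - k : ℕ) : ℝ) + k := by exact_mod_cast le_tsub_add
      have a2 := Nat.le_ceil (63 / 64 * (m : ℝ))
      push_cast at a1
      change 63 / 64 * (m : ℝ) ≤ q at a2
      linarith
    have hmpos : (0 : ℝ) < m := by
      have : (0 : ℝ) ≤ k := Nat.cast_nonneg k
      linarith
    set w : ℝ := ((q + 1 - k : ℕ) : ℝ) * W with hw
    have hwge : 967 / 1000 * (m * n) ≤ w := by
      calc 967 / 1000 * ((m : ℝ) * n) ≤ (31 / 32 * m) * (999 / 1000 * n) := by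
            have : 0 < (m : ℝ) * n := by positivity
            linarith
        _ ≤ w := by rw [hw]; gcongr
    have hwpos : 0 < w := lt_of_lt_of_le (by positivity) hwge
    have hmA : (m : ℝ) * A.card ≤ 99 / 100 * w := by
      calc (m : ℝ) * A.card ≤ m * (939 / 1000 * n) := by gcongr
        _ ≤ 99 / 100 * (967 / 1000 * (m * n)) := by
            have : 0 < (m : ℝ) * n := by positivity
            linarith
        _ ≤ _ := by gcongr
    have hmain' : (B.card : ℝ) * w ^ k ≤ P.card * (m * A.card) ^ k := by
      rw [hw]; exact_mod_cast hmain
    refine le_of_mul_le_mul_right ?_ (pow_pos hwpos k)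
    calc (B.card : ℝ) * w ^ k ≤ P.card * (m * A.card) ^ k := hmain'
      _ ≤ P.card * (99 / 100 * w) ^ k := by gcongr
      _ = (99 / 100) ^ k * P.card * w ^ k := by rw [mul_pow]; ring
      _ ≤ δ * P.card * w ^ k := by gcongr
  · rw [Finset.mem_sdiff] at hS
    have hSP := mem_placements.1 hS.1
    have hlt : (S ∩ A).card < q := by
      by_contra! h
      exact hS.2 (Finset.mem_filter.2 ⟨hS.1, h⟩)
    have hlt' : ((S ∩ A).card : ℝ) < 63 / 64 * m := Nat.lt_ceil.1 hlt
    have hsub : S ⊆ (S.filter fun j => j + b ≤ D) ∪ (S ∩ A) := by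
      intro j hj
      have := Finset.mem_range.1 (hSP.1 hj)
      rw [Finset.mem_union, Finset.mem_filter, Finset.mem_inter, hA, Finset.mem_Ico]
      by_cases h : j + b ≤ D
      · exact Or.inl ⟨hj, h⟩
      · exact Or.inr ⟨hj, by omega, by omega⟩
    have hcard : m ≤ (S.filter fun j => j + b ≤ D).card + (S ∩ A).card := by
      rw [← hSP.2.1]
      exact (Finset.card_le_card hsub).trans (Finset.card_union_le _ _)
    have hcard' : (m : ℝ) ≤ (S.filter fun j => j + b ≤ D).card + (S ∩ A).card := by
      exact_mod_cast hcard
    have hov : ((S.filter fun j => j + b ≤ D).card : ℝ) * b ≤ overlap b S (0, D) := by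
      exact_mod_cast le_overlap hS.1 D
    have h5 := rpow_le_numBlocks hαβ.le hn
    have h6 := rpow_le_blockLength hα₀ hn
    have h7 : (n : ℝ) ^ (1 - β) ≤ (2 * m) * (2 * b) := by
      calc (n : ℝ) ^ (1 - β) = (n : ℝ) ^ (1 - α - β) * (n : ℝ) ^ α := by
            rw [← Real.rpow_add hn']; congr 1; ring
        _ ≤ _ := by gcongr
    have h8 : (m : ℝ) / 64 * b ≤ (S.filter fun j => j + b ≤ D).card * b := by
      gcongr; linarith
    linarith

/-- The critical values `log n` are far above the noise; they suffice against a signal of polynomial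
size. -/
lemma tendsto_typeI_log {F : ℕ → Finset (ℕ × ℕ)} (hF : ∀ n, F n ⊆ allIntervals n)
    (hne : ∀ᶠ n in atTop, (F n).Nonempty) :
    Tendsto (fun n : ℕ => typeI (fun n => maxOver n (F n)) n (Real.log n)) atTop (𝓝 0) := by
  refine squeeze_zero' (Eventually.of_forall fun n => measureReal_nonneg) ?_
    tendsto_nullLaw_exists_gt_log
  filter_upwards [hne] with n hn
  refine measureReal_mono fun z hz => ?_
  obtain ⟨I, hI, h⟩ := (lt_maxOver_iff hn).1 hz
  refine ⟨I, hF n hI, ?_⟩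
  rw [penalizedSum_eq] at h
  linarith [penalty_nonneg n I]

/-- Above the dense boundary a single interval `(0, D]` collects a signal of polynomial size. -/
theorem hasAsymptoticPowerOne_dense {α β r : ℝ} (hα₀ : 0 ≤ α) (hα₁ : α < 1) (hβ : 0 ≤ β)
    (hαβ₀ : 0 < α + β) (hd : β < (1 - α) / 2) (hr : β - (1 - α) / 2 < r)
    {F : ℕ → Finset (ℕ × ℕ)} (hF : ∀ n, F n ⊆ allIntervals n) (hA : ∀ n, appIntervals n ⊆ F n) :
    HasAsymptoticPowerOne (fun n => maxOver n (F n)) (altLaw α β (denseMean α r)) := by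
  have hne := eventually_nonempty_of_appIntervals_subset hA
  have hP := eventually_placements_nonempty hα₀ hβ
  refine hasAsymptoticPowerOne_of_tendsto (fun n => Real.log n) (tendsto_typeI_log hF hne)
    (tendsto_typeII hne hP fun δ hδ => ?_)
  have hov : ∀ᶠ n : ℕ in atTop, ∀ D ≤ n, n ≤ 16 * D →
      ∃ G ⊆ placements n (blockLength α n) (numBlocks α β n),
        ((placements n (blockLength α n) (numBlocks α β n) \ G).card : ℝ)
          ≤ δ * (placements n (blockLength α n) (numBlocks α β n)).card ∧
        ∀ S ∈ G, (n : ℝ) ^ (1 - β) / 256 ≤ overlap (blockLength α n) S (0, D) := by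
    rcases hβ.eq_or_lt with h0 | h0
    · subst h0
      filter_upwards [eventually_half_le_overlap_of_covering (by linarith) hα₁] with n h D hDn hD
      refine ⟨_, subset_rfl, by simpa using by positivity, fun S hS => ?_⟩
      simpa using h S hS D hDn hD
    · exact eventually_le_overlap_of_sparse hα₀ hα₁ h0 (by linarith) hδ
  set c := r - (β - (1 - α) / 2) with hc
  have hc0 : 0 < c := by linarith
  have hgrow : ∀ᶠ n : ℕ in atTop,
      256 * (2 * Real.log n + √(2 * (1 + Real.log 16))) < (n : ℝ) ^ c := by
    have h1 : Tendsto (fun n : ℕ => 256 * (2 * ((n : ℝ) ^ (-c) * Real.log n)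
        + √(2 * (1 + Real.log 16)) * (n : ℝ) ^ (-c))) atTop (𝓝 0) := by
      simpa using (((tendsto_rpow_neg_mul_log hc0).const_mul 2).add
        ((tendsto_rpow_neg_nat hc0).const_mul (√(2 * (1 + Real.log 16))))).const_mul 256
    filter_upwards [(tendsto_order.1 h1).2 1 one_pos, eventually_gt_atTop 0] with n h hn
    have hn' : (0 : ℝ) < n := by exact_mod_cast hn
    have hp : 0 < (n : ℝ) ^ c := by positivity
    have e : (n : ℝ) ^ c * (n : ℝ) ^ (-c) = 1 := by rw [← Real.rpow_add hn']; simp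
    calc 256 * (2 * Real.log n + √(2 * (1 + Real.log 16)))
        = ((n : ℝ) ^ c * (n : ℝ) ^ (-c)) * (256 * (2 * Real.log n + √(2 * (1 + Real.log 16)))) := by
          rw [e, one_mul]
      _ = (n : ℝ) ^ c * (256 * (2 * ((n : ℝ) ^ (-c) * Real.log n)
        + √(2 * (1 + Real.log 16)) * (n : ℝ) ^ (-c))) := by ring
      _ < (n : ℝ) ^ c * 1 := by gcongr
      _ = (n : ℝ) ^ c := mul_one _
  filter_upwards [hov, eventually_ge_atTop 9, hgrow, hne,
    (tendsto_order.1 tendsto_nullLaw_exists_lt_neg_log).2 δ hδ] with n h1 hn9 hgr hnen hno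
  have hn : 0 < n := by omega
  have hn' : (0 : ℝ) < n := by exact_mod_cast hn
  obtain ⟨D, hD, hD16⟩ := exists_long_mem_appIntervals hn9
  have hDF := hA n hD
  have hDall := hF n hDF
  have hDn : D ≤ n := (mem_allIntervals.1 hDall).2
  obtain ⟨G, hGP, hGc, hG⟩ := h1 D hDn hD16
  refine ⟨G, hGP, hGc, fun S hS => le_trans (measureReal_mono fun z hz => ?_) hno.le⟩
  refine ⟨(0, D), hDall, ?_⟩
  have h2 := (le_maxOver hDF).trans hz
  rw [penalizedSum_observe hDall] at h2
  have h3 := penalty_le_of_long hDall (by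
    have : (n : ℝ) ≤ 16 * D := by exact_mod_cast hD16
    simpa using this)
  have h4 : (n : ℝ) ^ c / 256
      ≤ denseMean α r n * overlap (blockLength α n) S (0, D) / √(((0, D) : ℕ × ℕ).2 - ((0, D) : ℕ × ℕ).1 : ℝ) := by
    have hlen := len_le hDall
    have hlen0 := len_pos hDall
    calc (n : ℝ) ^ c / 256 = denseMean α r n * ((n : ℝ) ^ (1 - β) / 256) / √(n : ℝ) := by
          have e : (n : ℝ) ^ c = (n : ℝ) ^ r / (n : ℝ) ^ (α / 2) * (n : ℝ) ^ (1 - β) / (n : ℝ) ^ (1 / 2 : ℝ) := by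
            rw [← Real.rpow_sub hn', ← Real.rpow_add hn', ← Real.rpow_sub hn']
            congr 1; rw [hc]; ring
          rw [denseMean, sqrt_rpow hn'.le, Real.sqrt_eq_rpow, e]; ring
      _ ≤ denseMean α r n * overlap (blockLength α n) S (0, D) / √(n : ℝ) := by
          have : 0 ≤ denseMean α r n := by unfold denseMean; positivity
          gcongr
          exact hG S hS
      _ ≤ _ := by
          have : 0 ≤ denseMean α r n := by unfold denseMean; positivity
          have h0 : 0 < √(((0, D) : ℕ × ℕ).2 - ((0, D) : ℕ × ℕ).1 : ℝ) := Real.sqrt_pos.2 (by linarith)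
          gcongr
  linarith

/-! ### The sparse case above the boundary -/

/-- The maximum of about `n ^ κ` independent standardized sums exceeds `(√(2 κ) - ζ) √(log n)` with
high probability. -/
lemma eventually_nullLaw_forall_stdSum_le {κ ζ δ : ℝ} (hκ : 0 ≤ κ) (hζ : 0 < ζ) (hδ : 0 < δ) :
    ∀ᶠ n : ℕ in atTop, ∀ F ⊆ allIntervals n,
      (∀ I ∈ F, ∀ J ∈ F, I ≠ J → Disjoint (Finset.Ioc I.1 I.2) (Finset.Ioc J.1 J.2)) →
      (n : ℝ) ^ κ ≤ 2 * F.card →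
      (nullLaw n).real {z | ∀ I ∈ F, stdSum n z I ≤ (√(2 * κ) - ζ) * √(Real.log n)} ≤ δ := by
  set t := √(2 * κ) - ζ with ht
  rcases le_or_gt 0 t with ht0 | ht0
  · have hsq : t ^ 2 < 2 * κ := by
      have h1 : t < √(2 * κ) := by linarith
      calc t ^ 2 < √(2 * κ) ^ 2 := by gcongr
        _ = 2 * κ := Real.sq_sqrt (by linarith)
    set ν := (κ - t ^ 2 / 2) / 2 with hν
    have hν0 : 0 < ν := by rw [hν]; linarith
    have hlim : Tendsto (fun n : ℕ => Real.exp (-((n : ℝ) ^ ν / 6))) atTop (𝓝 0) :=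
      Real.tendsto_exp_neg_atTop_nhds_zero.comp
        (((tendsto_rpow_atTop hν0).comp tendsto_natCast_atTop_atTop).atTop_div_const (by norm_num))
    filter_upwards [eventually_gt_atTop 0, (tendsto_order.1 hlim).2 δ hδ,
      tendsto_sqrt_log.eventually_ge_atTop 1,
      tendsto_sqrt_log.eventually_ge_atTop ((t + 1 / 2) / ν)] with n hn hexp hs1 hs F hF hd hcard
    have hn' : (0 : ℝ) < n := by exact_mod_cast hn
    set s := √(Real.log n) with hsdef
    have hL : s ^ 2 = Real.log n := Real.sq_sqrt (Real.log_natCast_nonneg n)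
    have hx : (t * s + 1) ^ 2 / 2 ≤ (κ - ν) * Real.log n := by
      rw [div_le_iff₀ hν0] at hs
      have h1 : (t + 1 / 2) * s ≤ s * ν * s := by gcongr
      have h2 : t ^ 2 = 2 * (κ - 2 * ν) := by rw [hν]; ring
      rw [← hL]
      calc (t * s + 1) ^ 2 / 2 = t ^ 2 * s ^ 2 / 2 + (t * s + 1 / 2) := by ring
        _ ≤ t ^ 2 * s ^ 2 / 2 + s * ν * s := by linarith
        _ = (κ - ν) * s ^ 2 := by rw [h2]; ring
    have hp : (n : ℝ) ^ (-(κ - ν)) ≤ Real.exp (-(t * s + 1) ^ 2 / 2) := by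
      rw [Real.rpow_def_of_pos hn']
      refine Real.exp_le_exp.2 ?_
      rw [neg_div]; linarith
    have hp1 : Real.exp (-(t * s + 1) ^ 2 / 2) ≤ 1 := by
      refine Real.exp_le_one_iff.2 ?_
      rw [neg_div]; linarith [sq_nonneg (t * s + 1)]
    refine (nullLaw_forall_stdSum_le F hF hd (x := t * s) (by positivity)).trans
      (le_trans ?_ hexp.le)
    set p := Real.exp (-(t * s + 1) ^ 2 / 2)
    calc (1 - p / 3) ^ F.card ≤ Real.exp (-(p / 3)) ^ F.card := by
          gcongr
          · linarith
          · linarith [Real.add_one_le_exp (-(p / 3))]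
      _ = Real.exp (-(F.card * p / 3)) := by rw [← Real.exp_nat_mul]; congr 1; ring
      _ ≤ _ := by
          refine Real.exp_le_exp.2 (neg_le_neg ?_)
          calc (n : ℝ) ^ ν / 6 = (n : ℝ) ^ κ / 2 * (n : ℝ) ^ (-(κ - ν)) / 3 := by
                rw [show (n : ℝ) ^ ν = (n : ℝ) ^ (κ + -(κ - ν)) by congr 1; ring,
                  Real.rpow_add hn']
                ring
            _ ≤ F.card * p / 3 := by gcongr; linarith
  · -- the level is negative and tends to `-∞`, so that one interval suffices
    have hlim : Tendsto (fun n : ℕ => Real.exp (-(-(t / 2) * √(Real.log n)) ^ 2 / 2)) atTop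
        (𝓝 0) := by
      have h1 := tendsto_sqrt_log.const_mul_atTop (by linarith : 0 < -(t / 2))
      have h2 := ((tendsto_pow_atTop (two_ne_zero)).comp h1).atTop_div_const
        (by norm_num : (0 : ℝ) < 2)
      refine (Real.tendsto_exp_neg_atTop_nhds_zero.comp h2).congr fun n => ?_
      simp only [Function.comp_apply, neg_div]
    filter_upwards [eventually_gt_atTop 0, (tendsto_order.1 hlim).2 δ hδ,
      tendsto_sqrt_log.eventually_gt_atTop 0] with n hn hexp hs F hF _ hcard
    have hn' : (0 : ℝ) < n := by exact_mod_cast hn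
    have hne : F.Nonempty := by
      rw [← Finset.card_pos]
      have : 0 < (n : ℝ) ^ κ := by positivity
      have : (0 : ℝ) < F.card := by linarith
      exact_mod_cast this
    obtain ⟨I, hI⟩ := hne
    refine le_trans (measureReal_mono fun z hz => ?_)
      ((nullLaw_stdSum_lt_le (hF hI) (x := -(t / 2) * √(Real.log n))
        (mul_nonneg (by linarith) hs.le)).trans hexp.le)
    have h1 : stdSum n z I ≤ t * √(Real.log n) := hz I hI
    have h2 : t * √(Real.log n) < 0 := mul_neg_of_neg_of_pos ht0 hs
    change stdSum n z I < -(-(t / 2) * √(Real.log n))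
    linarith

lemma eventually_le_blockLength {α θ : ℝ} (hα : 0 ≤ α) (hθ : 0 < θ) :
    ∀ᶠ n : ℕ in atTop, (1 - θ) * (n : ℝ) ^ α ≤ blockLength α n := by
  rcases hα.eq_or_lt with rfl | hα
  · refine Eventually.of_forall fun n => ?_
    simp only [blockLength, Real.rpow_zero, Nat.floor_one, Nat.cast_one]
    linarith
  · filter_upwards [((tendsto_rpow_atTop hα).comp tendsto_natCast_atTop_atTop).eventually_ge_atTop
      (1 / θ)] with n hn
    have h1 : 1 / θ ≤ (n : ℝ) ^ α := hn
    rw [div_le_iff₀ hθ] at h1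
    have h2 := Nat.lt_floor_add_one ((n : ℝ) ^ α)
    have e : (blockLength α n : ℝ) = ⌊(n : ℝ) ^ α⌋₊ := rfl
    linarith

lemma overlap_eq_of_subset_block {b : ℕ} {S : Finset ℕ} {j : ℕ} (hj : j ∈ S) {J : ℕ × ℕ}
    (h1 : j ≤ J.1) (h2 : J.2 ≤ j + b) : overlap b S J = J.2 - J.1 := by
  rw [overlap, Finset.inter_eq_left.2, Nat.card_Ioc]
  intro x hx
  rw [Finset.mem_Ioc] at hx
  simp only [support, Finset.mem_biUnion, Finset.mem_Ioc]
  exact ⟨j, hj, by omega, by omega⟩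

/-- Deterministic part of the penalized sum over an interval that fills almost all of a block. -/
lemma signal_sub_penalty_ge {n : ℕ} {α r θ : ℝ} {J : ℕ × ℕ} (hn : 0 < n)
    (hJ : J ∈ allIntervals n) (hθ : 0 < θ) (hθ1 : θ < 1 / 2)
    (hlen : (1 - θ) ^ 2 * (n : ℝ) ^ α ≤ (J.2 : ℝ) - J.1) :
    (√2 * √r * (1 - θ) - √2 * √(1 - α)) * √(Real.log n) - √(2 * (1 + Real.log 4))
      ≤ sparseMean α r n * ((J.2 : ℝ) - J.1) / √((J.2 : ℝ) - J.1) - penalty n J := by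
  have hn' : (0 : ℝ) < n := by exact_mod_cast hn
  have hL := Real.log_natCast_nonneg n
  set ℓ := (J.2 : ℝ) - J.1 with hℓ
  have hℓ1 : 1 ≤ ℓ := len_pos hJ
  have hA : 0 < (n : ℝ) ^ α := by positivity
  have h1 : √2 * √r * (1 - θ) * √(Real.log n) ≤ sparseMean α r n * ℓ / √ℓ := by
    have a1 : (1 - θ) * √((n : ℝ) ^ α) ≤ √ℓ := by
      rw [← Real.sqrt_sq (by linarith : 0 ≤ 1 - θ), ← Real.sqrt_mul (by positivity)]
      exact Real.sqrt_le_sqrt hlen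
    have a2 : 0 < √((n : ℝ) ^ α) := Real.sqrt_pos.2 hA
    rw [sparseMean, sqrt_mul_log r hL, mul_div_assoc, Real.div_sqrt, div_mul_eq_mul_div,
      le_div_iff₀ a2]
    calc √2 * √r * (1 - θ) * √(Real.log n) * √((n : ℝ) ^ α)
        = √2 * √r * √(Real.log n) * ((1 - θ) * √((n : ℝ) ^ α)) := by ring
      _ ≤ _ := by gcongr
  have h2 : penalty n J ≤ √(2 * (1 + Real.log 4)) + √2 * √(1 - α) * √(Real.log n) := by
    rw [penalty_eq hJ, ← sqrt_mul_log _ hL]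
    refine le_trans (Real.sqrt_le_sqrt ?_) (sqrt_add_le _ _)
    have b1 : (1 / 4 : ℝ) * (n : ℝ) ^ α ≤ ℓ := by
      refine le_trans ?_ hlen
      gcongr
      nlinarith
    have b2 := Real.log_le_log (by positivity) b1
    rw [Real.log_mul (by norm_num) hA.ne', Real.log_rpow hn', one_div, Real.log_inv] at b2
    linarith
  linarith

open Classical in
/-- Above the sparse boundary the best of the intervals that fill the blocks exceeds its penalty. -/
theorem hasAsymptoticPowerOne_sparse {α β r : ℝ} (hα₀ : 0 ≤ α) (hα₁ : α < 1) (hβ : 0 ≤ β)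
    (hαβ₁ : α + β ≤ 1) (hr : √(1 - α) - √(1 - α - β) < √r)
    {F : ℕ → Finset (ℕ × ℕ)} (hF : ∀ n, F n ⊆ allIntervals n) (hA : ∀ n, appIntervals n ⊆ F n) :
    HasAsymptoticPowerOne (fun n => maxOver n (F n)) (altLaw α β (sparseMean α r)) := by
  have hne := eventually_nonempty_of_appIntervals_subset hA
  have hP := eventually_placements_nonempty hα₀ hβ
  set κ := 1 - α - β with hκ
  set H := √2 * (√κ + √r - √(1 - α)) with hH
  have hH0 : 0 < H := mul_pos (by positivity) (by linarith)
  obtain ⟨θ, hθ0, hθ⟩ : ∃ θ, 0 < θ ∧ θ < min (1 / 2) (H / (4 * (√2 * √r + 1))) :=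
    exists_between (by positivity)
  have hθ1 : θ < 1 / 2 := hθ.trans_le (min_le_left _ _)
  have hθr : √2 * √r * θ ≤ H / 4 := by
    have h := hθ.trans_le (min_le_right _ _)
    rw [lt_div_iff₀ (by positivity)] at h
    linarith
  refine hasAsymptoticPowerOne_of_tendsto (fun n => H / 8 * √(Real.log n)) ?_
    (tendsto_typeII hne hP fun δ hδ => ?_)
  · refine squeeze_zero' (Eventually.of_forall fun n => measureReal_nonneg) ?_
      (tendsto_nullLaw_penalized_gt (by positivity : 0 < H / 8))
    filter_upwards [hne] with n hn
    refine measureReal_mono fun z hz => ?_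
    obtain ⟨I, hI, h⟩ := (lt_maxOver_iff hn).1 hz
    exact ⟨I, hF n hI, h⟩
  filter_upwards [eventually_gt_atTop 0, eventually_le_blockLength hα₀ hθ0,
    eventually_exists_inner_mem_appIntervals hα₁ hθ0 hθ1,
    eventually_nullLaw_forall_stdSum_le (κ := κ) (by linarith) (by positivity : 0 < H / 4) hδ,
    (tendsto_sqrt_log.const_mul_atTop (by positivity : 0 < H / 8)).eventually_ge_atTop
      (√(2 * (1 + Real.log 4)))] with n hn hb hinner hnoise hlarge
  refine ⟨_, subset_rfl, by simpa using by positivity, fun S hS => ?_⟩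
  set b := blockLength α n with hbdef
  have hSP := mem_placements.1 hS
  have hbpos : 0 < b := blockLength_pos hα₀ hn
  have hex : ∀ j ∈ S, ∃ J ∈ appIntervals n, j ≤ J.1 ∧ J.2 ≤ j + b ∧
      (1 - θ) * b ≤ (J.2 : ℝ) - J.1 := fun j hj =>
    hinner b j hbpos (blockLength_le α n) (hSP.2.2.1 j hj)
  choose! J hJA hJ1 hJ2 hJlen using hex
  have hJall : ∀ j ∈ S, J j ∈ allIntervals n := fun j hj => appIntervals_subset n (hJA j hj)
  have hJlt : ∀ j ∈ S, (J j).1 < (J j).2 := fun j hj => (mem_allIntervals.1 (hJall j hj)).1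
  have hsep : ∀ i ∈ S, ∀ j ∈ S, i ≠ j → (J i).2 ≤ (J j).1 ∨ (J j).2 ≤ (J i).1 := by
    intro i hi j hj hij
    have h1 := (disjoint_blocks_iff hbpos).1 (hSP.2.2.2 i hi j hj hij)
    have := hJ1 i hi; have := hJ2 i hi; have := hJ1 j hj; have := hJ2 j hj
    omega
  have hinj : Set.InjOn J S := by
    intro i hi j hj hij
    by_contra hne'
    have h1 := hsep i hi j hj hne'
    have h2 := hJlt i hi
    rw [hij] at h1 h2
    omega
  have hcard : (n : ℝ) ^ κ ≤ 2 * (S.image J).card := by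
    rw [Finset.card_image_of_injOn hinj, hSP.2.1]
    exact rpow_le_numBlocks hαβ₁ hn
  refine le_trans (measureReal_mono fun z hz => ?_) (hnoise (S.image J) ?_ ?_ hcard)
  · intro I hI
    obtain ⟨j, hj, rfl⟩ := Finset.mem_image.1 hI
    have h1 := (le_maxOver (hA n (hJA j hj))).trans hz
    rw [penalizedSum_observe (hJall j hj), overlap_eq_of_subset_block hj (hJ1 j hj) (hJ2 j hj),
      Nat.cast_sub (hJlt j hj).le] at h1
    have hlen : (1 - θ) ^ 2 * (n : ℝ) ^ α ≤ ((J j).2 : ℝ) - (J j).1 := by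
      refine le_trans ?_ (hJlen j hj)
      rw [sq, mul_assoc]
      exact mul_le_mul_of_nonneg_left hb (by linarith)
    have h2 := signal_sub_penalty_ge (r := r) hn (hJall j hj) hθ0 hθ1 hlen
    have h3 : √2 * √r * θ * √(Real.log n) ≤ H / 4 * √(Real.log n) := by gcongr
    have h4 : √(2 * κ) * √(Real.log n) = √2 * √κ * √(Real.log n) := by
      rw [Real.sqrt_mul (by norm_num)]
    have h5 : H * √(Real.log n) = √2 * √κ * √(Real.log n) + √2 * √r * √(Real.log n)
        - √2 * √(1 - α) * √(Real.log n) := by rw [hH]; ring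
    have h6 : 0 ≤ H * √(Real.log n) := by positivity
    linarith
  · intro I hI
    obtain ⟨j, hj, rfl⟩ := Finset.mem_image.1 hI
    exact hJall j hj
  · intro I hI I' hI' hII
    obtain ⟨i, hi, rfl⟩ := Finset.mem_image.1 hI
    obtain ⟨j, hj, rfl⟩ := Finset.mem_image.1 hI'
    have h := hsep i hi j hj fun h => hII (by rw [h])
    rw [Finset.disjoint_left]
    intro x hx hx'
    rw [Finset.mem_Ioc] at hx hx'
    omega

/-! ### The boundaries -/

/-- The sparse branch exceeds the dense branch by a square that vanishes only where the two branches
of `rhoStar` meet. -/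
lemma sparse_sub_dense_eq {a β : ℝ} (ha : 0 ≤ a) (hβ : β ≤ a) :
    (√a - √(a - β)) ^ 2 - (β - a / 2) = 2 * (√(a - β) - √a / 2) ^ 2 := by
  have h1 := Real.sq_sqrt ha
  have h2 := Real.sq_sqrt (sub_nonneg.2 hβ)
  linear_combination (1 / 2) * h1 - h2

lemma rhoPen_of_dense {α β : ℝ} (hα₁ : α < 1) (h : β < (1 - α) / 2) :
    rhoPen α β = β - (1 - α) / 2 :=
  if_pos ((div_lt_iff₀ (by linarith)).2 (by linarith))

lemma rhoPen_of_sparse {α β : ℝ} (hα₁ : α < 1) (h : (1 - α) / 2 ≤ β) :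
    rhoPen α β = (√(1 - α) - √(1 - α - β)) ^ 2 :=
  if_neg (not_lt.2 ((le_div_iff₀ (by linarith)).2 (by linarith)))

lemma rhoStar_of_lt {α β : ℝ} (hα₁ : α < 1) (h : β < 3 * (1 - α) / 4) :
    rhoStar α β = β - (1 - α) / 2 :=
  if_pos ((div_lt_iff₀ (by linarith)).2 (by linarith))

lemma rhoStar_of_ge {α β : ℝ} (hα₁ : α < 1) (h : 3 * (1 - α) / 4 ≤ β) :
    rhoStar α β = (√(1 - α) - √(1 - α - β)) ^ 2 :=
  if_neg (not_lt.2 ((le_div_iff₀ (by linarith)).2 (by linarith)))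

lemma rhoStar_lt_rhoPen {α β : ℝ} (hα₁ : α < 1) (h1 : (1 - α) / 2 < β)
    (h2 : β < 3 * (1 - α) / 4) : rhoStar α β < rhoPen α β := by
  rw [rhoPen_of_sparse hα₁ h1.le, rhoStar_of_lt hα₁ h2, ← sub_pos,
    sparse_sub_dense_eq (by linarith) (by linarith)]
  have h : √(1 - α) / 2 < √(1 - α - β) := by
    refine Real.lt_sqrt_of_sq_lt ?_
    rw [div_pow, Real.sq_sqrt (by linarith)]
    linarith
  have := sub_pos.2 h
  positivity

lemma rhoPen_eq_rhoStar {α β : ℝ} (hα₁ : α < 1) (h : β < (1 - α) / 2 ∨ 3 * (1 - α) / 4 ≤ β) :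
    rhoPen α β = rhoStar α β := by
  rcases h with h | h
  · rw [rhoPen_of_dense hα₁ h, rhoStar_of_lt hα₁ (by linarith)]
  · rw [rhoPen_of_sparse hα₁ (by linarith), rhoStar_of_ge hα₁ h]

/-- The dense boundary, for every scan between the one over the approximating set and the one over
all intervals. -/
theorem isDetectionBoundary_dense {α β : ℝ} (hα₀ : 0 ≤ α) (hα₁ : α < 1) (hβ : 0 ≤ β)
    (hαβ₀ : 0 < α + β) (hd : β < (1 - α) / 2)
    {F : ℕ → Finset (ℕ × ℕ)} (hF : ∀ n, F n ⊆ allIntervals n) (hA : ∀ n, appIntervals n ⊆ F n) :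
    IsDetectionBoundary (fun n => maxOver n (F n)) (fun r => altLaw α β (denseMean α r)) Set.univ
      (rhoPen α β) := by
  rw [rhoPen_of_dense hα₁ hd]
  exact fun r _ => ⟨fun hr => hasAsymptoticPowerOne_dense hα₀ hα₁ hβ hαβ₀ hd hr hF hA,
    fun hr => isPowerless_dense hα₀ hβ (by linarith) hd hr hF
      (eventually_nonempty_of_appIntervals_subset hA)⟩

/-- The sparse boundary, for every scan between the one over the approximating set and the one over
all intervals. -/
theorem isDetectionBoundary_sparse {α β : ℝ} (hα₀ : 0 ≤ α) (hα₁ : α < 1) (hβ : 0 ≤ β)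
    (hαβ₁ : α + β ≤ 1) (hd : (1 - α) / 2 < β)
    {F : ℕ → Finset (ℕ × ℕ)} (hF : ∀ n, F n ⊆ allIntervals n) (hA : ∀ n, appIntervals n ⊆ F n) :
    IsDetectionBoundary (fun n => maxOver n (F n)) (fun r => altLaw α β (sparseMean α r))
      (Set.Ioi 0) (rhoPen α β) := by
  rw [rhoPen_of_sparse hα₁ hd.le]
  have h0 : 0 ≤ √(1 - α) - √(1 - α - β) := sub_nonneg.2 (Real.sqrt_le_sqrt (by linarith))
  intro r hr0
  refine ⟨fun hr => ?_, fun hr => ?_⟩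
  · exact hasAsymptoticPowerOne_sparse hα₀ hα₁ hβ hαβ₁ (Real.lt_sqrt_of_sq_lt hr) hF hA
  · exact isPowerless_sparse hα₀ (by linarith) hαβ₁ hd ((Real.sqrt_lt' (by
      refine h0.lt_of_ne fun h => ?_
      rw [← h] at hr
      simp only [Set.mem_Ioi] at hr0
      linarith)).2 hr) hF hA

end BlockScan

theorem theorem9 (α β : ℝ) (hα₀ : 0 ≤ α) (hα₁ : α < 1) (hβ : 0 ≤ β)
    (hαβ₀ : 0 < α + β) (hαβ₁ : α + β ≤ 1) :
    -- dense case
    (β / (1 - α) < 1 / 2 →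
      BlockScan.IsDetectionBoundary BlockScan.scan
          (fun r => BlockScan.altLaw α β (BlockScan.denseMean α r)) Set.univ
          (BlockScan.rhoPen α β) ∧
        BlockScan.IsDetectionBoundary BlockScan.scanApp
          (fun r => BlockScan.altLaw α β (BlockScan.denseMean α r)) Set.univ
          (BlockScan.rhoPen α β)) ∧
    -- sparse case
    (1 / 2 < β / (1 - α) →
      BlockScan.IsDetectionBoundary BlockScan.scan
          (fun r => BlockScan.altLaw α β (BlockScan.sparseMean α r)) (Set.Ioi 0)
          (BlockScan.rhoPen α β) ∧
        BlockScan.IsDetectionBoundary BlockScan.scanApp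
          (fun r => BlockScan.altLaw α β (BlockScan.sparseMean α r)) (Set.Ioi 0)
          (BlockScan.rhoPen α β)) ∧
    -- comparison with the optimal boundary
    ((1 - α) / 2 < β → β < 3 * (1 - α) / 4 →
      BlockScan.rhoStar α β < BlockScan.rhoPen α β) ∧
    (β < (1 - α) / 2 ∨ 3 * (1 - α) / 4 ≤ β →
      BlockScan.rhoPen α β = BlockScan.rhoStar α β) := by
  have ha : 0 < 1 - α := sub_pos.2 hα₁
  refine ⟨fun h => ?_, fun h => ?_, BlockScan.rhoStar_lt_rhoPen hα₁,
    BlockScan.rhoPen_eq_rhoStar hα₁⟩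
  · rw [div_lt_iff₀ ha] at h
    exact ⟨BlockScan.isDetectionBoundary_dense hα₀ hα₁ hβ hαβ₀ (by linarith)
        (F := BlockScan.allIntervals) (fun _ => subset_rfl) BlockScan.appIntervals_subset,
      BlockScan.isDetectionBoundary_dense hα₀ hα₁ hβ hαβ₀ (by linarith)
        (F := BlockScan.appIntervals) BlockScan.appIntervals_subset fun _ => subset_rfl⟩
  · rw [lt_div_iff₀ ha] at h
    exact ⟨BlockScan.isDetectionBoundary_sparse hα₀ hα₁ hβ hαβ₁ (by linarith)
        (F := BlockScan.allIntervals) (fun _ => subset_rfl) BlockScan.appIntervals_subset,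
      BlockScan.isDetectionBoundary_sparse hα₀ hα₁ hβ hαβ₁ (by linarith)
        (F := BlockScan.appIntervals) BlockScan.appIntervals_subset fun _ => subset_rfl⟩
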